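/- Let $D\ge 3$. For a metric $g_{ab}$ (mostly-plus signature) with Riemann tensor $R_{abcd}$, let an invariant of curvature order $n\ge 0$ be a real linear combination of complete contractions of $n$ Riemann tensors with inverse metrics (for $n=0$: a constant). A theory is a Lagrangian $\mathcal L(g^{ab},R_{abcd})$ that is a sum of such invariants of orders $0,1,2,\dots$; the sum is either finite or a formal expansion in the curvature order. With $P^{abcd}=\partial\mathcal L/\partial R_{abcd}$ its equations of motion are $$\mathcal E_{ab}=P_{acde}R_b{}^{cde}-\tfrac12\mathcal L\,g_{ab}+2\nabla^c\nabla^dP_{acbd}=0$$ (for a formal expansion: the formal series of the contributions of all orders). Consider the FLRW configurations $$ds^2=-F(t)\,dt^2+a(t)^2\Big(\frac{dr^2}{1-kr^2}+r^2d\Omega_{D-2}^2\Big),\qquad k\in\{-1,0,1\},\quad a,F>0\ \text{smooth}.$$ A theory is a *Cosmological Gravity* if $\mathcal E_{ab}$ on FLRW configurations involves $a$, $F$ and their time derivatives only up to second order. It is *trivial* if $\mathcal E_{ab}$ vanishes on all FLRW configurations. Two Cosmological Gravities are *equivalent* if both are trivial, or if neither is trivial and their $\mathcal E_{ab}$ on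 FLRW configurations are linearly dependent over $\mathbb R$. Let $R$ be the Ricci scalar, $Z_{ab}=R_{ab}-\frac1D g_{ab}R$ the traceless Ricci tensor, $$\mathcal K_2=\frac{Z_{ab}Z^{ab}}{D(D-1)},\qquad \mathcal K_3=-\frac{Z_{ab}Z^{bc}Z_c{}^a}{D(D-1)(D-2)},$$ and $$\mathcal C^{(n)}=R^n-\sum_{p=1}^{\lfloor n/2\rfloor}(2p-1)\binom n{2p}\Big(\frac{D(D-1)}{D-2}\Big)^{2p}R^{n-2p}(4\mathcal K_2)^p-\sum_{p=1}^{\lfloor (n-1)/2\rfloor}16p\binom n{2p+1}\Big(\frac{D(D-1)}{D-2}\Big)^{2p+1}R^{n-2p-1}(4\mathcal K_2)^{p-1}\mathcal K_3 ,$$ where empty sums are zero, so that $\mathcal C^{(0)}=1$ and $\mathcal C^{(1)}=R$. **Theorem.** (1) For every $n\ge 0$, $\mathcal C^{(n)}$ is an invariant of curvature order $n$ and a Cosmological Gravity, and it is trivial if and only if $D=2n$. Every non-trivial Cosmological Gravity that is an invariant of curvature order $n$ is equivalent to $\mathcal C^{(n)}$. Hence at order $n$ there is exactly one non-trivial equivalence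 class if $D\neq 2n$, and there is none if $D=2n$. (2) Let $\ell>0$. For all real $\Lambda,\mu_1,\mu_2,\dots$ the theory $$\mathcal L_{\rm cosmo}=-2\Lambda+\sum_{p\ge 1}\mu_p\,\ell^{2p-2}\,\mathcal C^{(p)}$$ is a Cosmological Gravity, and every Cosmological Gravity is equivalent to one of this form. This holds for formal infinite expansions, and also for theories of order at most $N$, with the sum in $\mathcal L_{\rm cosmo}$ running over $1\le p\le N$, for every $N\ge 0$. -/

import Mathlib

open Finset

noncomputable section

namespace CosmoGravity

/-! ### Lagrangians built from contractions of the Riemann tensor -/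

/-- Components of a tensor with four indices in dimension `D`. -/
abbrev Tensor4 (D : ℕ) := Fin D → Fin D → Fin D → Fin D → ℝ

/-- Lagrangians `L(g^{ab}, R_{abcd})`: the arguments are the components of the inverse metric and
of the Riemann tensor with all indices down. -/
abbrev Lagrangian (D : ℕ) := Matrix (Fin D) (Fin D) ℝ → Tensor4 D → ℝ

/-- A complete contraction of `n` Riemann tensors with `2 n` inverse metrics.  The bijection `σ`
says which index slot of the Riemann tensors is attached to which slot of the inverse metrics. -/
def contraction (D n : ℕ) (σ : Fin n × Fin 4 ≃ Fin (2 * n) × Fin 2) : Lagrangian D :=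
  fun ginv Rm => ∑ i : Fin n × Fin 4 → Fin D,
    (∏ v : Fin n, Rm (i (v, 0)) (i (v, 1)) (i (v, 2)) (i (v, 3))) *
      ∏ e : Fin (2 * n), ginv (i (σ.symm (e, 0))) (i (σ.symm (e, 1)))

/-- The linear combinations of curvature invariants of order `n` in the curvature. -/
def curvatureInvariants (D n : ℕ) : Submodule ℝ (Lagrangian D) :=
  Submodule.span ℝ (Set.range (contraction D n))

/-- The Ricci tensor `R_{ab} = R_{adb}{}^d = g^{de} R_{adbe}`. -/
def ricci {D : ℕ} (ginv : Matrix (Fin D) (Fin D) ℝ) (Rm : Tensor4 D) :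
    Matrix (Fin D) (Fin D) ℝ :=
  Matrix.of fun a b => ∑ d, ∑ e, ginv d e * Rm a d b e

/-- The Ricci scalar. -/
def ricciScalar (D : ℕ) : Lagrangian D :=
  fun ginv Rm => (ricci ginv Rm * ginv).trace

/-- The traceless Ricci tensor with one index raised, `Z_a{}^b = R_a{}^b - (R / D) δ_a^b`. -/
def tracelessRicci {D : ℕ} (ginv : Matrix (Fin D) (Fin D) ℝ) (Rm : Tensor4 D) :
    Matrix (Fin D) (Fin D) ℝ :=
  ricci ginv Rm * ginv - (ricciScalar D ginv Rm / (D : ℝ)) • (1 : Matrix (Fin D) (Fin D) ℝ)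

/-- `K₂ = Z_{ab} Z^{ab} / (D (D - 1))`. -/
def K2 (D : ℕ) : Lagrangian D := fun ginv Rm =>
  1 / ((D : ℝ) * ((D : ℝ) - 1)) * (tracelessRicci ginv Rm ^ 2).trace

/-- `K₃ = - Z_{ab} Z^{bc} Z_c{}^a / (D (D - 1) (D - 2))`. -/
def K3 (D : ℕ) : Lagrangian D := fun ginv Rm =>
  -(1 / ((D : ℝ) * ((D : ℝ) - 1) * ((D : ℝ) - 2))) * (tracelessRicci ginv Rm ^ 3).trace

/-- The representative `C^{(n)}`. -/
def cosmo (D n : ℕ) : Lagrangian D := fun ginv Rm =>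
  ricciScalar D ginv Rm ^ n
    - ∑ p ∈ Icc 1 (n / 2), (2 * (p : ℝ) - 1) * (n.choose (2 * p) : ℝ)
        * ((D : ℝ) * ((D : ℝ) - 1) / ((D : ℝ) - 2)) ^ (2 * p)
        * ricciScalar D ginv Rm ^ (n - 2 * p) * (4 * K2 D ginv Rm) ^ p
    - ∑ p ∈ Icc 1 ((n - 1) / 2), 16 * (p : ℝ) * (n.choose (2 * p + 1) : ℝ)
        * ((D : ℝ) * ((D : ℝ) - 1) / ((D : ℝ) - 2)) ^ (2 * p + 1)
        * ricciScalar D ginv Rm ^ (n - 2 * p - 1) * (4 * K2 D ginv Rm) ^ (p - 1)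
        * K3 D ginv Rm

/-! ### Curvature of a metric in coordinates -/

/-- A metric in a coordinate patch: the component matrix as a function of the coordinates. -/
abbrev MetricField (D : ℕ) := (Fin D → ℝ) → Matrix (Fin D) (Fin D) ℝ

/-- The partial derivative `∂_a f` at `y`. -/
def pderiv {D : ℕ} (a : Fin D) (f : (Fin D → ℝ) → ℝ) (y : Fin D → ℝ) : ℝ :=
  fderiv ℝ f y (Pi.single a 1)

/-- The Christoffel symbols; `christoffel g y c a b` is `Γ^c_{ab}`. -/
def christoffel {D : ℕ} (g : MetricField D) (y : Fin D → ℝ) (c a b : Fin D) : ℝ :=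
  1 / 2 * ∑ d, (g y)⁻¹ c d *
    (pderiv a (fun z => g z b d) y + pderiv b (fun z => g z a d) y - pderiv d (fun z => g z a b) y)

/-- The Riemann tensor `R_{abc}{}^d = ∂_b Γ^d_{ac} - ∂_a Γ^d_{bc} + Γ^e_{ac} Γ^d_{be}
- Γ^e_{bc} Γ^d_{ae}` (for which round spheres have positive Ricci tensor). -/
def riemannUp {D : ℕ} (g : MetricField D) (y : Fin D → ℝ) : Tensor4 D := fun a b c d =>
  pderiv b (fun z => christoffel g z d a c) y - pderiv a (fun z => christoffel g z d b c) y
    + ∑ e, (christoffel g y e a c * christoffel g y d b e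
      - christoffel g y e b c * christoffel g y d a e)

/-- The Riemann tensor with all indices down, `R_{abcd}`. -/
def riemann {D : ℕ} (g : MetricField D) (y : Fin D → ℝ) : Tensor4 D := fun a b c d =>
  ∑ e, riemannUp g y a b c e * g y e d

/-- `∇_d T^{acbd}` for a tensor field `T` with four upper indices. -/
def div4 {D : ℕ} (g : MetricField D) (T : (Fin D → ℝ) → Tensor4 D) (y : Fin D → ℝ)
    (a c b : Fin D) : ℝ :=
  ∑ d, (pderiv d (fun z => T z a c b d) y
    + ∑ f, (christoffel g y a d f * T y f c b d + christoffel g y c d f * T y a f b d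
      + christoffel g y b d f * T y a c f d + christoffel g y d d f * T y a c b f))

/-- `∇_c V^{acb}` for a tensor field `V` with three upper indices. -/
def div3 {D : ℕ} (g : MetricField D) (V : (Fin D → ℝ) → Fin D → Fin D → Fin D → ℝ)
    (y : Fin D → ℝ) (a b : Fin D) : ℝ :=
  ∑ c, (pderiv c (fun z => V z a c b) y
    + ∑ f, (christoffel g y a c f * V y f c b + christoffel g y c c f * V y a f b
      + christoffel g y b c f * V y a c f))

/-! ### The gravitational field equations -/

/-- Antisymmetrization in each of the two index pairs and symmetrization under their exchange. -/
def pairSymm {D : ℕ} (Q : Tensor4 D) : Tensor4 D := fun a b c d =>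
  1 / 8 * (Q a b c d - Q b a c d - Q a b d c + Q b a d c
    + Q c d a b - Q d c a b - Q c d b a + Q d c b a)

/-- The projection of a four-index tensor onto the tensors with the algebraic symmetries of the
Riemann tensor. -/
def riemannProj {D : ℕ} (Q : Tensor4 D) : Tensor4 D := fun a b c d =>
  pairSymm Q a b c d
    - 1 / 3 * (pairSymm Q a b c d + pairSymm Q a c d b + pairSymm Q a d b c)

/-- `P^{abcd} = ∂L / ∂R_{abcd}`, with the algebraic symmetries of the Riemann tensor. -/
def curvatureMomentum {D : ℕ} (L : Lagrangian D) (ginv : Matrix (Fin D) (Fin D) ℝ)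
    (Rm : Tensor4 D) : Tensor4 D :=
  riemannProj fun a b c d =>
    fderiv ℝ (L ginv) Rm (Pi.single a (Pi.single b (Pi.single c (Pi.single d 1))))

/-- The gravitational field equations of `L(g^{ab}, R_{abcd})` at the metric `g`, with raised
indices: `E^{ab} = P^{acde} R^b{}_{cde} - (1/2) L g^{ab} + 2 ∇_c ∇_d P^{acbd}`. -/
def fieldEq {D : ℕ} (L : Lagrangian D) (g : MetricField D) (y : Fin D → ℝ) :
    Matrix (Fin D) (Fin D) ℝ :=
  let P : (Fin D → ℝ) → Tensor4 D := fun z => curvatureMomentum L (g z)⁻¹ (riemann g z)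
  Matrix.of fun a b =>
    (∑ c, ∑ d, ∑ e, P y a c d e * ∑ h, (g y)⁻¹ b h * riemann g y h c d e)
      - 1 / 2 * L (g y)⁻¹ (riemann g y) * (g y)⁻¹ a b
      + 2 * div3 g (div4 g P) y a b

/-! ### FLRW configurations -/

/-- The FLRW metric `- F(t) dt² + a(t)² (dr² / (1 - k r²) + r² dΩ²)` in spacetime dimension
`d + 1`, in the coordinates `y = (t, x)` with `x = r n` and `n` in the unit sphere: the spatial
part is `a² (δ_ij + k x_i x_j / (1 - k |x|²))`. -/
def flrwMetric (d : ℕ) (k : ℝ) (a F : ℝ → ℝ) : MetricField (d + 1) := fun y =>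
  Matrix.of fun μ ν =>
    Fin.cases
      (Fin.cases (-F (y 0)) (fun _ => 0) ν)
      (fun i => Fin.cases 0
        (fun j => a (y 0) ^ 2 * ((if i = j then 1 else 0)
          + k * y i.succ * y j.succ / (1 - k * ∑ l : Fin d, y l.succ ^ 2))) ν)
      μ

/-- An FLRW configuration in spacetime dimension `d + 1`, together with a point `y = (t, x)` of
its coordinate patch. -/
structure FLRWEvent (d : ℕ) where
  k : ℝ
  a : ℝ → ℝ
  F : ℝ → ℝ
  y : Fin (d + 1) → ℝ
  k_mem : k = -1 ∨ k = 0 ∨ k = 1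
  a_smooth : ContDiff ℝ (⊤ : ℕ∞) a
  F_smooth : ContDiff ℝ (⊤ : ℕ∞) F
  a_pos : ∀ t, 0 < a t
  F_pos : ∀ t, 0 < F t
  patch : 0 < 1 - k * ∑ i : Fin d, y i.succ ^ 2

/-- Equality of two functions of time and of their first two derivatives at the time `t`. -/
def SameTwoJet (f h : ℝ → ℝ) (t : ℝ) : Prop :=
  f t = h t ∧ deriv f t = deriv h t ∧ iteratedDeriv 2 f t = iteratedDeriv 2 h t

/-- Equations on FLRW configurations are of second order in time derivatives if at every point
they involve `a`, `F` and their time derivatives only up to the second order. -/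
def SecondOrder {d : ℕ} {V : Type*} (E : FLRWEvent d → V) : Prop :=
  ∀ p q : FLRWEvent d, p.k = q.k → p.y = q.y →
    SameTwoJet p.a q.a (p.y 0) → SameTwoJet p.F q.F (p.y 0) → E p = E q

/-- Equivalence of equations on FLRW configurations: they are linearly dependent, where the zero
equations are equivalent only to themselves. -/
def EquivEq {d : ℕ} {V : Type*} [AddCommGroup V] [Module ℝ V] (E₁ E₂ : FLRWEvent d → V) : Prop :=
  (E₁ = 0 ↔ E₂ = 0) ∧ ¬ LinearIndependent ℝ ![E₁, E₂]

/-! ### Cosmological Gravities -/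

/-- The equations of motion of `L` on FLRW configurations. -/
def flrwEq {d : ℕ} (L : Lagrangian (d + 1)) (p : FLRWEvent d) :
    Matrix (Fin (d + 1)) (Fin (d + 1)) ℝ :=
  fieldEq L (flrwMetric d p.k p.a p.F) p.y

/-- The Lagrangian `L` defines a Cosmological Gravity. -/
def IsCosmological {d : ℕ} (L : Lagrangian (d + 1)) : Prop := SecondOrder (flrwEq L)

/-- `L` has identically vanishing equations of motion on FLRW configurations. -/
def IsTrivial {d : ℕ} (L : Lagrangian (d + 1)) : Prop := flrwEq L = 0

/-- Equivalence of (Cosmological) Gravities. -/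
def Equivalent {d : ℕ} (L₁ L₂ : Lagrangian (d + 1)) : Prop := EquivEq (flrwEq L₁) (flrwEq L₂)

/-- A higher-curvature expansion `∑ n, L n` with `L n` of order `n` in the curvature (and the
coupling constants absorbed in `L n`). -/
def IsExpansion {D : ℕ} (L : ℕ → Lagrangian D) : Prop := ∀ n, L n ∈ curvatureInvariants D n

/-- The equations of motion of an expansion on FLRW configurations, as a formal series graded by
the curvature order: the sequence of the contributions of all orders. -/
def flrwEqSeries {d : ℕ} (L : ℕ → Lagrangian (d + 1)) (p : FLRWEvent d) :
    ℕ → Matrix (Fin (d + 1)) (Fin (d + 1)) ℝ :=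
  fun n => flrwEq (L n) p

/-- The expansion `- 2 Λ + ∑_{p ≥ 1} μ_p ℓ^{2 p - 2} C^{(p)}`. -/
def cosmoExpansion (D : ℕ) (lam ell : ℝ) (mu : ℕ → ℝ) : ℕ → Lagrangian D
  | 0 => fun _ _ => -2 * lam
  | p + 1 => (mu (p + 1) * ell ^ (2 * p)) • cosmo D (p + 1)

end CosmoGravity

end

open CosmoGravity

namespace CosmoGravity

/-! ### Sums over index assignments -/

/-! Write D = d + 1 and H = a'/a. In an orthonormal frame the Riemann tensor of an FLRW metric is
isotropic: it is fixed by the time-space sectional curvature A, which contains a'', and by the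
spatial sectional curvature B, which contains only first derivatives (`riemann_flrwMetric`). An
invariant L thus becomes a function f(A, B), called `reduced L`. Contractions are covariant under
linear frame changes (`contraction_act`), so sign flips and spatial permutations of the axes make
the momentum P isotropic too, with its two components given by ∂f/∂A and ∂f/∂B
(`IsInvariant.momentum_frame`). Hence the field equations depend on L only through f
(`IsInvariant.fieldEq_flrw`). Where A = B the curvature is maximally symmetric, and invariance under
a boost adds the constraint (d - 1) ∂f/∂A = 2 ∂f/∂B (`IsInvariant.reduced_constraint`).

The time-time equation contains the time derivative of ∂f/∂A, hence a''' multiplied by H ∂²f/∂A².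
Comparing two scale factors with equal two-jets but different third derivatives gives ∂²f/∂A² = 0
for B > 0, so that f = h(B) + A g(B) there (`IsInvariant.second_deriv_eq_zero`,
`IsInvariant.reduced_affine`). Conversely, for polynomials h and g, the identity B' = 2 H (A - B)
and the constraint make the first divergence of P vanish, and g drops out of the rest: the equations
are of second order and depend on h alone (`IsInvariant.flrwEq_of_affine`).

At curvature order n, homogeneity gives h = α Bⁿ and g = β Bⁿ⁻¹, and the constraint becomes (D - 2n)
β = 2n α. The possible equations of order n therefore lie on one line, they vanish exactly when α =
0, and this is forced when D = 2n. For the representatives with n ≥ 1, put x = R and w = 2d (A - B);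
the defining sums combine to Σ_j (1 - j) (n choose j) xⁿ⁻ʲ (-w)ʲ = (x - w)ⁿ⁻¹ (x - w + n w), where x
- w = d (d + 1) B. This is affine in A, and its α is D - 2n times a non-zero constant (`cosmo_sum`,
`reduced_cosmo_succ`).

For a truncated theory only the sum is known to be of second order. Its deviation from affinity at
(x A, x) is a polynomial in x whose coefficients are the deviations of the single orders, so every
order is affine separately (`isAffine_of_sum_isCosmological`). Matching α order by order then
produces couplings with exactly the same field equations. -/

theorem prod_sum_arrow {V S X : Type*} [Fintype V] [DecidableEq V] [Fintype S] [DecidableEq S]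
    [Fintype X] (f : V → (S → X) → ℝ) :
    ∏ v, ∑ w : S → X, f v w = ∑ j : V × S → X, ∏ v, f v (fun s => j (v, s)) := by
  rw [Finset.prod_univ_sum, Fintype.piFinset_univ]
  exact (Fintype.sum_equiv (Equiv.curry V S X) _ _ (fun j => rfl)).symm

theorem sum_arrow_fin_succ {n : ℕ} {X : Type*} [Fintype X] (f : (Fin (n + 1) → X) → ℝ) :
    ∑ w, f w = ∑ x : X, ∑ w : Fin n → X, f (Fin.cons x w) := by
  rw [← Fintype.sum_prod_type']
  exact (Fintype.sum_equiv (Fin.consEquiv (fun _ => X)) _ _ (fun j => rfl)).symm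

theorem sum_arrow_fin_two {X : Type*} [Fintype X] (f : (Fin 2 → X) → ℝ) :
    ∑ w, f w = ∑ a, ∑ b, f ![a, b] := by
  simp only [sum_arrow_fin_succ, Fintype.sum_unique]
  rfl

theorem sum_arrow_fin_three {X : Type*} [Fintype X] (f : (Fin 3 → X) → ℝ) :
    ∑ w, f w = ∑ a, ∑ b, ∑ c, f ![a, b, c] := by
  simp only [sum_arrow_fin_succ, Fintype.sum_unique]
  rfl

theorem sum_arrow_fin_four {X : Type*} [Fintype X] (f : (Fin 4 → X) → ℝ) :
    ∑ w, f w = ∑ a, ∑ b, ∑ c, ∑ d, f ![a, b, c, d] := by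
  simp only [sum_arrow_fin_succ, Fintype.sum_unique]
  rfl

/-! ### Covariance of contractions under linear maps -/

/-- The action of a matrix on all four indices of a tensor. -/
def act {D : ℕ} (M : Matrix (Fin D) (Fin D) ℝ) (R : Tensor4 D) : Tensor4 D := fun a b c d =>
  ∑ a', ∑ b', ∑ c', ∑ d', M a a' * M b b' * M c c' * M d d' * R a' b' c' d'

theorem act_eq_sum_arrow {D : ℕ} (M : Matrix (Fin D) (Fin D) ℝ) (R : Tensor4 D)
    (i : Fin 4 → Fin D) :
    act M R (i 0) (i 1) (i 2) (i 3) =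
      ∑ w : Fin 4 → Fin D, (∏ s, M (i s) (w s)) * R (w 0) (w 1) (w 2) (w 3) := by
  rw [sum_arrow_fin_four]
  simp [act, Fin.prod_univ_four]

theorem conj_eq_sum_arrow {D : ℕ} (M G : Matrix (Fin D) (Fin D) ℝ) (j : Fin 2 → Fin D) :
    (M.transpose * G * M) (j 0) (j 1) =
      ∑ w : Fin 2 → Fin D, (∏ s, M (w s) (j s)) * G (w 0) (w 1) := by
  rw [sum_arrow_fin_two]
  simp only [Matrix.mul_apply, Matrix.transpose_apply, Finset.sum_mul, Fin.prod_univ_two,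
    Matrix.cons_val_zero, Matrix.cons_val_one]
  rw [Finset.sum_comm]
  exact Finset.sum_congr rfl fun a _ => Finset.sum_congr rfl fun b _ => by ring

/-- Expanding all factors, both sides become the same double sum over labellings i and j of the
slots, with one entry M (i x) (j x) per slot x. On one side the slots are grouped by Riemann
tensors, on the other by inverse metrics. Invertibility of M plays no role. -/
theorem contraction_act {D n : ℕ} (σ : Fin n × Fin 4 ≃ Fin (2 * n) × Fin 2)
    (G M : Matrix (Fin D) (Fin D) ℝ) (R : Tensor4 D) :
    contraction D n σ G (act M R) = contraction D n σ (M.transpose * G * M) R := by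
  have h1 : ∀ i : Fin n × Fin 4 → Fin D,
      ∏ v, act M R (i (v, 0)) (i (v, 1)) (i (v, 2)) (i (v, 3)) =
        ∑ j : Fin n × Fin 4 → Fin D, (∏ x, M (i x) (j x)) *
          ∏ v, R (j (v, 0)) (j (v, 1)) (j (v, 2)) (j (v, 3)) := by
    intro i
    have := fun v => act_eq_sum_arrow M R (fun s => i (v, s))
    simp only [this]
    rw [prod_sum_arrow]
    refine Finset.sum_congr rfl fun j _ => ?_
    rw [Finset.prod_mul_distrib, Fintype.prod_prod_type]
  have h2 : ∀ j : Fin n × Fin 4 → Fin D,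
      ∏ e, (M.transpose * G * M) (j (σ.symm (e, 0))) (j (σ.symm (e, 1))) =
        ∑ i : Fin n × Fin 4 → Fin D, (∏ x, M (i x) (j x)) *
          ∏ e, G (i (σ.symm (e, 0))) (i (σ.symm (e, 1))) := by
    intro j
    have := fun e => conj_eq_sum_arrow M G (fun s => j (σ.symm (e, s)))
    simp only [this]
    rw [prod_sum_arrow]
    -- Labellings of the metric slots are labellings of the Riemann slots transported along σ.
    refine (Fintype.sum_equiv (Equiv.arrowCongr σ (Equiv.refl (Fin D))) _ _ fun i => ?_).symm
    rw [Finset.prod_mul_distrib]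
    congr 1
    rw [← Fintype.prod_prod_type (fun x : Fin (2 * n) × Fin 2 =>
      M ((Equiv.arrowCongr σ (Equiv.refl (Fin D))) i x) (j (σ.symm x)))]
    exact Fintype.prod_equiv σ _ _ fun x => by simp [Equiv.arrowCongr]
  simp only [contraction, h1, h2, Finset.sum_mul, Finset.mul_sum]
  rw [Finset.sum_comm]
  exact Finset.sum_congr rfl fun j _ => Finset.sum_congr rfl fun i _ => by ring

theorem contDiff_contraction {D n : ℕ} (σ : Fin n × Fin 4 ≃ Fin (2 * n) × Fin 2)
    (G : Matrix (Fin D) (Fin D) ℝ) : ContDiff ℝ (⊤ : ℕ∞) (contraction D n σ G) := by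
  unfold contraction
  refine ContDiff.sum fun i _ => ContDiff.mul (contDiff_prod fun v _ => ?_) contDiff_const
  exact contDiff_apply_apply_apply_apply i v
where
  contDiff_apply_apply_apply_apply (i : Fin n × Fin 4 → Fin D) (v : Fin n) :
    ContDiff ℝ (⊤ : ℕ∞) fun R : Tensor4 D => R (i (v, 0)) (i (v, 1)) (i (v, 2)) (i (v, 3)) := by
    fun_prop

theorem contraction_smul {D n : ℕ} (σ : Fin n × Fin 4 ≃ Fin (2 * n) × Fin 2)
    (G : Matrix (Fin D) (Fin D) ℝ) (R : Tensor4 D) (c : ℝ) :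
    contraction D n σ G (c • R) = c ^ n * contraction D n σ G R := by
  simp only [contraction, Pi.smul_apply, smul_eq_mul, Finset.prod_mul_distrib, Finset.mul_sum,
    Finset.prod_const, Finset.card_univ, Fintype.card_fin, mul_assoc]

/-- Smooth Lagrangians which are invariant under linear changes of the frame. -/
structure IsInvariant {D : ℕ} (L : Lagrangian D) : Prop where
  smooth : ∀ G, ContDiff ℝ (⊤ : ℕ∞) (L G)
  covariant : ∀ G M R, L G (act M R) = L (M.transpose * G * M) R

theorem IsInvariant.zero {D : ℕ} : IsInvariant (0 : Lagrangian D) :=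
  ⟨fun _ => contDiff_const, fun _ _ _ => rfl⟩

theorem IsInvariant.add {D : ℕ} {L L' : Lagrangian D} (h : IsInvariant L) (h' : IsInvariant L') :
    IsInvariant (L + L') :=
  ⟨fun G => (h.smooth G).add (h'.smooth G), fun G M R => by
    simp only [Pi.add_apply, h.covariant, h'.covariant]⟩

theorem IsInvariant.smul {D : ℕ} {L : Lagrangian D} (h : IsInvariant L) (c : ℝ) :
    IsInvariant (c • L) :=
  ⟨fun G => (h.smooth G).const_smul c, fun G M R => by
    simp only [Pi.smul_apply, h.covariant]⟩

theorem IsInvariant.sum {D : ℕ} {ι : Type*} {L : ι → Lagrangian D} {s : Finset ι}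
    (h : ∀ i ∈ s, IsInvariant (L i)) : IsInvariant (∑ i ∈ s, L i) :=
  Finset.sum_induction _ _ (fun _ _ => IsInvariant.add) IsInvariant.zero h

theorem isInvariant_of_mem {D n : ℕ} {L : Lagrangian D} (h : L ∈ curvatureInvariants D n) :
    IsInvariant L := by
  induction h using Submodule.span_induction with
  | mem x hx =>
    obtain ⟨σ, rfl⟩ := hx
    exact ⟨contDiff_contraction σ, contraction_act σ⟩
  | zero => exact IsInvariant.zero
  | add x y _ _ hx hy => exact hx.add hy
  | smul c x _ hx => exact hx.smul c

theorem homogeneous_of_mem {D n : ℕ} {L : Lagrangian D} (h : L ∈ curvatureInvariants D n)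
    (G : Matrix (Fin D) (Fin D) ℝ) (R : Tensor4 D) (c : ℝ) : L G (c • R) = c ^ n * L G R := by
  induction h using Submodule.span_induction with
  | mem x hx =>
    obtain ⟨σ, rfl⟩ := hx
    exact contraction_smul σ G R c
  | zero => simp
  | add x y _ _ hx hy => simp only [Pi.add_apply, hx, hy, mul_add]
  | smul a x _ hx => simp only [Pi.smul_apply, hx, smul_eq_mul]; ring

/-! ### Products of curvature invariants -/

/-- A complete contraction with arbitrary finite sets of vertices and edges. -/
def graphContraction (D : ℕ) {V E : Type*} [Fintype V] [Fintype E] [DecidableEq V]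
    (σ : V × Fin 4 ≃ E × Fin 2) : Lagrangian D :=
  fun ginv Rm => ∑ i : V × Fin 4 → Fin D,
    (∏ v : V, Rm (i (v, 0)) (i (v, 1)) (i (v, 2)) (i (v, 3))) *
      ∏ e : E, ginv (i (σ.symm (e, 0))) (i (σ.symm (e, 1)))

/-- Counting slots gives 4 |V| = 2 |E|, so the number of edges is forced, and any enumeration of
vertices and edges yields a standard contraction. -/
theorem graphContraction_mem (D : ℕ) {V E : Type*} [Fintype V] [Fintype E] [DecidableEq V]
    (σ : V × Fin 4 ≃ E × Fin 2) {n : ℕ} (hn : Fintype.card V = n) :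
    graphContraction D σ ∈ curvatureInvariants D n := by
  have hE : Fintype.card E = 2 * n := by
    have := Fintype.card_congr σ
    simp only [Fintype.card_prod, Fintype.card_fin] at this
    omega
  let eV := Fintype.equivFinOfCardEq hn
  let eE := Fintype.equivFinOfCardEq hE
  let τ : Fin n × Fin 4 ≃ Fin (2 * n) × Fin 2 :=
    ((Equiv.prodCongr eV (Equiv.refl _)).symm.trans σ).trans (Equiv.prodCongr eE (Equiv.refl _))
  have : graphContraction D σ = contraction D n τ := by
    funext G R
    refine Fintype.sum_equiv (Equiv.arrowCongr (Equiv.prodCongr eV (Equiv.refl (Fin 4)))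
      (Equiv.refl (Fin D))) _ _ fun i => ?_
    congr 1
    · exact Fintype.prod_equiv eV _ _ fun v => by simp [Equiv.arrowCongr]
    · exact Fintype.prod_equiv eE _ _ fun v => by
        simp only [Equiv.arrowCongr, τ, Equiv.symm_trans_apply, Equiv.coe_fn_mk,
          Function.comp_apply, Equiv.refl_apply]
        simp [Prod.map]
  rw [this]
  exact Submodule.subset_span ⟨τ, rfl⟩

/-- Multiplying contractions amounts to taking the disjoint union of their graphs. -/
theorem contraction_mul_contraction (D : ℕ) {n m : ℕ} (σ : Fin n × Fin 4 ≃ Fin (2 * n) × Fin 2)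
    (τ : Fin m × Fin 4 ≃ Fin (2 * m) × Fin 2) :
    contraction D n σ * contraction D m τ = graphContraction D
      (((Equiv.sumProdDistrib _ _ _).trans (Equiv.sumCongr σ τ)).trans
        (Equiv.sumProdDistrib _ _ _).symm) := by
  funext G R
  simp only [Pi.mul_apply, contraction, graphContraction]
  rw [Fintype.sum_mul_sum, ← Fintype.sum_prod_type']
  refine Fintype.sum_equiv (((Equiv.sumArrowEquivProdArrow _ _ _).symm).trans
    (Equiv.arrowCongr (Equiv.sumProdDistrib _ _ _).symm (Equiv.refl (Fin D)))) _ _ fun i => ?_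
  have hl : ∀ x, (Equiv.sumArrowEquivProdArrow (Fin n × Fin 4) (Fin m × Fin 4) (Fin D)).symm i
      (Sum.inl x) = i.1 x := fun _ => rfl
  have hr : ∀ x, (Equiv.sumArrowEquivProdArrow (Fin n × Fin 4) (Fin m × Fin 4) (Fin D)).symm i
      (Sum.inr x) = i.2 x := fun _ => rfl
  simp only [Fintype.prod_sum_type, Equiv.arrowCongr, Equiv.trans_apply, Equiv.coe_fn_mk,
    Function.comp_apply, Equiv.refl_apply, Equiv.symm_symm, Equiv.symm_trans_apply,
    Equiv.sumProdDistrib_apply_left, Equiv.sumProdDistrib_apply_right, Equiv.sumCongr_symm,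
    Equiv.sumCongr_apply, Sum.map_inl, Sum.map_inr, Equiv.apply_symm_apply,
    hl, hr]
  ring

theorem mul_mem_curvatureInvariants {D n m : ℕ} {L L' : Lagrangian D}
    (h : L ∈ curvatureInvariants D n) (h' : L' ∈ curvatureInvariants D m) :
    L * L' ∈ curvatureInvariants D (n + m) := by
  induction h using Submodule.span_induction with
  | mem x hx =>
    obtain ⟨σ, rfl⟩ := hx
    induction h' using Submodule.span_induction with
    | mem x hx =>
      obtain ⟨τ, rfl⟩ := hx
      rw [contraction_mul_contraction]
      exact graphContraction_mem D _ (by simp)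
    | zero => rw [mul_zero]; exact Submodule.zero_mem _
    | add x y _ _ hx hy => rw [mul_add]; exact Submodule.add_mem _ hx hy
    | smul a x _ hx => rw [mul_smul_comm]; exact Submodule.smul_mem _ _ hx
  | zero => rw [zero_mul]; exact Submodule.zero_mem _
  | add x y _ _ hx hy => rw [add_mul]; exact Submodule.add_mem _ hx hy
  | smul a x _ hx => rw [smul_mul_assoc]; exact Submodule.smul_mem _ _ hx

theorem one_mem_curvatureInvariants (D : ℕ) : (1 : Lagrangian D) ∈ curvatureInvariants D 0 := by
  refine Submodule.subset_span ⟨⟨fun x => x.1.elim0, fun x => x.1.elim0, fun x => x.1.elim0,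
    fun x => x.1.elim0⟩, ?_⟩
  funext G R
  simp [contraction]

theorem pow_mem_curvatureInvariants {D n : ℕ} {L : Lagrangian D}
    (h : L ∈ curvatureInvariants D n) (k : ℕ) : L ^ k ∈ curvatureInvariants D (k * n) := by
  induction k with
  | zero => rw [pow_zero, zero_mul]; exact one_mem_curvatureInvariants D
  | succ k ih => rw [pow_succ, Nat.succ_mul]; exact mul_mem_curvatureInvariants ih h

/-- The pattern of the contraction of Ricci tensors along the cycles of a permutation: the edges
of the first kind build the Ricci tensors, those of the second kind connect them. -/
def ricciPattern {V : Type*} (ν : Equiv.Perm V) : V × Fin 4 ≃ (V ⊕ V) × Fin 2 where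
  toFun x := ![(Sum.inr (ν.symm x.1), 1), (Sum.inl x.1, 0), (Sum.inr x.1, 0), (Sum.inl x.1, 1)] x.2
  invFun y := Sum.elim (fun v => ![(v, 1), (v, 3)] y.2) (fun v => ![(v, 2), (ν v, 0)] y.2) y.1
  left_inv := by
    rintro ⟨v, s⟩
    fin_cases s <;> simp
  right_inv := by
    rintro ⟨v | v, s⟩ <;> fin_cases s <;> simp

/-- Each vertex carries a mixed Ricci tensor whose second index feeds the first index of the one at
ν v. A single cycle of length n thus produces the trace of the n-th power. -/
theorem graphContraction_ricciPattern (D : ℕ) {V : Type*} [Fintype V] [DecidableEq V]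
    (ν : Equiv.Perm V) (G : Matrix (Fin D) (Fin D) ℝ) (R : Tensor4 D) :
    graphContraction D (ricciPattern ν) G R =
      ∑ a : V → Fin D, ∏ v, (ricci G R * G) (a v) (a (ν v)) := by
  have h : ∀ a c, (ricci G R * G) a c = ∑ w : Fin 3 → Fin D,
      R a (w 0) (w 1) (w 2) * G (w 0) (w 2) * G (w 1) c := by
    intro a c
    rw [sum_arrow_fin_three]
    simp only [ricci, Matrix.mul_apply, Matrix.of_apply, Finset.sum_mul, Matrix.cons_val_zero,
      Matrix.cons_val_one, Matrix.cons_val]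
    rw [Finset.sum_comm]
    exact Finset.sum_congr rfl fun _ _ => Finset.sum_congr rfl fun _ _ =>
      Finset.sum_congr rfl fun _ _ => by ring
  simp only [h, Finset.prod_univ_sum, Fintype.piFinset_univ]
  rw [← Fintype.sum_prod_type']
  -- Slot 0 of a vertex is the row index of its Ricci factor; the other three slots are the indices
  -- summed inside that factor.
  let e : ((V → Fin D) × (V → Fin 3 → Fin D)) ≃ (V × Fin 4 → Fin D) :=
    ((Equiv.arrowProdEquivProdArrow V (fun _ => Fin D) (fun _ => Fin 3 → Fin D)).symm.trans
      (Equiv.arrowCongr (Equiv.refl V) (Fin.consEquiv (fun _ : Fin 4 => Fin D)))).trans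
      (Equiv.curry V (Fin 4) (Fin D)).symm
  have e0 : ∀ x v, e x (v, 0) = x.1 v := fun x v => rfl
  have e1 : ∀ x v, e x (v, 1) = x.2 v 0 := fun x v => rfl
  have e2 : ∀ x v, e x (v, 2) = x.2 v 1 := fun x v => rfl
  have e3 : ∀ x v, e x (v, 3) = x.2 v 2 := fun x v => rfl
  refine (Fintype.sum_equiv e _ _ fun x => ?_).symm
  simp [Fintype.prod_sum_type, ricciPattern, e0, e1, e2, e3, Finset.prod_mul_distrib, mul_assoc]

theorem trace_ricci_mem (D : ℕ) :
    (fun G R => (ricci G R * G).trace : Lagrangian D) ∈ curvatureInvariants D 1 := by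
  convert graphContraction_mem D (ricciPattern (Equiv.refl (Fin 1))) (n := 1) (by simp) using 1
  funext G R
  rw [graphContraction_ricciPattern]
  simp [sum_arrow_fin_succ, Matrix.trace]

theorem trace_ricci_sq_mem (D : ℕ) :
    (fun G R => ((ricci G R * G) ^ 2).trace : Lagrangian D) ∈ curvatureInvariants D 2 := by
  convert graphContraction_mem D (ricciPattern (finRotate 2)) (n := 2) (by simp) using 1
  funext G R
  rw [graphContraction_ricciPattern, sum_arrow_fin_two]
  simp [Matrix.trace, sq, Matrix.mul_apply (M := ricci G R * G)]

theorem trace_ricci_cube_mem (D : ℕ) :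
    (fun G R => ((ricci G R * G) ^ 3).trace : Lagrangian D) ∈ curvatureInvariants D 3 := by
  convert graphContraction_mem D (ricciPattern (finRotate 3)) (n := 3) (by simp) using 1
  funext G R
  rw [graphContraction_ricciPattern, sum_arrow_fin_three]
  have h0 : finRotate 3 0 = 1 := rfl
  have h1 : finRotate 3 1 = 2 := rfl
  have h2 : finRotate 3 2 = 0 := rfl
  simp only [Matrix.trace, pow_succ, pow_zero, one_mul, Matrix.diag_apply,
    Matrix.mul_apply (M := ricci G R * G * (ricci G R * G)),
    Matrix.mul_apply (M := ricci G R * G) (N := ricci G R * G), Finset.sum_mul,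
    Fin.prod_univ_three, h0, h1, h2, Matrix.cons_val_zero, Matrix.cons_val_one, Matrix.cons_val]
  exact Finset.sum_congr rfl fun _ _ => Finset.sum_comm

/-! ### Algebra of four-index tensors -/

/-- `X^{ac} Y^{bd} - X^{ad} Y^{bc}`. -/
def kn {D : ℕ} (X Y : Matrix (Fin D) (Fin D) ℝ) : Tensor4 D := fun a b c d =>
  X a c * Y b d - X a d * Y b c

theorem act_add {D : ℕ} (M : Matrix (Fin D) (Fin D) ℝ) (Q Q' : Tensor4 D) :
    act M (Q + Q') = act M Q + act M Q' := by
  funext a b c d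
  simp only [act, Pi.add_apply, mul_add, Finset.sum_add_distrib]

theorem act_smul {D : ℕ} (M : Matrix (Fin D) (Fin D) ℝ) (r : ℝ) (Q : Tensor4 D) :
    act M (r • Q) = r • act M Q := by
  funext a b c d
  simp only [act, Pi.smul_apply, smul_eq_mul, Finset.mul_sum]
  refine Finset.sum_congr rfl fun _ _ => Finset.sum_congr rfl fun _ _ =>
      Finset.sum_congr rfl fun _ _ => Finset.sum_congr rfl fun _ _ => by ring

/-- The action of a matrix on four-index tensors, as a linear map. -/
noncomputable def actL {D : ℕ} (M : Matrix (Fin D) (Fin D) ℝ) : Tensor4 D →L[ℝ] Tensor4 D :=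
  LinearMap.toContinuousLinearMap
    { toFun := act M, map_add' := act_add M, map_smul' := act_smul M }

@[simp] theorem actL_apply {D : ℕ} (M : Matrix (Fin D) (Fin D) ℝ) (Q : Tensor4 D) :
    actL M Q = act M Q := rfl

theorem act_sub {D : ℕ} (M : Matrix (Fin D) (Fin D) ℝ) (Q Q' : Tensor4 D) :
    act M (Q - Q') = act M Q - act M Q' := (actL M).map_sub Q Q'

theorem act_act {D : ℕ} (M N : Matrix (Fin D) (Fin D) ℝ) (Q : Tensor4 D) :
    act M (act N Q) = act (M * N) Q := by
  funext a b c d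
  have key : ∀ i : Fin 4 → Fin D, act M (act N Q) (i 0) (i 1) (i 2) (i 3) =
      act (M * N) Q (i 0) (i 1) (i 2) (i 3) := by
    intro i
    simp only [act_eq_sum_arrow M, act_eq_sum_arrow (M * N), act_eq_sum_arrow N, Matrix.mul_apply,
      Finset.prod_univ_sum, Fintype.piFinset_univ, Finset.mul_sum, Finset.sum_mul,
      Finset.prod_mul_distrib]
    rw [Finset.sum_comm]
    exact Finset.sum_congr rfl fun _ _ => Finset.sum_congr rfl fun _ _ => by ring
  exact key ![a, b, c, d]

theorem act_one {D : ℕ} (Q : Tensor4 D) : act 1 Q = Q := by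
  funext a b c d
  simp [act, Matrix.one_apply, Finset.sum_ite_eq]

theorem act_diagonal {D : ℕ} (s : Fin D → ℝ) (Q : Tensor4 D) (a b c d : Fin D) :
    act (Matrix.diagonal s) Q a b c d = s a * s b * s c * s d * Q a b c d := by
  simp [act, Matrix.diagonal_apply]

/-- The fourfold sum factorizes over the two matrices, so frame changes of isotropic tensors reduce
to congruences of matrices. -/
theorem act_kn {D : ℕ} (M X Y : Matrix (Fin D) (Fin D) ℝ) :
    act M (kn X Y) = kn (M * X * M.transpose) (M * Y * M.transpose) := by
  have h : ∀ (Z : Matrix (Fin D) (Fin D) ℝ) (a c : Fin D), (M * Z * M.transpose) a c =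
      ∑ p, ∑ q, M a p * M c q * Z p q := by
    intro Z a c
    simp only [Matrix.mul_apply, Matrix.transpose_apply, Finset.sum_mul]
    rw [Finset.sum_comm]
    exact Finset.sum_congr rfl fun _ _ => Finset.sum_congr rfl fun _ _ => by ring
  have h2 : ∀ a b c d, ∑ p, ∑ q, ∑ r, ∑ s, M a p * M b q * M c r * M d s * (X p r * Y q s) =
      (M * X * M.transpose) a c * (M * Y * M.transpose) b d := by
    intro a b c d
    simp only [h, Finset.sum_mul_sum]
    refine Finset.sum_congr rfl fun p _ => Finset.sum_congr rfl fun q _ => ?_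
    exact Finset.sum_congr rfl fun _ _ => Finset.sum_congr rfl fun _ _ => by ring
  funext a b c d
  simp only [act, kn, mul_sub, Finset.sum_sub_distrib]
  rw [h2 a b c d]
  congr 1
  rw [← h2 a b d c]
  refine Finset.sum_congr rfl fun p _ => Finset.sum_congr rfl fun q _ => ?_
  rw [Finset.sum_comm]
  exact Finset.sum_congr rfl fun _ _ => Finset.sum_congr rfl fun _ _ => by ring

/-- The adjacent transpositions generate all permutations of the four slots, and every permutation
commutes with an action that is the same on each slot. This is what makes the projection onto
Riemann symmetries equivariant. -/
theorem act_swap₁₂ {D : ℕ} (M : Matrix (Fin D) (Fin D) ℝ) (Q : Tensor4 D) (a b c d : Fin D) :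
    act M (fun a b c d => Q b a c d) a b c d = act M Q b a c d := by
  simp only [act]
  rw [Finset.sum_comm]
  simp only [mul_comm (M a _) (M b _)]

theorem act_swap₂₃ {D : ℕ} (M : Matrix (Fin D) (Fin D) ℝ) (Q : Tensor4 D) (a b c d : Fin D) :
    act M (fun a b c d => Q a c b d) a b c d = act M Q a c b d := by
  simp only [act]
  refine Finset.sum_congr rfl fun _ _ => ?_
  rw [Finset.sum_comm]
  simp only [mul_right_comm _ (M b _) (M c _)]

theorem act_swap₃₄ {D : ℕ} (M : Matrix (Fin D) (Fin D) ℝ) (Q : Tensor4 D) (a b c d : Fin D) :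
    act M (fun a b c d => Q a b d c) a b c d = act M Q a b d c := by
  simp only [act]
  refine Finset.sum_congr rfl fun _ _ => Finset.sum_congr rfl fun _ _ => ?_
  rw [Finset.sum_comm]
  simp only [mul_right_comm _ (M c _) (M d _)]

theorem act_swap_pairs {D : ℕ} (M : Matrix (Fin D) (Fin D) ℝ) (Q : Tensor4 D) (a b c d : Fin D) :
    act M (fun a b c d => Q c d a b) a b c d = act M Q c d a b := by
  rw [act_swap₂₃ M (fun a c b d => Q c d a b), act_swap₁₂ M (fun c a b d => Q c d a b),
    act_swap₃₄ M (fun c a d b => Q c d a b), act_swap₂₃ M Q]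

theorem act_cycle {D : ℕ} (M : Matrix (Fin D) (Fin D) ℝ) (Q : Tensor4 D) (a b c d : Fin D) :
    act M (fun a b c d => Q a c d b) a b c d = act M Q a c d b := by
  rw [act_swap₂₃ M (fun a c b d => Q a c d b), act_swap₃₄ M Q]

theorem act_cycle' {D : ℕ} (M : Matrix (Fin D) (Fin D) ℝ) (Q : Tensor4 D) (a b c d : Fin D) :
    act M (fun a b c d => Q a d b c) a b c d = act M Q a d b c := by
  rw [act_swap₃₄ M (fun a b d c => Q a d b c), act_swap₂₃ M Q]

theorem pairSymm_act {D : ℕ} (M : Matrix (Fin D) (Fin D) ℝ) (Q : Tensor4 D) :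
    pairSymm (act M Q) = act M (pairSymm Q) := by
  have h : pairSymm Q = (1 / 8 : ℝ) • (Q - (fun a b c d => Q b a c d) - (fun a b c d => Q a b d c)
      + (fun a b c d => Q b a d c) + (fun a b c d => Q c d a b) - (fun a b c d => Q d c a b)
      - (fun a b c d => Q c d b a) + (fun a b c d => Q d c b a)) := rfl
  funext a b c d
  rw [h]
  simp only [act_smul, act_add, act_sub, Pi.smul_apply, Pi.add_apply, Pi.sub_apply, smul_eq_mul]
  have e1 : act M (fun a b c d => Q b a c d) a b c d = act M Q b a c d := act_swap₁₂ ..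
  have e2 : act M (fun a b c d => Q a b d c) a b c d = act M Q a b d c := act_swap₃₄ ..
  have e3 : act M (fun a b c d => Q b a d c) a b c d = act M Q b a d c :=
    (act_swap₁₂ M (fun a b c d => Q a b d c) a b c d).trans (act_swap₃₄ ..)
  have e4 : act M (fun a b c d => Q c d a b) a b c d = act M Q c d a b := act_swap_pairs ..
  have e5 : act M (fun a b c d => Q d c a b) a b c d = act M Q d c a b :=
    (act_swap_pairs M (fun a b c d => Q b a c d) a b c d).trans (act_swap₁₂ ..)
  have e6 : act M (fun a b c d => Q c d b a) a b c d = act M Q c d b a :=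
    (act_swap_pairs M (fun a b c d => Q a b d c) a b c d).trans (act_swap₃₄ ..)
  have e7 : act M (fun a b c d => Q d c b a) a b c d = act M Q d c b a :=
    (act_swap_pairs M (fun a b c d => Q b a d c) a b c d).trans
      ((act_swap₁₂ M (fun a b c d => Q a b d c) c d a b).trans (act_swap₃₄ ..))
  rw [e1, e2, e3, e4, e5, e6, e7]
  rfl

theorem riemannProj_act {D : ℕ} (M : Matrix (Fin D) (Fin D) ℝ) (Q : Tensor4 D) :
    riemannProj (act M Q) = act M (riemannProj Q) := by
  have h : riemannProj Q = pairSymm Q - (1 / 3 : ℝ) • (pairSymm Q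
      + (fun a b c d => pairSymm Q a c d b) + (fun a b c d => pairSymm Q a d b c)) := rfl
  funext a b c d
  rw [h]
  simp only [act_smul, act_add, act_sub, Pi.smul_apply, Pi.add_apply, Pi.sub_apply, smul_eq_mul]
  have e1 : act M (fun a b c d => pairSymm Q a c d b) a b c d = act M (pairSymm Q) a c d b :=
    act_cycle ..
  have e2 : act M (fun a b c d => pairSymm Q a d b c) a b c d = act M (pairSymm Q) a d b c :=
    act_cycle' ..
  rw [e1, e2, ← pairSymm_act]
  rfl

theorem riemannProj_swap₁₂ {D : ℕ} (Q : Tensor4 D) (a b c d : Fin D) :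
    riemannProj Q b a c d = -riemannProj Q a b c d := by
  simp only [riemannProj, pairSymm]
  ring

theorem riemannProj_swap₃₄ {D : ℕ} (Q : Tensor4 D) (a b c d : Fin D) :
    riemannProj Q a b d c = -riemannProj Q a b c d := by
  simp only [riemannProj, pairSymm]
  ring

/-- On a sectional component the cyclic sum cancels: one of its terms repeats an index inside a pair
and the other two are opposite. -/
theorem riemannProj_diag {D : ℕ} (Q : Tensor4 D) (a b : Fin D) :
    riemannProj Q a b a b = 1 / 4 * (Q a b a b - Q b a a b - Q a b b a + Q b a b a) := by
  simp only [riemannProj, pairSymm]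
  ring

/-! ### Covariance of the curvature momentum -/

/-- The tensor with a single non-zero component. -/
def basisTensor {D : ℕ} (a b c d : Fin D) : Tensor4 D :=
  Pi.single a (Pi.single b (Pi.single c (Pi.single d 1)))

theorem basisTensor_apply {D : ℕ} (a b c d a' b' c' d' : Fin D) :
    basisTensor a b c d a' b' c' d' =
      (if a' = a then 1 else 0) * (if b' = b then 1 else 0) * (if c' = c then 1 else 0) *
        (if d' = d then 1 else 0) := by
  simp only [basisTensor, Pi.single_apply]
  split_ifs <;> simp_all

theorem eq_sum_basisTensor {D : ℕ} (Q : Tensor4 D) :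
    Q = ∑ a, ∑ b, ∑ c, ∑ d, Q a b c d • basisTensor a b c d := by
  funext a b c d
  simp only [Finset.sum_apply, Pi.smul_apply, smul_eq_mul, basisTensor_apply]
  simp

theorem clm_apply_eq_sum {D : ℕ} (φ : Tensor4 D →L[ℝ] ℝ) (Q : Tensor4 D) :
    φ Q = ∑ a, ∑ b, ∑ c, ∑ d, Q a b c d * φ (basisTensor a b c d) := by
  conv_lhs => rw [eq_sum_basisTensor Q]
  simp only [map_sum, map_smul, smul_eq_mul]

theorem act_basisTensor {D : ℕ} (M : Matrix (Fin D) (Fin D) ℝ) (a b c d a' b' c' d' : Fin D) :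
    act M (basisTensor a b c d) a' b' c' d' = M a' a * M b' b * M c' c * M d' d := by
  simp [act, basisTensor_apply]

theorem IsInvariant.fderiv_act {D : ℕ} {L : Lagrangian D} (hL : IsInvariant L)
    (G M : Matrix (Fin D) (Fin D) ℝ) (R Q : Tensor4 D) :
    fderiv ℝ (L G) (act M R) (act M Q) = fderiv ℝ (L (M.transpose * G * M)) R Q := by
  have h1 : L (M.transpose * G * M) = L G ∘ actL M := by
    funext R
    simp [hL.covariant]
  have hd : DifferentiableAt ℝ (L G) (actL M R) :=
    ((hL.smooth G).differentiable (by simp)).differentiableAt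
  rw [h1, fderiv_comp R hd (actL M).differentiableAt, ContinuousLinearMap.fderiv]
  rfl

/-- Chain rule for L (Mᵀ G M) = L G ∘ act M: on elementary tensors the derivative transforms with
the transposed matrix, and the projection commutes with the action. -/
theorem IsInvariant.curvatureMomentum_act {D : ℕ} {L : Lagrangian D} (hL : IsInvariant L)
    (G M : Matrix (Fin D) (Fin D) ℝ) (R : Tensor4 D) :
    curvatureMomentum L (M.transpose * G * M) R =
      act M.transpose (curvatureMomentum L G (act M R)) := by
  rw [curvatureMomentum, curvatureMomentum, ← riemannProj_act]
  congr 1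
  funext a b c d
  have := clm_apply_eq_sum (fderiv ℝ (L G) (act M R)) (act M (basisTensor a b c d))
  rw [hL.fderiv_act] at this
  simp only [act_basisTensor] at this
  exact this

/-! ### Isotropic curvature in an orthonormal frame -/

/-- The Minkowski metric. -/
def minkowski (d : ℕ) : Matrix (Fin (d + 1)) (Fin (d + 1)) ℝ :=
  Matrix.diagonal (Fin.cons (-1) fun _ => 1)

/-- The projector on the time direction. -/
def timeProj (d : ℕ) : Matrix (Fin (d + 1)) (Fin (d + 1)) ℝ :=
  Matrix.diagonal (Fin.cons 1 fun _ => 0)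

/-- The projector on the spatial directions. -/
def spaceProj (d : ℕ) : Matrix (Fin (d + 1)) (Fin (d + 1)) ℝ :=
  Matrix.diagonal (Fin.cons 0 fun _ => 1)

theorem minkowski_eq (d : ℕ) : minkowski d = spaceProj d - timeProj d := by
  rw [minkowski, spaceProj, timeProj, Matrix.diagonal_sub]
  congr 1
  funext i
  refine Fin.cases ?_ (fun i => ?_) i <;> simp

/-- The Riemann tensor with time-space sectional curvature `A` and spatial sectional
curvature `B`, in an orthonormal frame. -/
def isoRiemann {D : ℕ} (T S : Matrix (Fin D) (Fin D) ℝ) (A B : ℝ) : Tensor4 D :=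
  B • kn S S - A • (kn T S + kn S T)

theorem act_isoRiemann {D : ℕ} (M T S : Matrix (Fin D) (Fin D) ℝ) (A B : ℝ) :
    act M (isoRiemann T S A B) =
      isoRiemann (M * T * M.transpose) (M * S * M.transpose) A B := by
  simp only [isoRiemann, act_sub, act_smul, act_add, act_kn]

/-- The isotropic tensor with the symmetries of the Riemann tensor. -/
def isoMomentum {D : ℕ} (g T : Matrix (Fin D) (Fin D) ℝ) (σ θ : ℝ) : Tensor4 D :=
  σ • kn g g + θ • (kn g T + kn T g)

theorem act_isoMomentum {D : ℕ} (M g T : Matrix (Fin D) (Fin D) ℝ) (σ θ : ℝ) :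
    act M (isoMomentum g T σ θ) =
      isoMomentum (M * g * M.transpose) (M * T * M.transpose) σ θ := by
  simp only [isoMomentum, act_smul, act_add, act_kn]

/-- A tensor with the symmetries of the Riemann tensor which is invariant under sign flips. -/
theorem eq_of_flip_invariant {D : ℕ} {P : Tensor4 D}
    (h₁₂ : ∀ a b c d, P b a c d = -P a b c d) (h₃₄ : ∀ a b c d, P a b d c = -P a b c d)
    (hflip : ∀ (m : Fin D) a b c d, (if a = m then -1 else 1) * (if b = m then -1 else 1) *
      (if c = m then -1 else 1) * (if d = m then -1 else 1) * P a b c d = P a b c d)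
    (a b c d : Fin D) :
    P a b c d = P a b a b * ((if a = c then 1 else 0) * (if b = d then 1 else 0)
      - (if a = d then 1 else 0) * (if b = c then 1 else 0)) := by
  -- If some value occurs an odd number of times among the four indices, flipping that axis negates
  -- the component, which must vanish. With the antisymmetries only the patterns a b a b and a b b a
  -- remain.
  by_cases hab : a = b
  · subst hab
    have h1 := h₁₂ a a c d
    have h2 := h₁₂ a a a a
    rw [show P a a c d = 0 by linarith, show P a a a a = 0 by linarith, zero_mul]
  have hba : b ≠ a := fun h => hab h.symm
  by_cases hcd : c = d
  · subst hcd
    have h1 := h₃₄ a b c c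
    rw [show P a b c c = 0 by linarith]
    ring
  by_cases hac : a = c
  · subst hac
    by_cases hbd : b = d
    · subst hbd
      simp [hab]
    · have := hflip b a b a d
      have hdb : d ≠ b := fun h => hbd h.symm
      simp only [hab, hdb, if_true, if_false] at this
      have h0 : P a b a d = 0 := by linarith
      simp [h0, hbd, hba]
  · have hca : c ≠ a := fun h => hac h.symm
    by_cases had : a = d
    · subst had
      by_cases hbc : b = c
      · subst hbc
        rw [h₃₄]
        simp [hab]
      · have := hflip b a b c a
        have hcb : c ≠ b := fun h => hbc h.symm
        simp only [hab, hcb, if_true, if_false] at this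
        have h0 : P a b c a = 0 := by linarith
        simp [h0, hbc, hac]
    · have := hflip a a b c d
      have hda : d ≠ a := fun h => had h.symm
      simp only [hba, hca, hda, if_true, if_false] at this
      have h0 : P a b c d = 0 := by linarith
      simp [h0, hac, had]

section Frame

variable {d : ℕ} {L : Lagrangian (d + 1)} 

/-- A linear map that fixes both the metric and the curvature is a symmetry of the momentum. Flips,
spatial permutations and boosts all enter through this. -/
theorem IsInvariant.frame_invariant (hL : IsInvariant L)
    {M : Matrix (Fin (d + 1)) (Fin (d + 1)) ℝ} {A B : ℝ}
    (hM : M.transpose * minkowski d * M = minkowski d)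
    (hR : act M (isoRiemann (timeProj d) (spaceProj d) A B) =
      isoRiemann (timeProj d) (spaceProj d) A B) :
    act M.transpose (curvatureMomentum L (minkowski d)
      (isoRiemann (timeProj d) (spaceProj d) A B)) =
      curvatureMomentum L (minkowski d) (isoRiemann (timeProj d) (spaceProj d) A B) := by
  have := hL.curvatureMomentum_act (minkowski d) M (isoRiemann (timeProj d) (spaceProj d) A B)
  rw [hM, hR] at this
  exact this.symm

theorem IsInvariant.frame_flip (hL : IsInvariant L) (A B : ℝ) (m a b c e : Fin (d + 1)) :
    (if a = m then -1 else 1) * (if b = m then -1 else 1) *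
      (if c = m then -1 else 1) * (if e = m then -1 else 1) *
      curvatureMomentum L (minkowski d) (isoRiemann (timeProj d) (spaceProj d) A B) a b c e =
    curvatureMomentum L (minkowski d) (isoRiemann (timeProj d) (spaceProj d) A B) a b c e := by
  let s : Fin (d + 1) → ℝ := fun a => if a = m then -1 else 1
  have hs : ∀ v : Fin (d + 1) → ℝ, Matrix.diagonal s * Matrix.diagonal v * Matrix.diagonal s =
      Matrix.diagonal v := by
    intro v
    rw [Matrix.diagonal_mul_diagonal, Matrix.diagonal_mul_diagonal]
    congr 1
    funext i
    simp only [s]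
    split_ifs <;> ring
  have := hL.frame_invariant (M := Matrix.diagonal s) (A := A) (B := B)
    (by rw [Matrix.diagonal_transpose]; exact hs _)
    (by rw [act_isoRiemann, Matrix.diagonal_transpose, timeProj, spaceProj, hs, hs])
  rw [Matrix.diagonal_transpose] at this
  have h2 := congrFun (congrFun (congrFun (congrFun this a) b) c) e
  rw [act_diagonal] at h2
  exact h2

/-- The permutation matrix of g fixes the time axis, so it commutes with every diagonal matrix that
is constant on the spatial directions. -/
theorem IsInvariant.frame_perm (hL : IsInvariant L) (A B : ℝ) (f : Equiv.Perm (Fin d))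
    (a b c e : Fin (d + 1)) (g : Fin (d + 1) → Fin (d + 1))
    (hg : g = Fin.cons 0 fun i => (f i).succ) :
    curvatureMomentum L (minkowski d) (isoRiemann (timeProj d) (spaceProj d) A B)
      (g a) (g b) (g c) (g e) =
    curvatureMomentum L (minkowski d) (isoRiemann (timeProj d) (spaceProj d) A B) a b c e := by
  let M : Matrix (Fin (d + 1)) (Fin (d + 1)) ℝ := Matrix.of fun a b => if a = g b then 1 else 0
  have hinj : Function.Injective g := by
    intro a b
    subst hg
    refine Fin.cases ?_ (fun i => ?_) a <;> refine Fin.cases ?_ (fun j => ?_) b <;> 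
      simp [Fin.succ_ne_zero, (Fin.succ_ne_zero _).symm]
  have hM1 : M.transpose * M = 1 := by
    ext a b
    simp [M, Matrix.mul_apply, Matrix.one_apply, hinj.eq_iff, eq_comm]
  have hv : ∀ x y : ℝ, M * Matrix.diagonal (Fin.cons x fun _ => y) =
      Matrix.diagonal (Fin.cons x fun _ => y) * M := by
    intro x y
    ext a b
    rw [Matrix.mul_diagonal, Matrix.diagonal_mul]
    subst hg
    simp only [M, Matrix.of_apply]
    refine Fin.cases ?_ (fun i => ?_) a <;> refine Fin.cases ?_ (fun j => ?_) b <;>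
      simp [Fin.succ_ne_zero, (Fin.succ_ne_zero _).symm, mul_comm]
  have hM2 : M * M.transpose = 1 := mul_eq_one_comm.mp hM1
  have key : ∀ x y : ℝ, M * Matrix.diagonal (Fin.cons x fun _ => y) * M.transpose =
      Matrix.diagonal (Fin.cons x fun _ => y) := by
    intro x y
    rw [hv, Matrix.mul_assoc, hM2, Matrix.mul_one]
  have := hL.frame_invariant (M := M) (A := A) (B := B)
    (by rw [Matrix.mul_assoc, minkowski, ← hv, ← Matrix.mul_assoc, hM1, Matrix.one_mul])
    (by rw [act_isoRiemann, timeProj, spaceProj, key, key])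
  have h2 := congrFun (congrFun (congrFun (congrFun this a) b) c) e
  rw [← h2]
  simp [act, M, Matrix.transpose_apply]

/-- A boost in the plane of the time direction and of the spatial direction `i`. -/
noncomputable def boost (i : Fin d) : Matrix (Fin (d + 1)) (Fin (d + 1)) ℝ := Matrix.of fun a b =>
  -- Since (5/4)² - (3/4)² = 1 this is a Lorentz map with rational entries; a single non-trivial
  -- boost is enough.
  if a = 0 then (if b = 0 then 5 / 4 else if b = i.succ then 3 / 4 else 0)
  else if a = i.succ then (if b = 0 then 3 / 4 else if b = i.succ then 5 / 4 else 0)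
  else if a = b then 1 else 0

theorem boost_transpose (i : Fin d) : (boost i).transpose = boost i := by
  ext a b
  simp only [boost, Matrix.transpose_apply, Matrix.of_apply]
  refine Fin.cases ?_ (fun j => ?_) a <;> refine Fin.cases ?_ (fun k => ?_) b <;>
    simp [Fin.succ_ne_zero]
  by_cases hj : j = i <;> by_cases hk : k = i <;> simp [hj, hk, eq_comm]

theorem sum_boost_zero (i : Fin d) (f : Fin (d + 1) → ℝ) :
    ∑ a, boost i 0 a * f a = 5 / 4 * f 0 + 3 / 4 * f i.succ := by
  simp [boost, Fin.sum_univ_succ, Fin.succ_ne_zero]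

theorem sum_boost_self (i : Fin d) (f : Fin (d + 1) → ℝ) :
    ∑ a, boost i i.succ a * f a = 3 / 4 * f 0 + 5 / 4 * f i.succ := by
  simp [boost, Fin.sum_univ_succ, Fin.succ_ne_zero]

theorem sum_boost_of_ne {i j : Fin d} (hij : i ≠ j) (f : Fin (d + 1) → ℝ) :
    ∑ a, boost i j.succ a * f a = f j.succ := by
  simp [boost, Fin.succ_ne_zero, hij.symm]

theorem boost_mul_minkowski_mul (i : Fin d) : boost i * minkowski d * boost i = minkowski d := by
  ext a b
  rw [minkowski, Matrix.mul_assoc, Matrix.mul_apply]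
  simp only [Matrix.diagonal_mul]
  refine Fin.cases ?_ (fun j => ?_) a
  · rw [sum_boost_zero]
    refine Fin.cases ?_ (fun k => ?_) b
    · simp [boost, Fin.succ_ne_zero]
      norm_num
    · simp [boost, Fin.succ_ne_zero, (Fin.succ_ne_zero k).symm]
      split_ifs <;> norm_num
  · by_cases hj : i = j
    · subst hj
      rw [sum_boost_self]
      refine Fin.cases ?_ (fun k => ?_) b
      · simp [boost, Fin.succ_ne_zero]
        norm_num
      · simp [boost, Fin.succ_ne_zero, Matrix.diagonal_apply, eq_comm]
        split_ifs <;> norm_num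
    · rw [sum_boost_of_ne hj]
      have hj' : j ≠ i := fun h => hj h.symm
      simp [boost, Fin.succ_ne_zero, hj', Matrix.diagonal_apply]

/-- At A = B the curvature is B times `kn η η` for the Minkowski metric η, hence Lorentz invariant.
Boosting in the plane of 0 and i while j stays fixed gives P₀ⱼ₀ⱼ = (25/16) P₀ⱼ₀ⱼ + (9/16) Pᵢⱼᵢⱼ,
because the cross terms vanish under flips. -/
theorem IsInvariant.frame_boost (hL : IsInvariant L) (B : ℝ) {i j : Fin d} (hij : i ≠ j) :
    curvatureMomentum L (minkowski d) (isoRiemann (timeProj d) (spaceProj d) B B)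
      0 j.succ 0 j.succ =
    -curvatureMomentum L (minkowski d) (isoRiemann (timeProj d) (spaceProj d) B B)
      i.succ j.succ i.succ j.succ := by
  have hR : isoRiemann (timeProj d) (spaceProj d) B B = B • kn (minkowski d) (minkowski d) := by
    rw [isoRiemann, minkowski_eq, ← smul_sub]
    congr 1
    funext a b c e
    simp only [kn, Pi.sub_apply, Pi.add_apply, Matrix.sub_apply]
    -- The time projector has rank one, so its `kn` square is zero; this supplies the term missing
    -- from `kn η η`.
    have : timeProj d a c * timeProj d b e = timeProj d a e * timeProj d b c := by
      simp only [timeProj, Matrix.diagonal_apply]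
      refine Fin.cases ?_ (fun i => ?_) a <;> refine Fin.cases ?_ (fun j => ?_) b <;> simp
      split_ifs <;> rfl
    linear_combination -this
  have hb := boost_mul_minkowski_mul i
  have := hL.frame_invariant (M := boost i) (A := B) (B := B)
    (by rw [boost_transpose, hb])
    (by rw [hR, act_smul, act_kn, boost_transpose, hb])
  rw [boost_transpose] at this
  have h2 := congrFun (congrFun (congrFun (congrFun this 0) j.succ) 0) j.succ
  have expand : ∀ P : Tensor4 (d + 1), act (boost i) P 0 j.succ 0 j.succ =
      ∑ a, boost i 0 a * ∑ b, boost i j.succ b * ∑ c, boost i 0 c *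
        ∑ e, boost i j.succ e * P a b c e := by
    intro P
    simp only [act, Finset.mul_sum]
    exact Finset.sum_congr rfl fun _ _ => Finset.sum_congr rfl fun _ _ =>
      Finset.sum_congr rfl fun _ _ => Finset.sum_congr rfl fun _ _ => by ring
  rw [expand] at h2
  simp only [sum_boost_zero, sum_boost_of_ne hij] at h2
  set P := curvatureMomentum L (minkowski d) (isoRiemann (timeProj d) (spaceProj d) B B) with hP
  have f1 := hL.frame_flip B B i.succ 0 j.succ i.succ j.succ
  have f2 := hL.frame_flip B B i.succ i.succ j.succ 0 j.succ
  have hji : j ≠ i := hij.symm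
  simp [(Fin.succ_ne_zero _).symm, hji] at f1 f2
  rw [← hP] at f1 f2
  linarith

end Frame

/-! ### The Lagrangian as a function of two sectional curvatures. -/

theorem sum_kn_diagonal_mul {D : ℕ} (x y : Fin D → ℝ) (γ : Tensor4 D) :
    ∑ a, ∑ b, ∑ c, ∑ d, kn (Matrix.diagonal x) (Matrix.diagonal y) a b c d * γ a b c d =
      ∑ a, ∑ b, x a * y b * (γ a b a b - γ a b b a) := by
  refine Finset.sum_congr rfl fun a _ => Finset.sum_congr rfl fun b _ => ?_
  simp [kn, Matrix.diagonal_apply, sub_mul, Finset.sum_sub_distrib, mul_sub, ite_mul, mul_ite]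

/-- Pairing with a symmetrized diagonal tensor sees only the sectional components of the projected
gradient. This turns derivatives of the reduced Lagrangian into components of the curvature
momentum. -/
theorem sum_kn_symm_diagonal_mul {D : ℕ} (x y : Fin D → ℝ) (γ : Tensor4 D) :
    ∑ a, ∑ b, ∑ c, ∑ d, (kn (Matrix.diagonal x) (Matrix.diagonal y) a b c d
        + kn (Matrix.diagonal y) (Matrix.diagonal x) a b c d) * γ a b c d =
      4 * ∑ a, ∑ b, x a * y b * riemannProj γ a b a b := by
  simp only [add_mul, Finset.sum_add_distrib, sum_kn_diagonal_mul]
  rw [Finset.sum_comm (f := fun a b => y a * x b * (γ a b a b - γ a b b a)),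
    ← Finset.sum_add_distrib, Finset.mul_sum]
  refine Finset.sum_congr rfl fun a _ => ?_
  rw [← Finset.sum_add_distrib, Finset.mul_sum]
  refine Finset.sum_congr rfl fun b _ => ?_
  rw [riemannProj_diag]
  ring

/-- The Lagrangian on isotropic Riemann tensors, as a function of the two sectional curvatures. -/
def reduced {d : ℕ} (L : Lagrangian (d + 1)) : ℝ × ℝ → ℝ := fun x =>
  L (minkowski d) (isoRiemann (timeProj d) (spaceProj d) x.1 x.2)

/-- The partial derivative of the reduced Lagrangian in the time-space curvature. -/
noncomputable def reducedA {d : ℕ} (L : Lagrangian (d + 1)) (x : ℝ × ℝ) : ℝ :=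
  fderiv ℝ (reduced L) x (1, 0)

/-- The partial derivative of the reduced Lagrangian in the spatial curvature. -/
noncomputable def reducedB {d : ℕ} (L : Lagrangian (d + 1)) (x : ℝ × ℝ) : ℝ :=
  fderiv ℝ (reduced L) x (0, 1)

section

variable {d : ℕ} {L : Lagrangian (d + 1)}

theorem contDiff_isoRiemann {D : ℕ} (T S : Matrix (Fin D) (Fin D) ℝ) :
    ContDiff ℝ (⊤ : ℕ∞) fun x : ℝ × ℝ => isoRiemann T S x.1 x.2 := by
  unfold isoRiemann
  exact (contDiff_snd.smul contDiff_const).sub (contDiff_fst.smul contDiff_const)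

theorem IsInvariant.contDiff_reduced (hL : IsInvariant L) : ContDiff ℝ (⊤ : ℕ∞) (reduced L) :=
  (hL.smooth _).comp (contDiff_isoRiemann _ _)

theorem IsInvariant.fderiv_reduced (hL : IsInvariant L) (x v : ℝ × ℝ) :
    fderiv ℝ (reduced L) x v =
      fderiv ℝ (L (minkowski d)) (isoRiemann (timeProj d) (spaceProj d) x.1 x.2)
        (isoRiemann (timeProj d) (spaceProj d) v.1 v.2) := by
  have h : HasFDerivAt (fun x : ℝ × ℝ => isoRiemann (timeProj d) (spaceProj d) x.1 x.2)
      ((ContinuousLinearMap.snd ℝ ℝ ℝ).smulRight (kn (spaceProj d) (spaceProj d)) -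
        (ContinuousLinearMap.fst ℝ ℝ ℝ).smulRight
          (kn (timeProj d) (spaceProj d) + kn (spaceProj d) (timeProj d))) x := by
    unfold isoRiemann
    exact (hasFDerivAt_snd.smul_const _).sub (hasFDerivAt_fst.smul_const _)
  have h2 := ((hL.smooth (minkowski d)).differentiable (by simp)
    (isoRiemann (timeProj d) (spaceProj d) x.1 x.2)).hasFDerivAt.comp x h
  rw [show reduced L = L (minkowski d) ∘
    fun x : ℝ × ℝ => isoRiemann (timeProj d) (spaceProj d) x.1 x.2 from rfl, h2.fderiv]
  simp [isoRiemann]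

theorem IsInvariant.reducedA_eq (hL : IsInvariant L) (A B : ℝ) :
    reducedA L (A, B) = -4 * ∑ i : Fin d, curvatureMomentum L (minkowski d)
      (isoRiemann (timeProj d) (spaceProj d) A B) 0 i.succ 0 i.succ := by
  rw [reducedA, hL.fderiv_reduced, clm_apply_eq_sum]
  generalize isoRiemann (timeProj d) (spaceProj d) A B = R
  have := sum_kn_symm_diagonal_mul (Fin.cons 1 fun _ => 0 : Fin (d + 1) → ℝ) (Fin.cons 0 fun _ => 1)
    (fun a b c e => fderiv ℝ (L (minkowski d)) R (basisTensor a b c e))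
  simp only [isoRiemann, Pi.sub_apply, Pi.smul_apply, smul_eq_mul, zero_mul, one_mul, zero_sub,
    neg_mul, Finset.sum_neg_distrib, Pi.add_apply]
  rw [neg_inj]
  refine this.trans ?_
  simp [Fin.sum_univ_succ]
  rfl

theorem IsInvariant.reducedB_eq (hL : IsInvariant L) (A B : ℝ) :
    reducedB L (A, B) = 2 * ∑ i : Fin d, ∑ j : Fin d, curvatureMomentum L (minkowski d)
      (isoRiemann (timeProj d) (spaceProj d) A B) i.succ j.succ i.succ j.succ := by
  rw [reducedB, hL.fderiv_reduced, clm_apply_eq_sum]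
  generalize isoRiemann (timeProj d) (spaceProj d) A B = R
  have := sum_kn_symm_diagonal_mul (Fin.cons 0 fun _ => 1 : Fin (d + 1) → ℝ) (Fin.cons 0 fun _ => 1)
    (fun a b c e => fderiv ℝ (L (minkowski d)) R (basisTensor a b c e))
  simp only [isoRiemann, Pi.sub_apply, Pi.smul_apply, smul_eq_mul, zero_mul, one_mul, sub_zero]
  simp only [← two_mul, mul_assoc, ← Finset.mul_sum] at this
  -- The tensor `kn S S` enters the curvature once, whereas the symmetrized pairing counts it twice;
  -- hence the factor 2 instead of 4.
  have h2 : ∀ x y : ℝ, 2 * x = 4 * y → x = 2 * y := fun x y h => by linarith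
  refine (h2 _ _ this).trans ?_
  simp [Fin.sum_univ_succ]
  rfl

/-- Spatial permutations make the d time-space components equal, so each is the average of the sum
in `IsInvariant.reducedA_eq`. -/
theorem IsInvariant.momentum_timeSpace (hL : IsInvariant L) (hd : 2 ≤ d) (A B : ℝ) (i : Fin d) :
    curvatureMomentum L (minkowski d)
      (isoRiemann (timeProj d) (spaceProj d) A B) 0 i.succ 0 i.succ =
        -(reducedA L (A, B) / (4 * d)) := by
  have h : ∀ j : Fin d, curvatureMomentum L (minkowski d)
      (isoRiemann (timeProj d) (spaceProj d) A B) 0 j.succ 0 j.succ = curvatureMomentum L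
      (minkowski d) (isoRiemann (timeProj d) (spaceProj d) A B) 0 i.succ 0 i.succ := by
    intro j
    have := hL.frame_perm A B (Equiv.swap i j) 0 i.succ 0 i.succ _ rfl
    simpa using this
  rw [hL.reducedA_eq, Finset.sum_congr rfl fun j _ => h j]
  have : (d : ℝ) ≠ 0 := by positivity
  simp
  field_simp

theorem IsInvariant.momentum_spaceSpace (hL : IsInvariant L) (A B : ℝ) {i j : Fin d}
    (hij : i ≠ j) :
    curvatureMomentum L (minkowski d)
      (isoRiemann (timeProj d) (spaceProj d) A B) i.succ j.succ i.succ j.succ =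
        reducedB L (A, B) / (2 * d * (d - 1)) := by
  set P := curvatureMomentum L (minkowski d) (isoRiemann (timeProj d) (spaceProj d) A B) with hP
  have h1 : ∀ i j i', i ≠ j → i' ≠ j → P (Fin.succ i') (Fin.succ j) (Fin.succ i') (Fin.succ j) =
      P i.succ j.succ i.succ j.succ := by
    intro i j i' h h'
    have := hL.frame_perm A B (Equiv.swap i i') i.succ j.succ i.succ j.succ _ rfl
    simpa [Equiv.swap_apply_of_ne_of_ne h.symm h'.symm] using this
  have hs : ∀ i j, P (Fin.succ i) (Fin.succ j) (Fin.succ i) (Fin.succ j) =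
      P j.succ i.succ j.succ i.succ := by
    intro i j
    rw [hP, curvatureMomentum, riemannProj_swap₁₂, riemannProj_swap₃₄, neg_neg]
  have h2 : ∀ i' j', i' ≠ j' → P (Fin.succ i') (Fin.succ j') (Fin.succ i') (Fin.succ j') =
      P i.succ j.succ i.succ j.succ := by
    intro i' j' h
    by_cases hi : i' = j
    · rw [hs i' j', h1 i i' j' (hi ▸ hij) h.symm, hi]
    · rw [hs i' j', h1 j i' j' (Ne.symm hi) h.symm, hs j i', h1 i j i' hij hi]
  -- Coincident indices give zero by antisymmetry, which leaves d (d - 1) equal terms in the double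
  -- sum.
  have h3 : ∀ i' j', P (Fin.succ i') (Fin.succ j') (Fin.succ i') (Fin.succ j') =
      P i.succ j.succ i.succ j.succ - if i' = j' then P i.succ j.succ i.succ j.succ else 0 := by
    intro i' j'
    split_ifs with h
    · subst h
      have : P i'.succ i'.succ i'.succ i'.succ = -P i'.succ i'.succ i'.succ i'.succ :=
        riemannProj_swap₁₂ _ _ _ _ _
      rw [sub_self]
      linarith
    · rw [h2 _ _ h, sub_zero]
  rw [hL.reducedB_eq, ← hP]
  rw [Finset.sum_congr rfl fun i' _ => Finset.sum_congr rfl fun j' _ => h3 i' j']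
  simp only [Finset.sum_sub_distrib]
  clear h1 h2 h3 hs
  generalize P i.succ j.succ i.succ j.succ = z
  have hd2 : 2 ≤ d := by
    have := i.2
    have := j.2
    have : (i : ℕ) ≠ j := fun h => hij (Fin.ext h)
    omega
  have hd0 : (d : ℝ) ≠ 0 := by positivity
  have hd1 : (d : ℝ) - 1 ≠ 0 := by
    have : (2 : ℝ) ≤ d := by exact_mod_cast hd2
    intro h
    linarith
  simp only [Finset.sum_const, Finset.card_univ, Fintype.card_fin, nsmul_eq_mul,
    Finset.sum_ite_eq, Finset.mem_univ, if_true]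
  field_simp

/-- The curvature momentum of an isotropic Riemann tensor. -/
theorem IsInvariant.momentum_frame (hL : IsInvariant L) (hd : 2 ≤ d) (A B : ℝ) :
    curvatureMomentum L (minkowski d) (isoRiemann (timeProj d) (spaceProj d) A B) =
      isoMomentum (minkowski d) (timeProj d) (reducedB L (A, B) / (2 * d * (d - 1)))
        (-(reducedA L (A, B) / (4 * d)) + reducedB L (A, B) / (2 * d * (d - 1))) := by
  set P := curvatureMomentum L (minkowski d) (isoRiemann (timeProj d) (spaceProj d) A B) with hP
  have h0 : ∀ i : Fin d, P 0 i.succ 0 i.succ = _ := fun i => hL.momentum_timeSpace hd A B i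
  have h1 : ∀ i j : Fin d, i ≠ j → P i.succ j.succ i.succ j.succ = _ :=
    fun i j h => hL.momentum_spaceSpace A B h
  have hs : ∀ i : Fin d, P i.succ 0 i.succ 0 = P 0 i.succ 0 i.succ := fun i => by
    rw [hP, curvatureMomentum, riemannProj_swap₁₂, riemannProj_swap₃₄, neg_neg]
  set σ := reducedB L (A, B) / (2 * d * (d - 1))
  set π := -(reducedA L (A, B) / (4 * d))
  -- These are the diagonals of the metric and of the time projector. An isotropic tensor with
  -- coefficients σ and θ has time-space component θ - σ; equating it with π gives θ = π + σ.
  let x : Fin (d + 1) → ℝ := Fin.cons (-1) fun _ => 1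
  let t : Fin (d + 1) → ℝ := Fin.cons 1 fun _ => 0
  have hp : ∀ a b, a ≠ b → P a b a b = σ * (x a * x b) + (π + σ) * (x a * t b + t a * x b) := by
    intro a b
    refine Fin.cases ?_ (fun i => ?_) a <;> refine Fin.cases ?_ (fun j => ?_) b <;> intro hab
    · exact absurd rfl hab
    · rw [h0]
      simp only [x, t, Fin.cons_zero, Fin.cons_succ]
      ring
    · rw [hs, h0]
      simp only [x, t, Fin.cons_zero, Fin.cons_succ]
      ring
    · rw [h1 _ _ fun h => hab (congrArg Fin.succ h)]
      simp only [x, t, Fin.cons_succ]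
      ring
  funext a b c e
  rw [eq_of_flip_invariant (P := P) (fun _ _ _ _ => riemannProj_swap₁₂ ..)
    (fun _ _ _ _ => riemannProj_swap₃₄ ..) (fun m a b c e => hL.frame_flip A B m a b c e)]
  have hiso : isoMomentum (minkowski d) (timeProj d) σ (π + σ) a b c e =
      (σ * (x a * x b) + (π + σ) * (x a * t b + t a * x b)) *
        ((if a = c then 1 else 0) * (if b = e then 1 else 0)
          - (if a = e then 1 else 0) * (if b = c then 1 else 0)) := by
    simp only [isoMomentum, kn, minkowski, timeProj, Matrix.diagonal_apply, Pi.add_apply,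
      Pi.smul_apply, smul_eq_mul, x, t]
    split_ifs <;> ring
  rw [hiso]
  by_cases hab : a = b
  · subst hab
    rw [mul_comm (if a = c then (1 : ℝ) else 0), sub_self, mul_zero, mul_zero]
  · rw [hp a b hab]

/-- Local Lorentz invariance at maximally symmetric points. -/
theorem IsInvariant.reduced_constraint (hL : IsInvariant L) (hd : 2 ≤ d) (B : ℝ) :
    (d - 1) * reducedA L (B, B) = 2 * reducedB L (B, B) := by
  have hij : (⟨0, by omega⟩ : Fin d) ≠ ⟨1, by omega⟩ := by simp
  have h := hL.frame_boost B hij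
  rw [hL.momentum_timeSpace hd, hL.momentum_spaceSpace B B hij] at h
  have hd0 : (d : ℝ) ≠ 0 := by positivity
  have hd1 : (d : ℝ) - 1 ≠ 0 := by
    have : (2 : ℝ) ≤ d := by exact_mod_cast hd
    intro h
    linarith
  field_simp at h
  linarith

end

/-! ### Gradients -/

/-- `f` is differentiable at `y` with the given partial derivatives. -/
def HasGrad {D : ℕ} (f : (Fin D → ℝ) → ℝ) (f' : Fin D → ℝ) (y : Fin D → ℝ) : Prop :=
  DifferentiableAt ℝ f y ∧ ∀ a, pderiv a f y = f' a

section Grad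

variable {D : ℕ} {f h : (Fin D → ℝ) → ℝ} {f' h' : Fin D → ℝ} {y : Fin D → ℝ}

theorem HasGrad.pderiv_eq (hf : HasGrad f f' y) (a : Fin D) : pderiv a f y = f' a := hf.2 a

theorem HasGrad.congr_grad (hf : HasGrad f f' y) (e : ∀ a, f' a = h' a) : HasGrad f h' y :=
  ⟨hf.1, fun a => (hf.2 a).trans (e a)⟩

/-- The closed FLRW formulas hold only on the coordinate patch; since it is open, they may still be
differentiated. -/
theorem HasGrad.congr_of_eventuallyEq (hf : HasGrad f f' y) (e : h =ᶠ[nhds y] f) :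
    HasGrad h f' y :=
  ⟨hf.1.congr_of_eventuallyEq e, fun a => by rw [pderiv, e.fderiv_eq]; exact hf.2 a⟩

theorem hasGrad_const (c : ℝ) (y : Fin D → ℝ) : HasGrad (fun _ => c) (fun _ => 0) y :=
  ⟨differentiableAt_const c, fun a => by simp [pderiv]⟩

theorem hasGrad_coord (b : Fin D) (y : Fin D → ℝ) :
    HasGrad (fun z => z b) (fun a => if a = b then 1 else 0) y := by
  refine ⟨differentiableAt_apply b y, fun a => ?_⟩
  have : fderiv ℝ (fun z : Fin D → ℝ => z b) y = ContinuousLinearMap.proj b :=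
    (ContinuousLinearMap.proj (R := ℝ) (φ := fun _ : Fin D => ℝ) b).fderiv
  rw [pderiv, this]
  simp [Pi.single_apply, eq_comm]

theorem HasGrad.add (hf : HasGrad f f' y) (hh : HasGrad h h' y) :
    HasGrad (fun z => f z + h z) (fun a => f' a + h' a) y :=
  ⟨hf.1.add hh.1, fun a => by
    beta_reduce
    rw [pderiv, fderiv_fun_add hf.1 hh.1, ← hf.2, ← hh.2]
    rfl⟩

theorem HasGrad.sub (hf : HasGrad f f' y) (hh : HasGrad h h' y) :
    HasGrad (fun z => f z - h z) (fun a => f' a - h' a) y :=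
  ⟨hf.1.sub hh.1, fun a => by
    beta_reduce
    rw [pderiv, fderiv_fun_sub hf.1 hh.1, ← hf.2, ← hh.2]
    rfl⟩

theorem HasGrad.neg (hf : HasGrad f f' y) : HasGrad (fun z => -f z) (fun a => -f' a) y :=
  ⟨hf.1.neg, fun a => by
    beta_reduce
    rw [pderiv, fderiv_fun_neg, ← hf.2]
    rfl⟩

theorem HasGrad.mul (hf : HasGrad f f' y) (hh : HasGrad h h' y) :
    HasGrad (fun z => f z * h z) (fun a => f' a * h y + f y * h' a) y :=
  ⟨hf.1.mul hh.1, fun a => by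
    beta_reduce
    rw [pderiv, fderiv_fun_mul hf.1 hh.1, ← hf.2, ← hh.2]
    simp only [pderiv, add_apply, smul_apply, smul_eq_mul]
    ring⟩

theorem HasGrad.const_mul (c : ℝ) (hf : HasGrad f f' y) :
    HasGrad (fun z => c * f z) (fun a => c * f' a) y :=
  ((hasGrad_const c y).mul hf).congr_grad fun a => by ring

theorem HasGrad.comp {φ : ℝ → ℝ} {φ' : ℝ} (hφ : HasDerivAt φ φ' (f y)) (hf : HasGrad f f' y) :
    HasGrad (fun z => φ (f z)) (fun a => φ' * f' a) y := by
  have := hφ.comp_hasFDerivAt y hf.1.hasFDerivAt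
  refine ⟨this.differentiableAt, fun a => ?_⟩
  beta_reduce
  rw [← hf.2 a]
  have h2 : fderiv ℝ (fun z => φ (f z)) y = φ' • fderiv ℝ f y := this.fderiv
  rw [pderiv, h2]
  rfl

theorem HasGrad.div (hf : HasGrad f f' y) (hh : HasGrad h h' y) (h0 : h y ≠ 0) :
    HasGrad (fun z => f z / h z) (fun a => f' a / h y - f y * h' a / h y ^ 2) y := by
  have := hf.mul (HasGrad.comp (hasDerivAt_inv h0) hh)
  simp only [div_eq_mul_inv]
  exact this.congr_grad fun a => by ring

theorem HasGrad.fun_sum {ι : Type*} {s : Finset ι} {f : ι → (Fin D → ℝ) → ℝ}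
    {f' : ι → Fin D → ℝ} (hf : ∀ i ∈ s, HasGrad (f i) (f' i) y) :
    HasGrad (fun z => ∑ i ∈ s, f i z) (fun a => ∑ i ∈ s, f' i a) y := by
  classical
  induction s using Finset.induction_on with
  | empty => simpa using hasGrad_const 0 y
  | insert i s his ih =>
    simp only [Finset.sum_insert his]
    exact (hf i (Finset.mem_insert_self i s)).add
      (ih fun j hj => hf j (Finset.mem_insert_of_mem hj))

end Grad

theorem hasGrad_time {d : ℕ} {φ : ℝ → ℝ} {φ' : ℝ} {y : Fin (d + 1) → ℝ}
    (h : HasDerivAt φ φ' (y 0)) :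
    HasGrad (fun z => φ (z 0)) (Fin.cons φ' fun _ => 0) y :=
  (HasGrad.comp h (hasGrad_coord 0 y)).congr_grad fun a => by
    refine Fin.cases ?_ (fun i => ?_) a <;> simp [Fin.succ_ne_zero]

/-! ### Block-diagonal matrices -/

/-- The matrix with time-time component `p` and space-space components `X`. -/
def timeSpaceBlock {d : ℕ} (p : ℝ) (X : Matrix (Fin d) (Fin d) ℝ) :
    Matrix (Fin (d + 1)) (Fin (d + 1)) ℝ :=
  Matrix.of fun μ ν => Fin.cases (Fin.cases p (fun _ => 0) ν)
    (fun i => Fin.cases 0 (fun j => X i j) ν) μ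

section Block

variable {d : ℕ} (p q : ℝ) (X Y : Matrix (Fin d) (Fin d) ℝ) (i j : Fin d)

@[simp] theorem timeSpaceBlock_zero_zero : timeSpaceBlock p X 0 0 = p := rfl
@[simp] theorem timeSpaceBlock_zero_succ : timeSpaceBlock p X 0 i.succ = 0 := rfl
@[simp] theorem timeSpaceBlock_succ_zero : timeSpaceBlock p X i.succ 0 = 0 := rfl
@[simp] theorem timeSpaceBlock_succ_succ : timeSpaceBlock p X i.succ j.succ = X i j := rfl

theorem timeSpaceBlock_mul :
    timeSpaceBlock p X * timeSpaceBlock q Y = timeSpaceBlock (p * q) (X * Y) := by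
  ext a b
  rw [Matrix.mul_apply, Fin.sum_univ_succ]
  refine Fin.cases ?_ (fun i => ?_) a <;> refine Fin.cases ?_ (fun j => ?_) b <;>
    simp [Matrix.mul_apply]

theorem timeSpaceBlock_transpose :
    (timeSpaceBlock p X).transpose = timeSpaceBlock p X.transpose := by
  ext a b
  refine Fin.cases ?_ (fun i => ?_) a <;> refine Fin.cases ?_ (fun j => ?_) b <;> simp

theorem timeSpaceBlock_one_one : timeSpaceBlock 1 (1 : Matrix (Fin d) (Fin d) ℝ) = 1 := by
  ext a b
  refine Fin.cases ?_ (fun i => ?_) a <;> refine Fin.cases ?_ (fun j => ?_) b <;>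
    simp [Matrix.one_apply, Fin.succ_ne_zero, (Fin.succ_ne_zero _).symm]

theorem diagonal_cons_eq (x y : ℝ) :
    Matrix.diagonal (Fin.cons x fun _ => y : Fin (d + 1) → ℝ) = timeSpaceBlock x (y • 1) := by
  ext a b
  refine Fin.cases ?_ (fun i => ?_) a <;> refine Fin.cases ?_ (fun j => ?_) b <;>
    simp [Matrix.diagonal_apply, Matrix.one_apply, Fin.succ_ne_zero, (Fin.succ_ne_zero _).symm]

end Block

/-! ### The FLRW metric -/

section FLRW

variable {d : ℕ}

/-- The lapse-like function `1 - k r²` of the spatial slices. -/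
def slice (k : ℝ) (y : Fin (d + 1) → ℝ) : ℝ := 1 - k * ∑ i : Fin d, y i.succ ^ 2

/-- The dyad `x_i x_j`. -/
def dyad (y : Fin (d + 1) → ℝ) : Matrix (Fin d) (Fin d) ℝ :=
  Matrix.of fun i j => y i.succ * y j.succ

theorem dyad_mul_dyad (y : Fin (d + 1) → ℝ) :
    dyad y * dyad y = (∑ i : Fin d, y i.succ ^ 2) • dyad y := by
  ext i j
  simp only [dyad, Matrix.mul_apply, Matrix.of_apply, Matrix.smul_apply, smul_eq_mul,
    Finset.sum_mul]
  exact Finset.sum_congr rfl fun _ _ => by ring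

/-- Because the dyad squares to r² times itself, matrices of this shape are closed under products.
Inverses and square roots of the slice metric become scalar identities. -/
theorem one_add_dyad_mul (y : Fin (d + 1) → ℝ) (s t : ℝ) :
    (1 + s • dyad y) * (1 + t • dyad y) =
      1 + (s + t + s * t * ∑ i : Fin d, y i.succ ^ 2) • dyad y := by
  rw [add_mul, mul_add, mul_add, smul_mul_smul_comm, dyad_mul_dyad, smul_smul]
  simp only [one_mul, mul_one]
  module

theorem dyad_transpose (y : Fin (d + 1) → ℝ) : (dyad y).transpose = dyad y := by
  ext i j
  simp [dyad, mul_comm]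

/-- The metric of the unit spatial slice. -/
noncomputable def sliceMetric (k : ℝ) (y : Fin (d + 1) → ℝ) : Matrix (Fin d) (Fin d) ℝ :=
  1 + (k / slice k y) • dyad y

/-- The inverse metric of the unit spatial slice. -/
noncomputable def sliceInv (k : ℝ) (y : Fin (d + 1) → ℝ) : Matrix (Fin d) (Fin d) ℝ :=
  1 + (-k) • dyad y

theorem sliceMetric_apply (k : ℝ) (y : Fin (d + 1) → ℝ) (i j : Fin d) :
    sliceMetric k y i j = (if i = j then 1 else 0) + k * y i.succ * y j.succ / slice k y := by
  simp [sliceMetric, dyad, Matrix.one_apply]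
  ring

theorem sliceInv_apply (k : ℝ) (y : Fin (d + 1) → ℝ) (i j : Fin d) :
    sliceInv k y i j = (if i = j then 1 else 0) - k * y i.succ * y j.succ := by
  simp [sliceInv, dyad, Matrix.one_apply]
  ring

theorem sliceMetric_mul_sliceInv {k : ℝ} {y : Fin (d + 1) → ℝ} (h : 0 < slice k y) :
    sliceMetric k y * sliceInv k y = 1 := by
  rw [sliceMetric, sliceInv, one_add_dyad_mul]
  have h1 : k * ∑ i : Fin d, y i.succ ^ 2 = 1 - slice k y := by simp [slice]
  have : k / slice k y + -k + k / slice k y * -k * ∑ i : Fin d, y i.succ ^ 2 = 0 := by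
    rw [mul_assoc, neg_mul, h1]
    field_simp
    ring
  rw [this, zero_smul, add_zero]

theorem flrwMetric_eq (k : ℝ) (a F : ℝ → ℝ) (y : Fin (d + 1) → ℝ) :
    flrwMetric d k a F y = timeSpaceBlock (-F (y 0)) (a (y 0) ^ 2 • sliceMetric k y) := by
  ext μ ν
  refine Fin.cases ?_ (fun i => ?_) μ <;> refine Fin.cases ?_ (fun j => ?_) ν
  · rfl
  · rfl
  · rfl
  · simp [flrwMetric, sliceMetric_apply, slice]

theorem flrwMetric_inv {k : ℝ} {a F : ℝ → ℝ} {y : Fin (d + 1) → ℝ} (ha : 0 < a (y 0))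
    (hF : 0 < F (y 0)) (h : 0 < slice k y) :
    (flrwMetric d k a F y)⁻¹ =
      timeSpaceBlock (-(F (y 0))⁻¹) ((a (y 0) ^ 2)⁻¹ • sliceInv k y) := by
  refine Matrix.inv_eq_right_inv ?_
  rw [flrwMetric_eq, timeSpaceBlock_mul, smul_mul_smul_comm, sliceMetric_mul_sliceInv h,
    mul_inv_cancel₀ (by positivity), neg_mul_neg, mul_inv_cancel₀ hF.ne', one_smul,
    timeSpaceBlock_one_one]

/-- An orthonormal frame of the FLRW metric, together with the dual frame. -/
theorem exists_frame {k : ℝ} {a F : ℝ → ℝ} {y : Fin (d + 1) → ℝ} (ha : 0 < a (y 0))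
    (hF : 0 < F (y 0)) (h : 0 < slice k y) :
    ∃ M N : Matrix (Fin (d + 1)) (Fin (d + 1)) ℝ, N * M.transpose = 1 ∧ M.transpose * N = 1 ∧
      M * timeProj d * M.transpose = timeSpaceBlock (F (y 0)) 0 ∧
      M * spaceProj d * M.transpose = timeSpaceBlock 0 (a (y 0) ^ 2 • sliceMetric k y) ∧
      N * timeProj d * N.transpose = timeSpaceBlock (F (y 0))⁻¹ 0 ∧
      N * minkowski d * N.transpose = (flrwMetric d k a F y)⁻¹ := by
  set w := Real.sqrt (slice k y) with hw
  have hw0 : 0 < w := Real.sqrt_pos.mpr h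
  have hw2 : w ^ 2 = slice k y := Real.sq_sqrt h.le
  have hr : k * ∑ i : Fin d, y i.succ ^ 2 = 1 - w ^ 2 := by rw [hw2]; simp [slice]
  set f := Real.sqrt (F (y 0)) with hf
  have hf0 : 0 < f := Real.sqrt_pos.mpr hF
  have hf2 : f * f = F (y 0) := Real.mul_self_sqrt hF.le
  set r := ∑ i : Fin d, y i.succ ^ 2 with hrdef
  -- Along x the matrix S has eigenvalue 1/w and S' has eigenvalue w, while both are the identity
  -- orthogonally to x. They are the square roots of the slice metric and of its inverse, with
  -- coefficients that stay regular at x = 0 and at k = 0.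
  set S := (1 + (k / (w * (1 + w))) • dyad y : Matrix (Fin d) (Fin d) ℝ) with hS
  set S' := (1 + (-(k / (1 + w))) • dyad y : Matrix (Fin d) (Fin d) ℝ) with hS'
  have hSt : S.transpose = S := by
    rw [hS, Matrix.transpose_add, Matrix.transpose_smul, dyad_transpose, Matrix.transpose_one]
  have hSt' : S'.transpose = S' := by
    rw [hS', Matrix.transpose_add, Matrix.transpose_smul, dyad_transpose, Matrix.transpose_one]
  have hkr : k * (k * r) = k * (1 - w ^ 2) := by rw [hr]
  have h1 : S * S' = 1 := by
    rw [hS, hS', one_add_dyad_mul, ← hrdef]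
    have : k / (w * (1 + w)) + -(k / (1 + w)) + k / (w * (1 + w)) * -(k / (1 + w)) * r = 0 := by
      field_simp
      linear_combination -hkr
    rw [this, zero_smul, add_zero]
  have h2 : S * S = sliceMetric k y := by
    rw [hS, one_add_dyad_mul, sliceMetric, ← hrdef, ← hw2]
    congr 2
    field_simp
    linear_combination hkr
  have h3 : S' * S' = sliceInv k y := by
    rw [hS', one_add_dyad_mul, sliceInv, ← hrdef]
    congr 2
    field_simp
    linear_combination hkr
  have h4 : S' * S = 1 := mul_eq_one_comm.mp h1
  have ha0 : a (y 0) ≠ 0 := ha.ne'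
  refine ⟨timeSpaceBlock f (a (y 0) • S), timeSpaceBlock f⁻¹ ((a (y 0))⁻¹ • S'),
    ?_, ?_, ?_, ?_, ?_, ?_⟩
  · rw [timeSpaceBlock_transpose, timeSpaceBlock_mul, Matrix.transpose_smul, hSt,
      smul_mul_smul_comm, h4, inv_mul_cancel₀ hf0.ne', inv_mul_cancel₀ ha0, one_smul,
      timeSpaceBlock_one_one]
  · rw [timeSpaceBlock_transpose, timeSpaceBlock_mul, Matrix.transpose_smul, hSt,
      smul_mul_smul_comm, h1, mul_inv_cancel₀ hf0.ne', mul_inv_cancel₀ ha0, one_smul,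
      timeSpaceBlock_one_one]
  · rw [timeProj, diagonal_cons_eq, timeSpaceBlock_transpose, timeSpaceBlock_mul,
      timeSpaceBlock_mul, mul_one, hf2, zero_smul, Matrix.mul_zero, Matrix.zero_mul]
  · rw [spaceProj, diagonal_cons_eq, timeSpaceBlock_transpose, timeSpaceBlock_mul,
      timeSpaceBlock_mul, mul_zero, zero_mul, one_smul, Matrix.mul_one, Matrix.transpose_smul, hSt,
      smul_mul_smul_comm, h2, sq]
  · rw [timeProj, diagonal_cons_eq, timeSpaceBlock_transpose, timeSpaceBlock_mul,
      timeSpaceBlock_mul, mul_one, ← mul_inv, hf2, zero_smul, Matrix.mul_zero, Matrix.zero_mul]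
  · rw [flrwMetric_inv ha hF h, minkowski, diagonal_cons_eq, timeSpaceBlock_transpose,
      timeSpaceBlock_mul, timeSpaceBlock_mul, one_smul, Matrix.mul_one, Matrix.transpose_smul, hSt',
      smul_mul_smul_comm, h3, ← hf2, sq, mul_inv, mul_inv]
    congr 1
    ring

/-! ### Christoffel symbols -/

theorem hasGrad_slice (k : ℝ) (y : Fin (d + 1) → ℝ) :
    HasGrad (slice k) (Fin.cons 0 fun l : Fin d => -2 * k * y l.succ) y := by
  have h : ∀ i ∈ (Finset.univ : Finset (Fin d)), HasGrad (fun z : Fin (d + 1) → ℝ => z i.succ ^ 2)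
      (fun a => 2 * y i.succ * if a = i.succ then 1 else 0) y := fun i _ => by
    simp only [sq]
    exact ((hasGrad_coord i.succ y).mul (hasGrad_coord i.succ y)).congr_grad fun a => by ring
  refine ((hasGrad_const 1 y).sub ((HasGrad.fun_sum h).const_mul k)).congr_grad fun a => ?_
  refine Fin.cases ?_ (fun l => ?_) a
  · simp [(Fin.succ_ne_zero _).symm]
  · simp
    ring

/-- The partial derivatives of the metric of the unit spatial slice. -/
noncomputable def sliceMetricGrad (k : ℝ) (y : Fin (d + 1) → ℝ) (i j l : Fin d) : ℝ :=
  k * ((if l = i then 1 else 0) * y j.succ + y i.succ * (if l = j then 1 else 0)) / slice k y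
    + 2 * k ^ 2 * y i.succ * y j.succ * y l.succ / slice k y ^ 2

theorem hasGrad_sliceMetric {k : ℝ} {y : Fin (d + 1) → ℝ} (h : 0 < slice k y) (i j : Fin d) :
    HasGrad (fun z => sliceMetric k z i j) (Fin.cons 0 (sliceMetricGrad k y i j)) y := by
  simp only [sliceMetric_apply]
  refine ((hasGrad_const _ y).add ((((hasGrad_coord i.succ y).const_mul k).mul
    (hasGrad_coord j.succ y)).div (hasGrad_slice k y) h.ne')).congr_grad fun a => ?_
  refine Fin.cases ?_ (fun l => ?_) a
  · simp [(Fin.succ_ne_zero _).symm]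
  · simp [sliceMetricGrad]
    split_ifs <;> ring

theorem hasGrad_sliceInv (k : ℝ) (y : Fin (d + 1) → ℝ) (i j : Fin d) :
    HasGrad (fun z => sliceInv k z i j) (Fin.cons 0 fun l : Fin d =>
      -k * ((if l = i then 1 else 0) * y j.succ + y i.succ * (if l = j then 1 else 0))) y := by
  simp only [sliceInv_apply]
  refine ((hasGrad_const _ y).sub (((hasGrad_coord i.succ y).const_mul k).mul
    (hasGrad_coord j.succ y))).congr_grad fun a => ?_
  refine Fin.cases ?_ (fun l => ?_) a
  · simp [(Fin.succ_ne_zero _).symm]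
  · simp
    split_ifs <;> ring

end FLRW

section FLRW

variable {d : ℕ}

theorem sum_sliceInv_mul_coord (k : ℝ) (y : Fin (d + 1) → ℝ) (i : Fin d) :
    ∑ l : Fin d, sliceInv k y i l * y l.succ = slice k y * y i.succ := by
  have : ∀ l : Fin d, sliceInv k y i l * y l.succ =
      (if i = l then y l.succ else 0) - k * y i.succ * y l.succ ^ 2 := fun l => by
    rw [sliceInv_apply]
    split_ifs <;> ring
  simp only [this, Finset.sum_sub_distrib, ← Finset.mul_sum, slice]
  simp
  ring

theorem sum_coord_mul_sliceMetric {k : ℝ} {y : Fin (d + 1) → ℝ} (h : 0 < slice k y) (i : Fin d) :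
    ∑ l : Fin d, y l.succ * sliceMetric k y i l = y i.succ / slice k y := by
  have : ∀ l : Fin d, y l.succ * sliceMetric k y i l =
      (if i = l then y l.succ else 0) + y i.succ / slice k y * k * y l.succ ^ 2 := fun l => by
    rw [sliceMetric_apply]
    split_ifs <;> ring
  simp only [this, Finset.sum_add_distrib, ← Finset.mul_sum]
  have h1 : k * ∑ i : Fin d, y i.succ ^ 2 = 1 - slice k y := by simp [slice]
  rw [mul_assoc, h1]
  simp
  field_simp
  ring

theorem sliceMetric_symm (k : ℝ) (y : Fin (d + 1) → ℝ) (i j : Fin d) :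
    sliceMetric k y i j = sliceMetric k y j i := by
  simp only [sliceMetric_apply, eq_comm (a := i)]
  ring

theorem sliceInv_symm (k : ℝ) (y : Fin (d + 1) → ℝ) (i j : Fin d) :
    sliceInv k y i j = sliceInv k y j i := by
  simp only [sliceInv_apply, eq_comm (a := i)]
  ring

/-- The Levi-Civita combination of derivatives is 2 k x_m γ_ij / (1 - k r²) for the slice metric γ,
and x is an eigenvector of γ⁻¹ with eigenvalue 1 - k r². The slice connection is therefore k x^l
γ_ij. -/
theorem sum_sliceInv_mul_grad {k : ℝ} {y : Fin (d + 1) → ℝ} (h : 0 < slice k y)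
    (l i j : Fin d) :
    ∑ m, sliceInv k y l m * (sliceMetricGrad k y j m i + sliceMetricGrad k y i m j
      - sliceMetricGrad k y i j m) = 2 * (k * y l.succ * sliceMetric k y i j) := by
  have : ∀ m : Fin d, sliceInv k y l m * (sliceMetricGrad k y j m i + sliceMetricGrad k y i m j
      - sliceMetricGrad k y i j m) =
      2 * k / slice k y * sliceMetric k y i j * (sliceInv k y l m * y m.succ) := by
    intro m
    simp only [sliceMetricGrad, sliceMetric_apply, eq_comm (a := j) (b := i),
      eq_comm (a := m) (b := i), eq_comm (a := m) (b := j)]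
    split_ifs <;> ring
  rw [Finset.sum_congr rfl fun m _ => this m, ← Finset.mul_sum, sum_sliceInv_mul_coord]
  field_simp

/-- The partial derivatives of the FLRW metric. -/
noncomputable def flrwMetricGrad (k : ℝ) (a F : ℝ → ℝ) (y : Fin (d + 1) → ℝ)
    (μ ν : Fin (d + 1)) : Fin (d + 1) → ℝ :=
  Fin.cases (Fin.cases (Fin.cons (-deriv F (y 0)) fun _ => 0) (fun _ _ => 0) ν)
    (fun i => Fin.cases (fun _ => 0) (fun j => Fin.cons
      (2 * a (y 0) * deriv a (y 0) * sliceMetric k y i j)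
      fun l => a (y 0) ^ 2 * sliceMetricGrad k y i j l) ν) μ

theorem hasGrad_flrwMetric {k : ℝ} {a F : ℝ → ℝ} {y : Fin (d + 1) → ℝ} (h : 0 < slice k y)
    (ha : DifferentiableAt ℝ a (y 0)) (hF : DifferentiableAt ℝ F (y 0)) (μ ν : Fin (d + 1)) :
    HasGrad (fun z => flrwMetric d k a F z μ ν) (flrwMetricGrad k a F y μ ν) y := by
  simp only [flrwMetric_eq]
  refine Fin.cases ?_ (fun i => ?_) μ <;> refine Fin.cases ?_ (fun j => ?_) ν
  · exact (hasGrad_time hF.hasDerivAt).neg.congr_grad fun b => by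
      refine Fin.cases ?_ (fun l => ?_) b <;> simp [flrwMetricGrad]
  · exact hasGrad_const 0 y
  · exact hasGrad_const 0 y
  · simp only [timeSpaceBlock_succ_succ, Matrix.smul_apply, smul_eq_mul]
    refine ((hasGrad_time (ha.hasDerivAt.pow 2)).mul (hasGrad_sliceMetric h i j)).congr_grad
      fun b => ?_
    refine Fin.cases ?_ (fun l => ?_) b <;> simp [flrwMetricGrad]

/-- The Christoffel symbols of the FLRW metric. -/
noncomputable def flrwChristoffel (k : ℝ) (a F : ℝ → ℝ) (y : Fin (d + 1) → ℝ)
    (c μ ν : Fin (d + 1)) : ℝ :=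
  Fin.cases
    (Fin.cases (Fin.cases (deriv F (y 0) / (2 * F (y 0))) (fun _ => 0) ν)
      (fun i => Fin.cases 0
        (fun j => a (y 0) * deriv a (y 0) / F (y 0) * sliceMetric k y i j) ν) μ)
    (fun l => Fin.cases
      (Fin.cases 0 (fun j => if l = j then deriv a (y 0) / a (y 0) else 0) ν)
      (fun i => Fin.cases (if l = i then deriv a (y 0) / a (y 0) else 0)
        (fun j => k * y l.succ * sliceMetric k y i j) ν) μ) c

theorem sum_sliceInv_mul_sliceMetric {k : ℝ} {y : Fin (d + 1) → ℝ} (h : 0 < slice k y)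
    (i j : Fin d) : ∑ l, sliceInv k y i l * sliceMetric k y l j = if i = j then 1 else 0 := by
  have h2 : sliceInv k y * sliceMetric k y = 1 := mul_eq_one_comm.mp (sliceMetric_mul_sliceInv h)
  rw [← Matrix.mul_apply, h2, Matrix.one_apply]

theorem christoffel_flrwMetric {k : ℝ} {a F : ℝ → ℝ} {y : Fin (d + 1) → ℝ} (h : 0 < slice k y)
    (ha : DifferentiableAt ℝ a (y 0)) (hF : DifferentiableAt ℝ F (y 0)) (ha0 : 0 < a (y 0))
    (hF0 : 0 < F (y 0)) (c μ ν : Fin (d + 1)) :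
    christoffel (flrwMetric d k a F) y c μ ν = flrwChristoffel k a F y c μ ν := by
  simp only [christoffel, fun μ ν b => (hasGrad_flrwMetric h ha hF μ ν).pderiv_eq b,
    flrwMetric_inv ha0 hF0 h, Fin.sum_univ_succ]
  have hs := sum_sliceInv_mul_sliceMetric h
  refine Fin.cases ?_ (fun l => ?_) c <;> refine Fin.cases ?_ (fun i => ?_) μ <;>
    refine Fin.cases ?_ (fun j => ?_) ν
  · simp [flrwMetricGrad, flrwChristoffel]
    field_simp
  · simp [flrwMetricGrad, flrwChristoffel]
  · simp [flrwMetricGrad, flrwChristoffel]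
  · simp [flrwMetricGrad, flrwChristoffel]
    field_simp
  · simp [flrwMetricGrad, flrwChristoffel]
  · simp [flrwMetricGrad, flrwChristoffel]
    have : ∀ m, (a (y 0) ^ 2)⁻¹ * sliceInv k y l m *
        (2 * a (y 0) * deriv a (y 0) * sliceMetric k y j m) =
        2 * (deriv a (y 0) / a (y 0)) * (sliceInv k y l m * sliceMetric k y m j) := fun m => by
      rw [sliceMetric_symm k y j m]
      field_simp
    rw [Finset.sum_congr rfl fun m _ => this m, ← Finset.mul_sum, hs]
    split_ifs <;> ring
  · simp [flrwMetricGrad, flrwChristoffel]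
    have : ∀ m, (a (y 0) ^ 2)⁻¹ * sliceInv k y l m *
        (2 * a (y 0) * deriv a (y 0) * sliceMetric k y i m) =
        2 * (deriv a (y 0) / a (y 0)) * (sliceInv k y l m * sliceMetric k y m i) := fun m => by
      rw [sliceMetric_symm k y i m]
      field_simp
    rw [Finset.sum_congr rfl fun m _ => this m, ← Finset.mul_sum, hs]
    split_ifs <;> ring
  · simp [flrwMetricGrad, flrwChristoffel]
    have : ∀ m, (a (y 0) ^ 2)⁻¹ * sliceInv k y l m *
        (a (y 0) ^ 2 * sliceMetricGrad k y j m i + a (y 0) ^ 2 * sliceMetricGrad k y i m j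
          - a (y 0) ^ 2 * sliceMetricGrad k y i j m) =
        sliceInv k y l m * (sliceMetricGrad k y j m i + sliceMetricGrad k y i m j
          - sliceMetricGrad k y i j m) := fun m => by
      field_simp
    rw [Finset.sum_congr rfl fun m _ => this m, sum_sliceInv_mul_grad h]
    ring

/-! ### The Riemann tensor of the FLRW metric. -/

theorem isOpen_patch (k : ℝ) : IsOpen {y : Fin (d + 1) → ℝ | 0 < slice k y} := by
  refine isOpen_lt continuous_const ?_
  unfold slice
  fun_prop

theorem eventually_patch {k : ℝ} {y : Fin (d + 1) → ℝ} (h : 0 < slice k y) :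
    ∀ᶠ z in nhds y, 0 < slice k z := (isOpen_patch k).mem_nhds h

/-- The time-space sectional curvature of the FLRW metric. -/
noncomputable def curvA (a F : ℝ → ℝ) (t : ℝ) : ℝ :=
  (deriv (deriv a) t / a t - deriv F t * deriv a t / (2 * F t * a t)) / F t

/-- The sectional curvature of the FLRW metric in the spatial directions. -/
noncomputable def curvB (k : ℝ) (a F : ℝ → ℝ) (t : ℝ) : ℝ := (k + deriv a t ^ 2 / F t) / a t ^ 2

/-- This is ∇_j γ_im = ∇_i γ_jm for the slice metric γ, written out with the connection k x^l γ_ij.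
It removes the derivatives of γ from Riemann components with three or four spatial indices. -/
theorem sliceMetricGrad_antisymm {k : ℝ} {y : Fin (d + 1) → ℝ} (h : 0 < slice k y)
    (i j m : Fin d) :
    sliceMetricGrad k y i m j - sliceMetricGrad k y j m i
      + k * (sliceMetric k y i m * (y j.succ / slice k y)
        - sliceMetric k y j m * (y i.succ / slice k y)) = 0 := by
  simp only [sliceMetricGrad, sliceMetric_apply, eq_comm (a := j) (b := i)]
  field_simp
  split_ifs <;> ring

end FLRW

section FLRW

variable {d : ℕ}

/-- The partial derivatives of the Christoffel symbols of the FLRW metric. -/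
noncomputable def flrwChristoffelGrad (k : ℝ) (a F : ℝ → ℝ) (y : Fin (d + 1) → ℝ)
    (c μ ν : Fin (d + 1)) : Fin (d + 1) → ℝ :=
  Fin.cases
    (Fin.cases (Fin.cases
        (Fin.cons ((deriv (deriv F) (y 0) * F (y 0) - deriv F (y 0) ^ 2) / (2 * F (y 0) ^ 2))
          fun _ => 0) (fun _ _ => 0) ν)
      (fun i => Fin.cases (fun _ => 0)
        (fun j => Fin.cons (((deriv a (y 0) ^ 2 + a (y 0) * deriv (deriv a) (y 0)) / F (y 0)
            - a (y 0) * deriv a (y 0) * deriv F (y 0) / F (y 0) ^ 2) * sliceMetric k y i j)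
          fun m => a (y 0) * deriv a (y 0) / F (y 0) * sliceMetricGrad k y i j m) ν) μ)
    (fun l => Fin.cases
      (Fin.cases (fun _ => 0) (fun j => Fin.cons (if l = j then
        deriv (deriv a) (y 0) / a (y 0) - deriv a (y 0) ^ 2 / a (y 0) ^ 2 else 0) fun _ => 0) ν)
      (fun i => Fin.cases (Fin.cons (if l = i then
        deriv (deriv a) (y 0) / a (y 0) - deriv a (y 0) ^ 2 / a (y 0) ^ 2 else 0) fun _ => 0)
        (fun j => Fin.cons 0 fun m => k * ((if m = l then 1 else 0) * sliceMetric k y i j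
          + y l.succ * sliceMetricGrad k y i j m)) ν) μ) c

theorem hasGrad_flrwChristoffel {k : ℝ} {a F : ℝ → ℝ} {y : Fin (d + 1) → ℝ} (h : 0 < slice k y)
    (ha : ContDiff ℝ (⊤ : ℕ∞) a) (hF : ContDiff ℝ (⊤ : ℕ∞) F) (ha0 : 0 < a (y 0))
    (hF0 : 0 < F (y 0)) (c μ ν : Fin (d + 1)) :
    HasGrad (fun z => flrwChristoffel k a F z c μ ν) (flrwChristoffelGrad k a F y c μ ν) y := by
  have da := (ha.differentiable (by simp) (y 0)).hasDerivAt
  have dF := (hF.differentiable (by simp) (y 0)).hasDerivAt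
  have da2 := ((contDiff_infty_iff_deriv.mp ha).2.differentiable (by simp) (y 0)).hasDerivAt
  have dF2 := ((contDiff_infty_iff_deriv.mp hF).2.differentiable (by simp) (y 0)).hasDerivAt
  have h3 : HasDerivAt (fun t => deriv a t / a t)
      (deriv (deriv a) (y 0) / a (y 0) - deriv a (y 0) ^ 2 / a (y 0) ^ 2) (y 0) := by
    refine (da2.fun_div da ha0.ne').congr_deriv ?_
    field_simp
  have h4 : ∀ P : Prop, [Decidable P] → HasGrad
      (fun z : Fin (d + 1) → ℝ => if P then deriv a (z 0) / a (z 0) else 0)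
      (Fin.cons (if P then
        deriv (deriv a) (y 0) / a (y 0) - deriv a (y 0) ^ 2 / a (y 0) ^ 2 else 0) fun _ => 0) y := by
    intro P _
    by_cases hP : P
    · simpa only [hP, if_true] using hasGrad_time h3
    · simp only [hP, if_false]
      exact (hasGrad_const 0 y).congr_grad fun b => by
        refine Fin.cases ?_ (fun l => ?_) b <;> simp
  refine Fin.cases ?_ (fun l => ?_) c <;> refine Fin.cases ?_ (fun i => ?_) μ <;>
    refine Fin.cases ?_ (fun j => ?_) ν
  · refine hasGrad_time (φ := fun t => deriv F t / (2 * F t)) ?_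
    refine (dF2.fun_div (dF.const_mul 2) (by positivity)).congr_deriv ?_
    field_simp
  · exact hasGrad_const 0 y
  · exact hasGrad_const 0 y
  · have h2 : HasDerivAt (fun t => a t * deriv a t / F t)
        ((deriv a (y 0) ^ 2 + a (y 0) * deriv (deriv a) (y 0)) / F (y 0)
            - a (y 0) * deriv a (y 0) * deriv F (y 0) / F (y 0) ^ 2) (y 0) := by
      refine ((da.fun_mul da2).fun_div dF hF0.ne').congr_deriv ?_
      field_simp
    refine ((hasGrad_time h2).mul (hasGrad_sliceMetric h i j)).congr_grad fun b => ?_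
    refine Fin.cases ?_ (fun m => ?_) b <;> simp [flrwChristoffelGrad]
  · exact hasGrad_const 0 y
  · exact h4 (l = j)
  · exact h4 (l = i)
  · refine (((hasGrad_coord l.succ y).const_mul k).mul (hasGrad_sliceMetric h i j)).congr_grad
      fun b => ?_
    refine Fin.cases ?_ (fun m => ?_) b
    · simp [flrwChristoffelGrad, (Fin.succ_ne_zero _).symm]
    · simp [flrwChristoffelGrad]
      split_ifs <;> ring

theorem pderiv_christoffel_flrwMetric {k : ℝ} {a F : ℝ → ℝ} {y : Fin (d + 1) → ℝ}
    (h : 0 < slice k y) (ha : ContDiff ℝ (⊤ : ℕ∞) a) (hF : ContDiff ℝ (⊤ : ℕ∞) F)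
    (ha0 : ∀ t, 0 < a t) (hF0 : ∀ t, 0 < F t) (c μ ν b : Fin (d + 1)) :
    pderiv b (fun z => christoffel (flrwMetric d k a F) z c μ ν) y =
      flrwChristoffelGrad k a F y c μ ν b := by
  refine ((hasGrad_flrwChristoffel h ha hF (ha0 _) (hF0 _) c μ ν).congr_of_eventuallyEq
    ?_).pderiv_eq b
  filter_upwards [eventually_patch h] with z hz
  exact christoffel_flrwMetric hz (ha.differentiable (by simp) _) (hF.differentiable (by simp) _)
    (ha0 _) (hF0 _) c μ ν

/-- The Riemann tensor of the FLRW metric. -/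
theorem riemann_flrwMetric {k : ℝ} {a F : ℝ → ℝ} {y : Fin (d + 1) → ℝ}
    (h : 0 < slice k y) (ha : ContDiff ℝ (⊤ : ℕ∞) a) (hF : ContDiff ℝ (⊤ : ℕ∞) F)
    (ha0 : ∀ t, 0 < a t) (hF0 : ∀ t, 0 < F t) :
    riemann (flrwMetric d k a F) y = isoRiemann (timeSpaceBlock (F (y 0)) 0)
      (timeSpaceBlock 0 (a (y 0) ^ 2 • sliceMetric k y)) (curvA a F (y 0)) (curvB k a F (y 0)) := by
  have hup : ∀ a' b c e, riemannUp (flrwMetric d k a F) y a' b c e =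
      flrwChristoffelGrad k a F y e a' c b - flrwChristoffelGrad k a F y e b c a' +
      ∑ f, (flrwChristoffel k a F y f a' c * flrwChristoffel k a F y e b f
        - flrwChristoffel k a F y f b c * flrwChristoffel k a F y e a' f) := by
    intro a' b c e
    simp only [riemannUp, pderiv_christoffel_flrwMetric h ha hF ha0 hF0,
      christoffel_flrwMetric h (ha.differentiable (by simp) _) (hF.differentiable (by simp) _)
        (ha0 _) (hF0 _)]
  have hanti : ∀ a' b c e, riemannUp (flrwMetric d k a F) y b a' c e =
      -riemannUp (flrwMetric d k a F) y a' b c e := by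
    intro a' b c e
    simp only [hup, Finset.sum_sub_distrib]
    ring
  have h00 : ∀ c e, riemannUp (flrwMetric d k a F) y 0 0 c e = 0 := fun c e => by
    have := hanti 0 0 c e
    linarith
  have hF1 := hF0 (y 0)
  have ha1 := ha0 (y 0)
  have h0j00 : ∀ j : Fin d, riemannUp (flrwMetric d k a F) y 0 j.succ 0 0 = 0 := fun j => by
    rw [hup]
    simp [Fin.sum_univ_succ, flrwChristoffel, flrwChristoffelGrad]
  have h0j0l : ∀ j l : Fin d, riemannUp (flrwMetric d k a F) y 0 j.succ 0 l.succ =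
      if l = j then -F (y 0) * curvA a F (y 0) else 0 := fun j l => by
    rw [hup]
    simp [Fin.sum_univ_succ, flrwChristoffel, flrwChristoffelGrad]
    split_ifs
    · rw [curvA]
      field_simp
      ring
    · ring
  have h0jk0 : ∀ j m : Fin d, riemannUp (flrwMetric d k a F) y 0 j.succ m.succ 0 =
      -a (y 0) ^ 2 * curvA a F (y 0) * sliceMetric k y j m := fun j m => by
    rw [hup]
    simp [Fin.sum_univ_succ, flrwChristoffel, flrwChristoffelGrad]
    rw [curvA]
    field_simp
    ring
  have h0jkl : ∀ j m l : Fin d, riemannUp (flrwMetric d k a F) y 0 j.succ m.succ l.succ = 0 :=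
    fun j m l => by
      rw [hup]
      simp [Fin.sum_univ_succ, flrwChristoffel, flrwChristoffelGrad]
      ring
  have hij00 : ∀ i j : Fin d, riemannUp (flrwMetric d k a F) y i.succ j.succ 0 0 = 0 :=
    fun i j => by
      rw [hup]
      simp [Fin.sum_univ_succ, flrwChristoffel, flrwChristoffelGrad]
      rw [sliceMetric_symm k y i j]
      ring
  have hij0l : ∀ i j l : Fin d, riemannUp (flrwMetric d k a F) y i.succ j.succ 0 l.succ = 0 :=
    fun i j l => by
      rw [hup]
      simp [Fin.sum_univ_succ, flrwChristoffel, flrwChristoffelGrad]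
      rw [sliceMetric_symm k y i j]
      ring
  have hg := sum_coord_mul_sliceMetric h
  have hijk0 : ∀ i j m : Fin d, riemannUp (flrwMetric d k a F) y i.succ j.succ m.succ 0 = 0 :=
    fun i j m => by
      rw [hup]
      simp [Fin.sum_univ_succ, flrwChristoffel, flrwChristoffelGrad]
      have : ∀ x, k * y x.succ * sliceMetric k y i m *
            (a (y 0) * deriv a (y 0) / F (y 0) * sliceMetric k y j x) =
          k * sliceMetric k y i m * (a (y 0) * deriv a (y 0) / F (y 0)) *
            (y x.succ * sliceMetric k y j x) := fun x => by ring
      rw [Finset.sum_congr rfl fun x _ => this x]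
      have : ∀ x, k * y x.succ * sliceMetric k y j m *
            (a (y 0) * deriv a (y 0) / F (y 0) * sliceMetric k y i x) =
          k * sliceMetric k y j m * (a (y 0) * deriv a (y 0) / F (y 0)) *
            (y x.succ * sliceMetric k y i x) := fun x => by ring
      rw [Finset.sum_congr rfl fun x _ => this x, ← Finset.mul_sum, ← Finset.mul_sum, hg, hg]
      linear_combination a (y 0) * deriv a (y 0) / F (y 0) * sliceMetricGrad_antisymm h i j m
  have hijkl : ∀ i j m l : Fin d, riemannUp (flrwMetric d k a F) y i.succ j.succ m.succ l.succ =
      a (y 0) ^ 2 * curvB k a F (y 0) * ((if l = j then 1 else 0) * sliceMetric k y i m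
        - (if l = i then 1 else 0) * sliceMetric k y j m) :=
    fun i j m l => by
      rw [hup]
      simp [Fin.sum_univ_succ, flrwChristoffel, flrwChristoffelGrad]
      have : ∀ x, k * y x.succ * sliceMetric k y i m *
            (k * y l.succ * sliceMetric k y j x) =
          k * sliceMetric k y i m * (k * y l.succ) *
            (y x.succ * sliceMetric k y j x) := fun x => by ring
      rw [Finset.sum_congr rfl fun x _ => this x]
      have : ∀ x, k * y x.succ * sliceMetric k y j m *
            (k * y l.succ * sliceMetric k y i x) =
          k * sliceMetric k y j m * (k * y l.succ) *
            (y x.succ * sliceMetric k y i x) := fun x => by ring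
      rw [Finset.sum_congr rfl fun x _ => this x, ← Finset.mul_sum, ← Finset.mul_sum, hg, hg, curvB]
      have hw := sliceMetricGrad_antisymm h i j m
      simp only [eq_comm (a := j) (b := l), eq_comm (a := i) (b := l)]
      split_ifs <;> field_simp at hw ⊢ <;> linear_combination k * y l.succ * F (y 0) * hw
  funext a' b c e
  simp only [riemann, flrwMetric_eq, Fin.sum_univ_succ]
  refine Fin.cases ?_ (fun i => ?_) a' <;> refine Fin.cases ?_ (fun j => ?_) b <;>
    refine Fin.cases ?_ (fun m => ?_) c <;> refine Fin.cases ?_ (fun l => ?_) e <;>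
    simp [isoRiemann, kn, h00, h0j00, h0j0l, h0jk0, h0jkl, hij00, hij0l, hijk0, hijkl,
      hanti 0 (Fin.succ _), sub_mul, Finset.sum_sub_distrib, mul_sub, mul_assoc]
  all_goals ring

end FLRW

section FLRW

variable {d : ℕ}

/-- The coefficient of the spatial part of the curvature momentum. -/
noncomputable def momentumS (L : Lagrangian (d + 1)) (k : ℝ) (a F : ℝ → ℝ) (t : ℝ) : ℝ :=
  reducedB L (curvA a F t, curvB k a F t) / (2 * d * (d - 1))

/-- The coefficient of the time-space part of the curvature momentum. -/
noncomputable def momentumT (L : Lagrangian (d + 1)) (k : ℝ) (a F : ℝ → ℝ) (t : ℝ) : ℝ :=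
  -(reducedA L (curvA a F t, curvB k a F t) / (4 * d))

/-- Transport of the frame result: M carries the frame curvature to the coordinate curvature and
pulls the inverse metric back to the Minkowski one, while N undoes the transpose of M. -/
theorem IsInvariant.curvatureMomentum_flrw {L : Lagrangian (d + 1)} (hL : IsInvariant L)
    (hd : 2 ≤ d) {k : ℝ} {a F : ℝ → ℝ} {y : Fin (d + 1) → ℝ}
    (h : 0 < slice k y) (ha : ContDiff ℝ (⊤ : ℕ∞) a) (hF : ContDiff ℝ (⊤ : ℕ∞) F)
    (ha0 : ∀ t, 0 < a t) (hF0 : ∀ t, 0 < F t) :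
    curvatureMomentum L (flrwMetric d k a F y)⁻¹ (riemann (flrwMetric d k a F) y) =
      isoMomentum (flrwMetric d k a F y)⁻¹ (timeSpaceBlock (F (y 0))⁻¹ 0)
        (momentumS L k a F (y 0)) (momentumT L k a F (y 0) + momentumS L k a F (y 0)) ∧
    L (flrwMetric d k a F y)⁻¹ (riemann (flrwMetric d k a F) y) =
      reduced L (curvA a F (y 0), curvB k a F (y 0)) := by
  obtain ⟨M, N, h1, h2, h3, h4, h5, h6⟩ := exists_frame (ha0 (y 0)) (hF0 (y 0)) h
  have hR : riemann (flrwMetric d k a F) y = act M (isoRiemann (timeProj d) (spaceProj d)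
      (curvA a F (y 0)) (curvB k a F (y 0))) := by
    rw [riemann_flrwMetric h ha hF ha0 hF0, act_isoRiemann, h3, h4]
  have h7 : N.transpose * M = 1 := by
    rw [← Matrix.transpose_one, ← h2, Matrix.transpose_mul, Matrix.transpose_transpose]
  have hG : M.transpose * (flrwMetric d k a F y)⁻¹ * M = minkowski d := by
    rw [← h6]
    calc M.transpose * (N * minkowski d * N.transpose) * M
        = (M.transpose * N) * minkowski d * (N.transpose * M) := by simp only [Matrix.mul_assoc]
      _ = minkowski d := by rw [h2, h7, one_mul, mul_one]
  constructor
  · have := hL.curvatureMomentum_act (flrwMetric d k a F y)⁻¹ M (isoRiemann (timeProj d)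
      (spaceProj d) (curvA a F (y 0)) (curvB k a F (y 0)))
    rw [hG, ← hR] at this
    have h8 := congrArg (act N) this
    rw [act_act, h1, act_one, hL.momentum_frame hd, act_isoMomentum, h5, h6] at h8
    exact h8.symm
  · rw [hR, hL.covariant, hG]
    rfl

/-! ### Contractions of curvature tensors -/

theorem sum_kn_mul_kn {D : ℕ} (X Y S T : Matrix (Fin D) (Fin D) ℝ) (a h : Fin D) :
    ∑ c, ∑ e, ∑ f, kn X Y a c e f * kn S T h c e f =
      2 * ((X * S.transpose) a h * (Y * T.transpose).trace
        - (X * T.transpose * Y * S.transpose) a h) := by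
  have e1 : (X * S.transpose) a h * (Y * T.transpose).trace =
      ∑ c, ∑ e, ∑ f, X a e * S h e * (Y c f * T c f) := by
    simp only [Matrix.mul_apply, Matrix.trace, Matrix.diag_apply, Matrix.transpose_apply,
      Finset.sum_mul_sum]
    rw [Finset.sum_comm]
    simp only [Finset.mul_sum]
  have e1' : (X * S.transpose) a h * (Y * T.transpose).trace =
      ∑ c, ∑ e, ∑ f, X a f * S h f * (Y c e * T c e) := by
    rw [e1]
    exact Finset.sum_congr rfl fun _ _ => Finset.sum_comm
  have e2 : (X * T.transpose * Y * S.transpose) a h =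
      ∑ c, ∑ e, ∑ f, X a e * T c e * Y c f * S h f := by
    simp only [Matrix.mul_apply, Matrix.transpose_apply, Finset.sum_mul]
    rw [Finset.sum_comm]
    refine Finset.sum_congr rfl fun _ _ => Finset.sum_comm
  have e2' : (X * T.transpose * Y * S.transpose) a h =
      ∑ c, ∑ e, ∑ f, X a f * T c f * Y c e * S h e := by
    rw [e2]
    exact Finset.sum_congr rfl fun _ _ => Finset.sum_comm
  rw [two_mul]
  nth_rewrite 1 [e1, e2]
  rw [e1', e2']
  simp only [← Finset.sum_add_distrib, ← Finset.sum_sub_distrib, kn]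
  exact Finset.sum_congr rfl fun _ _ => Finset.sum_congr rfl fun _ _ =>
    Finset.sum_congr rfl fun _ _ => by ring

theorem timeSpaceBlock_trace (p : ℝ) (X : Matrix (Fin d) (Fin d) ℝ) :
    (timeSpaceBlock p X).trace = p + X.trace := by
  simp [Matrix.trace, Fin.sum_univ_succ]

/-- This evaluates the term P^{acde} R^b_{cde} by bilinearity in `kn`. In its use ρ - σ is the
time-space momentum, so the time-time entry carries A alone. -/
theorem sum_isoMomentum_mul_isoRiemann (F A B σ ρ : ℝ) (hF : F ≠ 0)
    (X Y : Matrix (Fin d) (Fin d) ℝ) (hXY : X * Y = 1) (hX : X.transpose = X)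
    (hY : Y.transpose = Y) (a b : Fin (d + 1)) :
    ∑ c, ∑ e, ∑ f, isoMomentum (timeSpaceBlock (-F⁻¹) X) (timeSpaceBlock F⁻¹ 0) σ ρ a c e f *
      ∑ h, timeSpaceBlock (-F⁻¹) X b h *
        isoRiemann (timeSpaceBlock F 0) (timeSpaceBlock 0 Y) A B h c e f =
    timeSpaceBlock (2 * d * (ρ - σ) * A * F⁻¹)
      ((2 * (d - 1) * σ * B - 2 * (ρ - σ) * A) • X) a b := by
  have h1 : ∑ c, ∑ e, ∑ f,
      isoMomentum (timeSpaceBlock (-F⁻¹) X) (timeSpaceBlock F⁻¹ 0) σ ρ a c e f *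
      ∑ h, timeSpaceBlock (-F⁻¹) X b h *
        isoRiemann (timeSpaceBlock F 0) (timeSpaceBlock 0 Y) A B h c e f =
      ∑ h, timeSpaceBlock (-F⁻¹) X b h * ∑ c, ∑ e, ∑ f,
        isoMomentum (timeSpaceBlock (-F⁻¹) X) (timeSpaceBlock F⁻¹ 0) σ ρ a c e f *
          isoRiemann (timeSpaceBlock F 0) (timeSpaceBlock 0 Y) A B h c e f := by
    simp only [Finset.mul_sum]
    symm
    rw [Finset.sum_comm]
    refine Finset.sum_congr rfl fun _ _ => ?_
    rw [Finset.sum_comm]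
    refine Finset.sum_congr rfl fun _ _ => ?_
    rw [Finset.sum_comm]
    exact Finset.sum_congr rfl fun _ _ => Finset.sum_congr rfl fun _ _ => by ring
  have h2 : ∀ h, ∑ c, ∑ e, ∑ f,
        isoMomentum (timeSpaceBlock (-F⁻¹) X) (timeSpaceBlock F⁻¹ 0) σ ρ a c e f *
          isoRiemann (timeSpaceBlock F 0) (timeSpaceBlock 0 Y) A B h c e f =
      timeSpaceBlock (-(2 * d * (ρ - σ) * A))
        ((2 * (d - 1) * σ * B - 2 * (ρ - σ) * A) • (1 : Matrix (Fin d) (Fin d) ℝ)) a h := by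
    intro h
    have h3 : ∀ c e f, isoMomentum (timeSpaceBlock (-F⁻¹) X) (timeSpaceBlock F⁻¹ 0) σ ρ a c e f *
          isoRiemann (timeSpaceBlock F 0) (timeSpaceBlock 0 Y) A B h c e f =
        σ * B * (kn (timeSpaceBlock (-F⁻¹) X) (timeSpaceBlock (-F⁻¹) X) a c e f *
            kn (timeSpaceBlock 0 Y) (timeSpaceBlock 0 Y) h c e f)
        - σ * A * (kn (timeSpaceBlock (-F⁻¹) X) (timeSpaceBlock (-F⁻¹) X) a c e f *
            kn (timeSpaceBlock F 0) (timeSpaceBlock 0 Y) h c e f)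
        - σ * A * (kn (timeSpaceBlock (-F⁻¹) X) (timeSpaceBlock (-F⁻¹) X) a c e f *
            kn (timeSpaceBlock 0 Y) (timeSpaceBlock F 0) h c e f)
        + ρ * B * (kn (timeSpaceBlock (-F⁻¹) X) (timeSpaceBlock F⁻¹ 0) a c e f *
            kn (timeSpaceBlock 0 Y) (timeSpaceBlock 0 Y) h c e f)
        - ρ * A * (kn (timeSpaceBlock (-F⁻¹) X) (timeSpaceBlock F⁻¹ 0) a c e f *
            kn (timeSpaceBlock F 0) (timeSpaceBlock 0 Y) h c e f)
        - ρ * A * (kn (timeSpaceBlock (-F⁻¹) X) (timeSpaceBlock F⁻¹ 0) a c e f *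
            kn (timeSpaceBlock 0 Y) (timeSpaceBlock F 0) h c e f)
        + ρ * B * (kn (timeSpaceBlock F⁻¹ 0) (timeSpaceBlock (-F⁻¹) X) a c e f *
            kn (timeSpaceBlock 0 Y) (timeSpaceBlock 0 Y) h c e f)
        - ρ * A * (kn (timeSpaceBlock F⁻¹ 0) (timeSpaceBlock (-F⁻¹) X) a c e f *
            kn (timeSpaceBlock F 0) (timeSpaceBlock 0 Y) h c e f)
        - ρ * A * (kn (timeSpaceBlock F⁻¹ 0) (timeSpaceBlock (-F⁻¹) X) a c e f *
            kn (timeSpaceBlock 0 Y) (timeSpaceBlock F 0) h c e f) := by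
      intro c e f
      simp only [isoMomentum, isoRiemann, Pi.add_apply, Pi.sub_apply, Pi.smul_apply, smul_eq_mul]
      ring
    simp only [h3, Finset.sum_add_distrib, Finset.sum_sub_distrib, ← Finset.mul_sum,
      sum_kn_mul_kn, timeSpaceBlock_transpose, timeSpaceBlock_mul, hY, hXY, Matrix.transpose_zero,
      mul_zero, zero_mul, timeSpaceBlock_trace,
      Matrix.trace_zero, Matrix.trace_one, Fintype.card_fin, neg_mul, inv_mul_cancel₀ hF,
      Matrix.one_mul]
    refine Fin.cases ?_ (fun i => ?_) a <;> refine Fin.cases ?_ (fun j => ?_) h <;> simp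
    · ring
    · ring
  simp only [h1, h2]
  rw [Finset.sum_congr rfl fun h _ => mul_comm _ _]
  have := Matrix.mul_apply (M := timeSpaceBlock (-(2 * d * (ρ - σ) * A))
        ((2 * (d - 1) * σ * B - 2 * (ρ - σ) * A) • (1 : Matrix (Fin d) (Fin d) ℝ)))
        (N := (timeSpaceBlock (-F⁻¹) X).transpose) (i := a) (k := b)
  simp only [Matrix.transpose_apply] at this
  rw [← this, timeSpaceBlock_transpose, timeSpaceBlock_mul, hX, Matrix.smul_mul, Matrix.one_mul,
    neg_mul_neg]

end FLRW

/-! ### Covariant derivatives -/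

/-- The connection terms of the covariant derivative of a tensor with two upper indices. -/
def connection2 {D : ℕ} (Γ : Fin D → Fin D → Fin D → ℝ) (U : Matrix (Fin D) (Fin D) ℝ)
    (e a b : Fin D) : ℝ := ∑ f, (Γ a e f * U f b + Γ b e f * U a f)

/-- The connection terms of the covariant derivative of a tensor with four upper indices. -/
def connection4 {D : ℕ} (Γ : Fin D → Fin D → Fin D → ℝ) (T : Tensor4 D)
    (e a b c d : Fin D) : ℝ :=
  ∑ f, (Γ a e f * T f b c d + Γ b e f * T a f c d + Γ c e f * T a b f d + Γ d e f * T a b c f)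

section Covariant

variable {D : ℕ} {Γ : Fin D → Fin D → Fin D → ℝ} {U V : (Fin D → ℝ) → Matrix (Fin D) (Fin D) ℝ}
  {X Y : Fin D → Matrix (Fin D) (Fin D) ℝ} {y : Fin D → ℝ}

/-- A gradient of the form X - ΓU says that X is the covariant derivative of U. In this form the
Leibniz rule is immediate, since the connection terms act as a derivation. -/
theorem hasGrad_kn
    (hU : ∀ a b, HasGrad (fun z => U z a b) (fun e => X e a b - connection2 Γ (U y) e a b) y)
    (hV : ∀ a b, HasGrad (fun z => V z a b) (fun e => Y e a b - connection2 Γ (V y) e a b) y)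
    (a b c d : Fin D) :
    HasGrad (fun z => kn (U z) (V z) a b c d)
      (fun e => kn (X e) (V y) a b c d + kn (U y) (Y e) a b c d
        - connection4 Γ (kn (U y) (V y)) e a b c d) y := by
  refine (((hU a c).mul (hV b d)).sub ((hU a d).mul (hV b c))).congr_grad fun e => ?_
  have : connection4 Γ (kn (U y) (V y)) e a b c d =
      connection2 Γ (U y) e a c * V y b d + U y a c * connection2 Γ (V y) e b d
        - connection2 Γ (U y) e a d * V y b c - U y a d * connection2 Γ (V y) e b c := by
    simp only [connection4, connection2, Finset.sum_mul, Finset.mul_sum, ← Finset.sum_add_distrib,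
      ← Finset.sum_sub_distrib, kn]
    exact Finset.sum_congr rfl fun f _ => by ring
  rw [this]
  simp only [kn]
  ring

theorem hasGrad_isoMomentum {s r : (Fin D → ℝ) → ℝ} {s' r' : Fin D → ℝ} (hs : HasGrad s s' y)
    (hr : HasGrad r r' y)
    (hU : ∀ a b, HasGrad (fun z => U z a b) (fun e => -connection2 Γ (U y) e a b) y)
    (hV : ∀ a b, HasGrad (fun z => V z a b) (fun e => Y e a b - connection2 Γ (V y) e a b) y)
    (a b c d : Fin D) :
    HasGrad (fun z => isoMomentum (U z) (V z) (s z) (r z) a b c d)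
      (fun e => s' e * kn (U y) (U y) a b c d
        + r' e * (kn (U y) (V y) a b c d + kn (V y) (U y) a b c d)
        + r y * (kn (U y) (Y e) a b c d + kn (Y e) (U y) a b c d)
        - connection4 Γ (isoMomentum (U y) (V y) (s y) (r y)) e a b c d) y := by
  have hU' : ∀ a b, HasGrad (fun z => U z a b)
      (fun e => (0 : Fin D → Matrix (Fin D) (Fin D) ℝ) e a b - connection2 Γ (U y) e a b) y :=
    fun a b => (hU a b).congr_grad fun e => by simp
  refine ((hs.mul (hasGrad_kn hU' hU' a b c d)).add (hr.mul ((hasGrad_kn hU' hV a b c d).add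
    (hasGrad_kn hV hU' a b c d)))).congr_grad fun e => ?_
  have : connection4 Γ (isoMomentum (U y) (V y) (s y) (r y)) e a b c d =
      s y * connection4 Γ (kn (U y) (U y)) e a b c d + r y *
        (connection4 Γ (kn (U y) (V y)) e a b c d + connection4 Γ (kn (V y) (U y)) e a b c d) := by
    simp only [connection4, Finset.mul_sum, ← Finset.sum_add_distrib, isoMomentum, Pi.add_apply,
      Pi.smul_apply, smul_eq_mul]
    exact Finset.sum_congr rfl fun f _ => by ring
  rw [this]
  simp only [kn, Pi.zero_apply, Matrix.zero_apply]
  ring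

end Covariant

section FLRW

variable {d : ℕ}

theorem sum_sliceMetric_mul_sliceInv {k : ℝ} {y : Fin (d + 1) → ℝ} (h : 0 < slice k y)
    (i j : Fin d) : ∑ l, sliceMetric k y i l * sliceInv k y l j = if i = j then 1 else 0 := by
  rw [← Matrix.mul_apply, sliceMetric_mul_sliceInv h, Matrix.one_apply]

/-- Metric compatibility: the covariant derivative of the inverse metric is zero. -/
theorem hasGrad_flrwInv {k : ℝ} {a F : ℝ → ℝ} {y : Fin (d + 1) → ℝ} (h : 0 < slice k y)
    (ha : DifferentiableAt ℝ a (y 0)) (hF : DifferentiableAt ℝ F (y 0))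
    (ha0 : ∀ t, 0 < a t) (hF0 : ∀ t, 0 < F t) (μ ν : Fin (d + 1)) :
    HasGrad (fun z => (flrwMetric d k a F z)⁻¹ μ ν)
      (fun e => -connection2 (flrwChristoffel k a F y) (flrwMetric d k a F y)⁻¹ e μ ν) y := by
  have hF1 := hF0 (y 0)
  have ha1 := ha0 (y 0)
  have hev : (fun z => (flrwMetric d k a F z)⁻¹ μ ν) =ᶠ[nhds y] fun z =>
      timeSpaceBlock (-(F (z 0))⁻¹) ((a (z 0) ^ 2)⁻¹ • sliceInv k z) μ ν := by
    filter_upwards [eventually_patch h] with z hz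
    rw [flrwMetric_inv (ha0 _) (hF0 _) hz]
  refine HasGrad.congr_of_eventuallyEq ?_ hev
  rw [flrwMetric_inv ha1 hF1 h]
  have hs := sum_sliceMetric_mul_sliceInv h
  have hs' : ∀ i j, ∑ l, sliceMetric k y i l * sliceInv k y j l = if i = j then 1 else 0 :=
    fun i j => by simp only [sliceInv_symm k y j, hs]
  have e1 : ∀ (p q : ℝ) (i j : Fin d), ∑ l, p * sliceMetric k y i l * (q * sliceInv k y l j) =
      p * q * if i = j then 1 else 0 := fun p q i j => by
    rw [← hs, Finset.mul_sum]
    exact Finset.sum_congr rfl fun _ _ => by ring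
  have e2 : ∀ (p q : ℝ) (i j : Fin d), ∑ l, p * sliceMetric k y i l * (q * sliceInv k y j l) =
      p * q * if i = j then 1 else 0 := fun p q i j => by
    rw [← hs', Finset.mul_sum]
    exact Finset.sum_congr rfl fun _ _ => by ring
  refine Fin.cases ?_ (fun i => ?_) μ <;> refine Fin.cases ?_ (fun j => ?_) ν
  · refine (hasGrad_time (hF.hasDerivAt.inv hF1.ne')).neg.congr_grad fun e => ?_
    refine Fin.cases ?_ (fun l => ?_) e
    · simp [connection2, Fin.sum_univ_succ, flrwChristoffel]
      field_simp
      ring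
    · simp [connection2, Fin.sum_univ_succ, flrwChristoffel]
  · refine (hasGrad_const 0 y).congr_grad fun e => ?_
    refine Fin.cases ?_ (fun l => ?_) e
    · simp [connection2, Fin.sum_univ_succ, flrwChristoffel]
    · simp [connection2, Fin.sum_univ_succ, flrwChristoffel, e1, eq_comm (a := j)]
      split_ifs <;> field_simp <;> ring
  · refine (hasGrad_const 0 y).congr_grad fun e => ?_
    refine Fin.cases ?_ (fun l => ?_) e
    · simp [connection2, Fin.sum_univ_succ, flrwChristoffel]
    · simp [connection2, Fin.sum_univ_succ, flrwChristoffel, e2, eq_comm (a := i)]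
      split_ifs <;> field_simp <;> ring
  · simp only [timeSpaceBlock_succ_succ, Matrix.smul_apply, smul_eq_mul]
    refine ((hasGrad_time ((ha.hasDerivAt.fun_pow 2).fun_inv (pow_ne_zero 2 ha1.ne'))).mul
      (hasGrad_sliceInv k y i j)).congr_grad fun e => ?_
    refine Fin.cases ?_ (fun l => ?_) e
    · simp [connection2, Fin.sum_univ_succ, flrwChristoffel, Finset.sum_add_distrib]
      field_simp
      ring
    · simp [connection2, Fin.sum_univ_succ, flrwChristoffel, Finset.sum_add_distrib, e1, e2]
      split_ifs <;> ring

/-- The covariant derivative of the projector on the time direction. -/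
noncomputable def timeProjDeriv (a F : ℝ → ℝ) (y : Fin (d + 1) → ℝ) (e : Fin (d + 1)) :
    Matrix (Fin (d + 1)) (Fin (d + 1)) ℝ :=
  Matrix.of fun μ ν => deriv a (y 0) / (a (y 0) * F (y 0)) *
    Fin.cases 0 (fun l => Fin.cases (Fin.cases 0 (fun j => if l = j then 1 else 0) ν)
      (fun i => Fin.cases (if l = i then 1 else 0) (fun _ => 0) ν) μ) e

/-- The tensor is u ⊗ u for the unit normal u of the slices, and ∇u is pure isotropic expansion;
hence only mixed time-space entries a' / (a F) appear. -/
theorem hasGrad_timeSpaceBlock_inv (k : ℝ) {a F : ℝ → ℝ} {y : Fin (d + 1) → ℝ}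
    (hF : DifferentiableAt ℝ F (y 0)) (ha0 : ∀ t, 0 < a t) (hF0 : ∀ t, 0 < F t)
    (μ ν : Fin (d + 1)) :
    HasGrad (fun z => timeSpaceBlock (F (z 0))⁻¹ (0 : Matrix (Fin d) (Fin d) ℝ) μ ν)
      (fun e => timeProjDeriv a F y e μ ν
        - connection2 (flrwChristoffel k a F y) (timeSpaceBlock (F (y 0))⁻¹ 0) e μ ν) y := by
  have hF1 := hF0 (y 0)
  have ha1 := ha0 (y 0)
  refine Fin.cases ?_ (fun i => ?_) μ <;> refine Fin.cases ?_ (fun j => ?_) ν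
  · refine (hasGrad_time (hF.hasDerivAt.inv hF1.ne')).congr_grad fun e => ?_
    refine Fin.cases ?_ (fun l => ?_) e
    · simp [connection2, Fin.sum_univ_succ, flrwChristoffel, timeProjDeriv]
      field_simp
      ring
    · simp [connection2, Fin.sum_univ_succ, flrwChristoffel, timeProjDeriv]
  · refine (hasGrad_const 0 y).congr_grad fun e => ?_
    refine Fin.cases ?_ (fun l => ?_) e
    · simp [connection2, Fin.sum_univ_succ, flrwChristoffel, timeProjDeriv]
    · simp [connection2, Fin.sum_univ_succ, flrwChristoffel, timeProjDeriv, eq_comm (a := j)]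
      split_ifs <;> field_simp <;> ring
  · refine (hasGrad_const 0 y).congr_grad fun e => ?_
    refine Fin.cases ?_ (fun l => ?_) e
    · simp [connection2, Fin.sum_univ_succ, flrwChristoffel, timeProjDeriv]
    · simp [connection2, Fin.sum_univ_succ, flrwChristoffel, timeProjDeriv, eq_comm (a := i)]
      split_ifs <;> field_simp <;> ring
  · refine (hasGrad_const 0 y).congr_grad fun e => ?_
    refine Fin.cases ?_ (fun l => ?_) e <;>
      simp [connection2, Fin.sum_univ_succ, flrwChristoffel, timeProjDeriv]

/-- The first divergence of the isotropic curvature momentum. -/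
theorem div4_flrw {k : ℝ} {a F : ℝ → ℝ} {y : Fin (d + 1) → ℝ} (h : 0 < slice k y)
    (ha : ContDiff ℝ (⊤ : ℕ∞) a) (hF : ContDiff ℝ (⊤ : ℕ∞) F) (ha0 : ∀ t, 0 < a t)
    (hF0 : ∀ t, 0 < F t) {P : (Fin (d + 1) → ℝ) → Tensor4 (d + 1)} {σ ρ : ℝ → ℝ} {σ' ρ' : ℝ}
    (hσ : HasDerivAt σ σ' (y 0)) (hρ : HasDerivAt ρ ρ' (y 0))
    (hP : ∀ z, 0 < slice k z → P z = isoMomentum (flrwMetric d k a F z)⁻¹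
      (timeSpaceBlock (F (z 0))⁻¹ 0) (σ (z 0)) (ρ (z 0))) (μ κ ν : Fin (d + 1)) :
    div4 (flrwMetric d k a F) P y μ κ ν =
      (ρ' - σ' + (d - 1) * (deriv a (y 0) / a (y 0)) * ρ (y 0)) / F (y 0) *
        ((flrwMetric d k a F y)⁻¹ μ ν * (if κ = 0 then 1 else 0)
          - (if μ = 0 then 1 else 0) * (flrwMetric d k a F y)⁻¹ κ ν) := by
  have hda := ha.differentiable (by simp) (y 0)
  have hdF := hF.differentiable (by simp) (y 0)
  have hF1 := hF0 (y 0)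
  have ha1 := ha0 (y 0)
  have h1 : ∀ e, pderiv e (fun z => P z μ κ ν e) y = _ := fun e =>
    ((hasGrad_isoMomentum (hasGrad_time hσ) (hasGrad_time hρ)
      (hasGrad_flrwInv h hda hdF ha0 hF0) (hasGrad_timeSpaceBlock_inv k hdF ha0 hF0)
      μ κ ν e).congr_of_eventuallyEq (by
        filter_upwards [eventually_patch h] with z hz
        rw [hP z hz])).pderiv_eq e
  have h2 : div4 (flrwMetric d k a F) P y μ κ ν = ∑ e, (pderiv e (fun z => P z μ κ ν e) y +
      connection4 (flrwChristoffel k a F y) (P y) e μ κ ν e) := by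
    simp only [div4, connection4, christoffel_flrwMetric h hda hdF ha1 hF1]
  rw [h2]
  -- The connection terms from `h1` cancel those of the divergence, leaving the derivatives of σ, of
  -- ρ and of the time projector.
  simp only [h1, hP y h, sub_add_cancel, flrwMetric_inv ha1 hF1 h, Fin.sum_univ_succ]
  refine Fin.cases ?_ (fun i => ?_) μ <;> refine Fin.cases ?_ (fun m => ?_) κ <;>
    refine Fin.cases ?_ (fun j => ?_) ν <;>
    simp [kn, timeProjDeriv, Finset.sum_add_distrib, Finset.sum_sub_distrib, Fin.succ_ne_zero,
      mul_add, mul_sub]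
  all_goals try ring1
  rw [sliceInv_symm k y i m]
  ring

/-- The second divergence of the isotropic curvature momentum. -/
theorem div3_flrw {k : ℝ} {a F : ℝ → ℝ} {y : Fin (d + 1) → ℝ} (h : 0 < slice k y)
    (ha : ContDiff ℝ (⊤ : ℕ∞) a) (hF : ContDiff ℝ (⊤ : ℕ∞) F) (ha0 : ∀ t, 0 < a t)
    (hF0 : ∀ t, 0 < F t) {V : (Fin (d + 1) → ℝ) → Fin (d + 1) → Fin (d + 1) → Fin (d + 1) → ℝ}
    {v : ℝ → ℝ} {v' : ℝ} (hv : HasDerivAt v v' (y 0))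
    (hV : ∀ z, 0 < slice k z → ∀ μ κ ν, V z μ κ ν = v (z 0) *
      ((flrwMetric d k a F z)⁻¹ μ ν * (if κ = 0 then 1 else 0)
        - (if μ = 0 then 1 else 0) * (flrwMetric d k a F z)⁻¹ κ ν)) (μ ν : Fin (d + 1)) :
    div3 (flrwMetric d k a F) V y μ ν =
      timeSpaceBlock (-(d * (deriv a (y 0) / a (y 0)) * v (y 0) / F (y 0)))
        ((v' + v (y 0) * (deriv F (y 0) / (2 * F (y 0)) + (d - 1) * (deriv a (y 0) / a (y 0)))) •
          (a (y 0) ^ 2)⁻¹ • sliceInv k y) μ ν := by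
  have hda := ha.differentiable (by simp) (y 0)
  have hdF := hF.differentiable (by simp) (y 0)
  have hF1 := hF0 (y 0)
  have ha1 := ha0 (y 0)
  set G := (flrwMetric d k a F y)⁻¹ with hG
  set Γ := flrwChristoffel k a F y with hΓ
  have hg : ∀ μ ν, HasGrad (fun z => (flrwMetric d k a F z)⁻¹ μ ν)
      (fun e => -connection2 Γ G e μ ν) y := hasGrad_flrwInv h hda hdF ha0 hF0
  have h1 : ∀ e, pderiv e (fun z => V z μ e ν) y = _ := fun e =>
    (((hasGrad_time hv).mul (((hg μ ν).mul (hasGrad_const (if e = 0 then 1 else 0) y)).sub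
      ((hg e ν).const_mul (if μ = 0 then 1 else 0)))).congr_of_eventuallyEq (by
        filter_upwards [eventually_patch h] with z hz
        rw [hV z hz])).pderiv_eq e
  have h2 : div3 (flrwMetric d k a F) V y μ ν = ∑ e, (pderiv e (fun z => V z μ e ν) y +
      ∑ f, (Γ μ e f * V y f e ν + Γ e e f * V y μ f ν + Γ ν e f * V y μ e f)) := by
    simp only [div3, christoffel_flrwMetric h hda hdF ha1 hF1, hΓ]
  -- The inverse metric is covariantly constant, so only v and the coordinate vector ∂_t are
  -- differentiated; the covariant derivative of the latter is Γ^κ_{e0}.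
  have h3 : ∀ e, pderiv e (fun z => V z μ e ν) y +
      ∑ f, (Γ μ e f * V y f e ν + Γ e e f * V y μ f ν + Γ ν e f * V y μ e f) =
      (Fin.cons v' (fun _ => 0) : Fin (d + 1) → ℝ) e *
        (G μ ν * (if e = 0 then 1 else 0) - (if μ = 0 then 1 else 0) * G e ν)
      + v (y 0) * (G μ ν * Γ e e 0 - Γ μ e 0 * G e ν) := by
    intro e
    rw [h1 e]
    have e1 : ∑ f, (Γ μ e f * V y f e ν + Γ e e f * V y μ f ν + Γ ν e f * V y μ e f) =
        v (y 0) * (connection2 Γ G e μ ν * (if e = 0 then 1 else 0)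
          - (if μ = 0 then 1 else 0) * connection2 Γ G e e ν
          + (G μ ν * ∑ f, Γ e e f * (if f = 0 then 1 else 0)
            - (∑ f, Γ μ e f * (if f = 0 then 1 else 0)) * G e ν)) := by
      simp only [hV y h, connection2, Finset.sum_mul, Finset.mul_sum, ← Finset.sum_add_distrib,
        ← Finset.sum_sub_distrib, ← hG]
      exact Finset.sum_congr rfl fun f _ => by ring
    rw [e1]
    simp only [mul_ite, mul_one, mul_zero, Finset.sum_ite_eq', Finset.mem_univ, if_true]
    split_ifs <;> ring
  rw [h2, Finset.sum_congr rfl fun e _ => h3 e]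
  rw [hG, flrwMetric_inv ha1 hF1 h, hΓ]
  simp only [Fin.sum_univ_succ]
  refine Fin.cases ?_ (fun i => ?_) μ <;> refine Fin.cases ?_ (fun j => ?_) ν <;>
    simp [flrwChristoffel, Fin.succ_ne_zero, ← Finset.mul_sum]
  all_goals ring

/-- The field equations on FLRW configurations. -/
theorem IsInvariant.fieldEq_flrw {L : Lagrangian (d + 1)} (hL : IsInvariant L)
    (hd : 2 ≤ d) {k : ℝ} {a F : ℝ → ℝ} {y : Fin (d + 1) → ℝ}
    (h : 0 < slice k y) (ha : ContDiff ℝ (⊤ : ℕ∞) a) (hF : ContDiff ℝ (⊤ : ℕ∞) F)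
    (ha0 : ∀ t, 0 < a t) (hF0 : ∀ t, 0 < F t) {σ' τ' : ℝ → ℝ}
    (hσ : ∀ t, HasDerivAt (momentumS L k a F) (σ' t) t)
    (hτ : ∀ t, HasDerivAt (momentumT L k a F) (τ' t) t) {v : ℝ → ℝ} {v' : ℝ}
    (hv : ∀ t, v t = (τ' t + (d - 1) * (deriv a t / a t) *
      (momentumT L k a F t + momentumS L k a F t)) / F t) (hv' : HasDerivAt v v' (y 0)) :
    fieldEq L (flrwMetric d k a F) y =
      timeSpaceBlock ((2 * d * momentumT L k a F (y 0) * curvA a F (y 0)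
          + 1 / 2 * reduced L (curvA a F (y 0), curvB k a F (y 0))
          - 2 * d * (deriv a (y 0) / a (y 0)) * v (y 0)) / F (y 0))
        ((2 * (d - 1) * momentumS L k a F (y 0) * curvB k a F (y 0)
          - 2 * momentumT L k a F (y 0) * curvA a F (y 0)
          - 1 / 2 * reduced L (curvA a F (y 0), curvB k a F (y 0))
          + 2 * (v' + v (y 0) * (deriv F (y 0) / (2 * F (y 0))
            + (d - 1) * (deriv a (y 0) / a (y 0))))) • (a (y 0) ^ 2)⁻¹ • sliceInv k y) := by
  have hF1 := hF0 (y 0)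
  have ha1 := ha0 (y 0)
  have hP : ∀ z, 0 < slice k z →
      curvatureMomentum L (flrwMetric d k a F z)⁻¹ (riemann (flrwMetric d k a F) z) = _ :=
    fun z hz => (hL.curvatureMomentum_flrw hd hz ha hF ha0 hF0).1
  -- The first divergence is needed on the whole patch and not just at y, since it is differentiated
  -- again.
  have hV : ∀ z, 0 < slice k z → ∀ μ κ ν, div4 (flrwMetric d k a F)
      (fun z => curvatureMomentum L (flrwMetric d k a F z)⁻¹ (riemann (flrwMetric d k a F) z))
      z μ κ ν = v (z 0) * ((flrwMetric d k a F z)⁻¹ μ ν * (if κ = 0 then 1 else 0)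
        - (if μ = 0 then 1 else 0) * (flrwMetric d k a F z)⁻¹ κ ν) := by
    intro z hz μ κ ν
    rw [div4_flrw hz ha hF ha0 hF0 (hσ (z 0)) ((hτ (z 0)).fun_add (hσ (z 0))) hP, hv,
      add_sub_cancel_right]
  ext μ ν
  simp only [fieldEq, Matrix.of_apply]
  rw [div3_flrw h ha hF ha0 hF0 hv' hV, hP y h, (hL.curvatureMomentum_flrw hd h ha hF ha0 hF0).2,
    riemann_flrwMetric h ha hF ha0 hF0, flrwMetric_inv ha1 hF1 h]
  rw [sum_isoMomentum_mul_isoRiemann _ _ _ _ _ hF1.ne']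
  · refine Fin.cases ?_ (fun i => ?_) μ <;> refine Fin.cases ?_ (fun j => ?_) ν <;> simp
    · ring
    · ring
  · rw [smul_mul_smul_comm, inv_mul_cancel₀ (pow_ne_zero 2 ha1.ne'), one_smul]
    exact mul_eq_one_comm.mp (sliceMetric_mul_sliceInv h)
  · ext i j
    simp [sliceInv_symm k y i j]
  · ext i j
    simp [sliceMetric_symm k y i j]

end FLRW

/-! ### Smoothness in time and the time-time equation. -/

section Smooth

variable {d : ℕ} {L : Lagrangian (d + 1)} {k : ℝ} {a F : ℝ → ℝ}

theorem contDiff_deriv {f : ℝ → ℝ} (h : ContDiff ℝ (⊤ : ℕ∞) f) :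
    ContDiff ℝ (⊤ : ℕ∞) (deriv f) := (contDiff_infty_iff_deriv.mp h).2

theorem hasDerivAt_of_contDiff {f : ℝ → ℝ} (h : ContDiff ℝ (⊤ : ℕ∞) f) (t : ℝ) :
    HasDerivAt f (deriv f t) t := (h.differentiable (by simp) t).hasDerivAt

theorem contDiff_curvA (ha : ContDiff ℝ (⊤ : ℕ∞) a) (hF : ContDiff ℝ (⊤ : ℕ∞) F)
    (ha0 : ∀ t, 0 < a t) (hF0 : ∀ t, 0 < F t) : ContDiff ℝ (⊤ : ℕ∞) (curvA a F) :=
  (((contDiff_deriv (contDiff_deriv ha)).div ha fun t => (ha0 t).ne').sub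
    (((contDiff_deriv hF).mul (contDiff_deriv ha)).div ((contDiff_const.mul hF).mul ha)
      fun t => mul_ne_zero (mul_ne_zero two_ne_zero (hF0 t).ne') (ha0 t).ne')).div hF
        fun t => (hF0 t).ne'

theorem contDiff_curvB (k : ℝ) (ha : ContDiff ℝ (⊤ : ℕ∞) a) (hF : ContDiff ℝ (⊤ : ℕ∞) F)
    (ha0 : ∀ t, 0 < a t) (hF0 : ∀ t, 0 < F t) : ContDiff ℝ (⊤ : ℕ∞) (curvB k a F) :=
  (contDiff_const.add (((contDiff_deriv ha).pow 2).div hF fun t => (hF0 t).ne')).div (ha.pow 2)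
    fun t => pow_ne_zero 2 (ha0 t).ne'

/-- Functions of B alone have time derivatives without a''', because B' is linear in A and B with
coefficients ±2 a'/a. Reduced Lagrangians affine in A rely on this to keep second-order equations.
-/
theorem hasDerivAt_curvB (k : ℝ) (ha : ContDiff ℝ (⊤ : ℕ∞) a) (hF : ContDiff ℝ (⊤ : ℕ∞) F)
    (ha0 : ∀ t, 0 < a t) (hF0 : ∀ t, 0 < F t) (t : ℝ) : HasDerivAt (curvB k a F)
      (2 * (deriv a t / a t) * (curvA a F t - curvB k a F t)) t := by
  have h1 := hasDerivAt_of_contDiff ha t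
  have h2 := hasDerivAt_of_contDiff (contDiff_deriv ha) t
  have h3 := hasDerivAt_of_contDiff hF t
  have ha1 := ha0 t
  have hF1 := hF0 t
  refine ((((h2.fun_pow 2).fun_div h3 hF1.ne').const_add k).fun_div (h1.fun_pow 2)
    (pow_ne_zero 2 ha1.ne')).congr_deriv ?_
  rw [curvA, curvB]
  simp
  field_simp

theorem IsInvariant.contDiff_reducedA (hL : IsInvariant L) : ContDiff ℝ (⊤ : ℕ∞) (reducedA L) :=
  (hL.contDiff_reduced.fderiv_right (m := (⊤ : ℕ∞)) (by simp)).clm_apply contDiff_const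

theorem IsInvariant.contDiff_reducedB (hL : IsInvariant L) : ContDiff ℝ (⊤ : ℕ∞) (reducedB L) :=
  (hL.contDiff_reduced.fderiv_right (m := (⊤ : ℕ∞)) (by simp)).clm_apply contDiff_const

theorem IsInvariant.contDiff_momentumS (hL : IsInvariant L) (k : ℝ) (ha : ContDiff ℝ (⊤ : ℕ∞) a)
    (hF : ContDiff ℝ (⊤ : ℕ∞) F) (ha0 : ∀ t, 0 < a t) (hF0 : ∀ t, 0 < F t) :
    ContDiff ℝ (⊤ : ℕ∞) (momentumS L k a F) :=
  (hL.contDiff_reducedB.comp ((contDiff_curvA ha hF ha0 hF0).prodMk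
    (contDiff_curvB k ha hF ha0 hF0))).div_const _

theorem IsInvariant.contDiff_momentumT (hL : IsInvariant L) (k : ℝ) (ha : ContDiff ℝ (⊤ : ℕ∞) a)
    (hF : ContDiff ℝ (⊤ : ℕ∞) F) (ha0 : ∀ t, 0 < a t) (hF0 : ∀ t, 0 < F t) :
    ContDiff ℝ (⊤ : ℕ∞) (momentumT L k a F) :=
  ((hL.contDiff_reducedA.comp ((contDiff_curvA ha hF ha0 hF0).prodMk
    (contDiff_curvB k ha hF ha0 hF0))).div_const _).neg

/-- The time-time component of the field equations. -/
theorem IsInvariant.fieldEq_flrw_zero_zero (hL : IsInvariant L) (hd : 2 ≤ d)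
    {y : Fin (d + 1) → ℝ} (h : 0 < slice k y) (ha : ContDiff ℝ (⊤ : ℕ∞) a)
    (hF : ContDiff ℝ (⊤ : ℕ∞) F) (ha0 : ∀ t, 0 < a t) (hF0 : ∀ t, 0 < F t) :
    fieldEq L (flrwMetric d k a F) y 0 0 =
      (2 * d * momentumT L k a F (y 0) * curvA a F (y 0)
        + 1 / 2 * reduced L (curvA a F (y 0), curvB k a F (y 0))
        - 2 * d * (deriv a (y 0) / a (y 0)) * ((deriv (momentumT L k a F) (y 0)
          + (d - 1) * (deriv a (y 0) / a (y 0)) *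
            (momentumT L k a F (y 0) + momentumS L k a F (y 0))) / F (y 0))) / F (y 0) := by
  have hT := hL.contDiff_momentumT k ha hF ha0 hF0
  have hS := hL.contDiff_momentumS k ha hF ha0 hF0
  have hv : ContDiff ℝ (⊤ : ℕ∞) fun t => (deriv (momentumT L k a F) t
      + (d - 1) * (deriv a t / a t) * (momentumT L k a F t + momentumS L k a F t)) / F t :=
    ((contDiff_deriv hT).add ((contDiff_const.mul ((contDiff_deriv ha).div ha
      fun t => (ha0 t).ne')).mul (hT.add hS))).div hF fun t => (hF0 t).ne'
  rw [hL.fieldEq_flrw hd h ha hF ha0 hF0 (hasDerivAt_of_contDiff hS) (hasDerivAt_of_contDiff hT)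
    (fun t => rfl) (hasDerivAt_of_contDiff hv _), timeSpaceBlock_zero_zero]

end Smooth

/-! ### Field equations when the reduced Lagrangian is affine in A. -/

section SecondOrderEquations

variable {d : ℕ} {L : Lagrangian (d + 1)}

open Polynomial in
/-- The field equations of a Lagrangian which is linear in the time-space curvature on FLRW
configurations; they only depend on the constant term `h`. -/
noncomputable def friedmannEq (h : ℝ[X]) (p : FLRWEvent d) :
    Matrix (Fin (d + 1)) (Fin (d + 1)) ℝ :=
  timeSpaceBlock (h.eval (curvB p.k p.a p.F (p.y 0)) / 2 / p.F (p.y 0))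
    ((-(h.eval (curvB p.k p.a p.F (p.y 0)) / 2) - (curvA p.a p.F (p.y 0)
      - curvB p.k p.a p.F (p.y 0)) * h.derivative.eval (curvB p.k p.a p.F (p.y 0)) / d) •
      (p.a (p.y 0) ^ 2)⁻¹ • sliceInv p.k p.y)

open Polynomial in
theorem hasFDerivAt_affine (h g : ℝ[X]) (A B : ℝ) :
    HasFDerivAt (fun x : ℝ × ℝ => h.eval x.2 + x.1 * g.eval x.2)
      (h.derivative.eval B • ContinuousLinearMap.snd ℝ ℝ ℝ +
        (A • g.derivative.eval B • ContinuousLinearMap.snd ℝ ℝ ℝ +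
          g.eval B • ContinuousLinearMap.fst ℝ ℝ ℝ)) (A, B) := by
  have hs : HasFDerivAt (fun x : ℝ × ℝ => x.2) (ContinuousLinearMap.snd ℝ ℝ ℝ) (A, B) :=
    hasFDerivAt_snd
  have hf : HasFDerivAt (fun x : ℝ × ℝ => x.1) (ContinuousLinearMap.fst ℝ ℝ ℝ) (A, B) :=
    hasFDerivAt_fst
  exact ((h.hasDerivAt B).comp_hasFDerivAt (A, B) hs).add
    (hf.mul ((g.hasDerivAt B).comp_hasFDerivAt (A, B) hs))

open Polynomial in
theorem reducedA_of_affine {h g : ℝ[X]} (hred : ∀ A B, reduced L (A, B) = h.eval B + A * g.eval B)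
    (A B : ℝ) : reducedA L (A, B) = g.eval B := by
  have : reduced L = fun x : ℝ × ℝ => h.eval x.2 + x.1 * g.eval x.2 := by
    funext x
    exact hred x.1 x.2
  rw [reducedA, this, (hasFDerivAt_affine h g A B).fderiv]
  simp

open Polynomial in
theorem reducedB_of_affine {h g : ℝ[X]} (hred : ∀ A B, reduced L (A, B) = h.eval B + A * g.eval B)
    (A B : ℝ) : reducedB L (A, B) = h.derivative.eval B + A * g.derivative.eval B := by
  have : reduced L = fun x : ℝ × ℝ => h.eval x.2 + x.1 * g.eval x.2 := by
    funext x
    exact hred x.1 x.2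
  rw [reducedB, this, (hasFDerivAt_affine h g A B).fderiv]
  simp

open Polynomial in
theorem IsInvariant.affine_constraint (hL : IsInvariant L) (hd : 2 ≤ d) {h g : ℝ[X]}
    (hred : ∀ A B, reduced L (A, B) = h.eval B + A * g.eval B) (B : ℝ) :
    (d - 1) * g.eval B = 2 * (h.derivative.eval B + B * g.derivative.eval B) := by
  have := hL.reduced_constraint hd B
  rwa [reducedA_of_affine hred, reducedB_of_affine hred] at this

theorem FLRWEvent.slice_pos (p : FLRWEvent d) : 0 < slice p.k p.y := p.patch

open Polynomial in
-- Here the time-space momentum depends on B only. The boost constraint, though imposed only at A =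
-- B, holds for every value of B as a relation between h and g; it kills the first divergence and
-- eliminates g.
theorem IsInvariant.flrwEq_of_affine (hL : IsInvariant L) (hd : 2 ≤ d) {h g : ℝ[X]}
    (hred : ∀ A B, reduced L (A, B) = h.eval B + A * g.eval B) : flrwEq L = friedmannEq h := by
  funext p
  obtain ⟨k, a, F, y, hk, ha, hF, ha0, hF0, hp⟩ := p
  have hsl : 0 < slice k y := hp
  have hd0 : (d : ℝ) ≠ 0 := by positivity
  have hd1 : (d : ℝ) - 1 ≠ 0 := by
    have : (2 : ℝ) ≤ d := by exact_mod_cast hd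
    intro h
    linarith
  have hc := fun t => hL.affine_constraint hd hred (curvB k a F t)
  have hT : momentumT L k a F = fun t => -(g.eval (curvB k a F t) / (4 * d)) := by
    funext t
    rw [momentumT, reducedA_of_affine hred]
  have hS : momentumS L k a F = fun t => (h.derivative.eval (curvB k a F t)
      + curvA a F t * g.derivative.eval (curvB k a F t)) / (2 * d * (d - 1)) := by
    funext t
    rw [momentumS, reducedB_of_affine hred]
  have hTd : ∀ t, HasDerivAt (momentumT L k a F) (-(g.derivative.eval (curvB k a F t) *
      (2 * (deriv a t / a t) * (curvA a F t - curvB k a F t)) / (4 * d))) t := by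
    intro t
    rw [hT]
    exact (((g.hasDerivAt (curvB k a F t)).comp t
      (hasDerivAt_curvB k ha hF ha0 hF0 t)).div_const _).neg
  -- With B' = 2 (a'/a) (A - B) inserted, the A-terms cancel and the rest is proportional to the
  -- constraint evaluated at the current B.
  have hv : ∀ t, (fun _ => (0 : ℝ)) t = (-(g.derivative.eval (curvB k a F t) *
      (2 * (deriv a t / a t) * (curvA a F t - curvB k a F t)) / (4 * d)) +
      (d - 1) * (deriv a t / a t) * (momentumT L k a F t + momentumS L k a F t)) / F t := by
    intro t
    have hc := hc t
    rw [hT, hS]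
    have ha1 := ha0 t
    have hF1 := hF0 t
    field_simp
    linear_combination 2 * deriv a t * hc
  rw [flrwEq, hL.fieldEq_flrw hd hsl ha hF ha0 hF0
    (hasDerivAt_of_contDiff (hL.contDiff_momentumS k ha hF ha0 hF0)) hTd hv
    (hasDerivAt_const _ _), friedmannEq]
  simp only [hred, hT, hS]
  have hc := hc (y 0)
  have hF1 := hF0 (y 0)
  congr 2
  · field_simp
    ring
  · field_simp
    -- A second use of the constraint: the terms proportional to A that involve g and its derivative
    -- are traded for the derivative of h.
    linear_combination (-4 * F (y 0) * curvA a F (y 0)) * hc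

end SecondOrderEquations

/-! ### Test configurations and the second-order condition. -/

section Exponential

/-- A scale factor with prescribed third derivative. -/
noncomputable def expScale (b c e : ℝ) (t : ℝ) : ℝ := Real.exp (b * t + c * t ^ 2 + e * t ^ 3)

variable (b c e : ℝ)

theorem contDiff_expScale : ContDiff ℝ (⊤ : ℕ∞) (expScale b c e) := by
  unfold expScale
  fun_prop

theorem expScale_pos (t : ℝ) : 0 < expScale b c e t := Real.exp_pos _

theorem deriv_expScale :
    deriv (expScale b c e) = fun t => (b + 2 * c * t + 3 * e * t ^ 2) * expScale b c e t := by
  funext t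
  have h : HasDerivAt (fun t : ℝ => b * t + c * t ^ 2 + e * t ^ 3)
      (b + 2 * c * t + 3 * e * t ^ 2) t := by
    refine ((((hasDerivAt_id' t).const_mul b).fun_add ((hasDerivAt_pow 2 t).const_mul c)).fun_add
      ((hasDerivAt_pow 3 t).const_mul e)).congr_deriv ?_
    simp
    ring
  exact h.exp.deriv.trans (mul_comm _ _)

theorem deriv_deriv_expScale :
    deriv (deriv (expScale b c e)) = fun t =>
      ((2 * c + 6 * e * t) + (b + 2 * c * t + 3 * e * t ^ 2) ^ 2) * expScale b c e t := by
  rw [deriv_expScale]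
  funext t
  have h : HasDerivAt (fun t : ℝ => b + 2 * c * t + 3 * e * t ^ 2) (2 * c + 6 * e * t) t := by
    refine ((((hasDerivAt_id' t).const_mul (2 * c)).const_add b).fun_add
      ((hasDerivAt_pow 2 t).const_mul (3 * e))).congr_deriv ?_
    simp
    ring
  have h2 := hasDerivAt_of_contDiff (contDiff_expScale b c e) t
  refine (h.fun_mul h2).deriv.trans ?_
  rw [deriv_expScale]
  ring

theorem curvA_expScale : curvA (expScale b c e) (fun _ => 1) = fun t =>
    (2 * c + 6 * e * t) + (b + 2 * c * t + 3 * e * t ^ 2) ^ 2 := by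
  funext t
  have := expScale_pos b c e t
  rw [curvA, deriv_deriv_expScale]
  simp
  field_simp

theorem curvB_expScale : curvB 0 (expScale b c e) (fun _ => 1) = fun t =>
    (b + 2 * c * t + 3 * e * t ^ 2) ^ 2 := by
  funext t
  have := expScale_pos b c e t
  rw [curvB, deriv_expScale]
  simp
  field_simp

variable {b c e}

/-- A flat FLRW configuration with an exponential scale factor, at the origin. -/
noncomputable def expEvent (d : ℕ) (b c e : ℝ) : FLRWEvent d where
  k := 0
  a := expScale b c e
  F := fun _ => 1
  y := 0
  k_mem := Or.inr (Or.inl rfl)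
  a_smooth := contDiff_expScale b c e
  F_smooth := contDiff_const
  a_pos := expScale_pos b c e
  F_pos := fun _ => one_pos
  patch := by simp

variable {d : ℕ} {L : Lagrangian (d + 1)}

/-- The configurations with e = 0 and e = 1 have the same two-jet at time 0, but their derivatives
of A there differ by 6. The time-time components then differ by 3 b ∂²f/∂A², where f is the reduced
Lagrangian, and b ≠ 0 because B > 0. -/
theorem IsInvariant.second_deriv_eq_zero (hL : IsInvariant L) (hd : 2 ≤ d)
    (hc : IsCosmological L) (A : ℝ) {B : ℝ} (hB : 0 < B) :
    fderiv ℝ (reducedA L) (A, B) (1, 0) = 0 := by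
  -- At time 0 the flat configuration has B = b² and A = 2 c + b², so this b and the c below reach
  -- every point with B > 0.
  set b := Real.sqrt B with hb
  have hb0 : 0 < b := Real.sqrt_pos.mpr hB
  have hb2 : b ^ 2 = B := Real.sq_sqrt hB.le
  set c := (A - B) / 2 with hcdef
  have hE := hc (expEvent d b c 0) (expEvent d b c 1) rfl rfl
    ⟨by simp [expEvent, expScale],
      by simp [expEvent, deriv_expScale, expScale],
      by simp [expEvent, iteratedDeriv_succ, deriv_deriv_expScale, expScale]⟩
    ⟨rfl, rfl, rfl⟩
  have h00 : ∀ e, flrwEq L (expEvent d b c e) 0 0 =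
      2 * d * (-(reducedA L (A, B) / (4 * d))) * A + 1 / 2 * reduced L (A, B)
        - 2 * d * b * (-(fderiv ℝ (reducedA L) (A, B) (6 * e + 4 * b * c, 4 * b * c) / (4 * d))
          + (d - 1) * b * (-(reducedA L (A, B) / (4 * d))
            + reducedB L (A, B) / (2 * d * (d - 1)))) := by
    intro e
    have hA0 : curvA (expScale b c e) (fun _ => 1) 0 = A := by
      rw [curvA_expScale]
      simp [hb2, hcdef]
      ring
    have hB0 : curvB 0 (expScale b c e) (fun _ => 1) 0 = B := by
      rw [curvB_expScale]
      simp [hb2]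
    have hp : HasDerivAt (fun t : ℝ => b + 2 * c * t + 3 * e * t ^ 2) (2 * c) 0 := by
      refine ((((hasDerivAt_id' 0).const_mul (2 * c)).const_add b).fun_add
        ((hasDerivAt_pow 2 0).const_mul (3 * e))).congr_deriv ?_
      simp
    have hA' : HasDerivAt (curvA (expScale b c e) (fun _ => 1)) (6 * e + 4 * b * c) 0 := by
      rw [curvA_expScale]
      refine ((((hasDerivAt_id' (0 : ℝ)).const_mul (6 * e)).const_add (2 * c)).fun_add
        (hp.fun_pow 2)).congr_deriv ?_
      simp
      ring
    have hB' : HasDerivAt (curvB 0 (expScale b c e) (fun _ => 1)) (4 * b * c) 0 := by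
      rw [curvB_expScale]
      refine (hp.fun_pow 2).congr_deriv ?_
      simp
      ring
    have hT' : HasDerivAt (momentumT L 0 (expScale b c e) (fun _ => 1))
        (-(fderiv ℝ (reducedA L) (A, B) (6 * e + 4 * b * c, 4 * b * c) / (4 * d))) 0 := by
      have h1 : HasFDerivAt (reducedA L) (fderiv ℝ (reducedA L) (A, B))
          (curvA (expScale b c e) (fun _ => 1) 0, curvB 0 (expScale b c e) (fun _ => 1) 0) := by
        rw [hA0, hB0]
        exact (hL.contDiff_reducedA.differentiable (by simp) (A, B)).hasFDerivAt
      exact ((h1.comp_hasDerivAt (0 : ℝ) (hA'.prodMk hB')).div_const _).neg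
    rw [flrwEq, hL.fieldEq_flrw_zero_zero hd (expEvent d b c e).slice_pos
      (expEvent d b c e).a_smooth (expEvent d b c e).F_smooth (expEvent d b c e).a_pos
      (expEvent d b c e).F_pos]
    simp only [expEvent, Pi.zero_apply, hT'.deriv, momentumT, momentumS, hA0, hB0, deriv_expScale]
    simp [expScale]
  have h := congrFun (congrFun hE 0) 0
  rw [h00, h00] at h
  have hlin : fderiv ℝ (reducedA L) (A, B) (6 * 1 + 4 * b * c, 4 * b * c) =
      6 * fderiv ℝ (reducedA L) (A, B) (1, 0) +
        fderiv ℝ (reducedA L) (A, B) (6 * 0 + 4 * b * c, 4 * b * c) := by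
    have e : ((6 * 1 + 4 * b * c, 4 * b * c) : ℝ × ℝ) =
        (6 : ℝ) • (1, 0) + (6 * 0 + 4 * b * c, 4 * b * c) := by
      ext <;> simp
    rw [e, map_add, map_smul, smul_eq_mul]
  rw [hlin] at h
  have hd0 : (d : ℝ) ≠ 0 := by positivity
  generalize fderiv ℝ (reducedA L) (A, B) (6 * 0 + 4 * b * c, 4 * b * c) = w at h
  generalize fderiv ℝ (reducedA L) (A, B) (1, 0) = z at h ⊢
  have h2 : 2 * d * b * (6 * z / (4 * d)) = 0 := by linear_combination -h
  have h3 : 2 * d * b * (6 * z / (4 * d)) = 3 * (b * z) := by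
    field_simp
    ring
  rw [h3] at h2
  rcases mul_eq_zero.mp h2 with h4 | h4
  · norm_num at h4
  · exact (mul_eq_zero.mp h4).resolve_left hb0.ne'

theorem IsInvariant.reduced_affine (hL : IsInvariant L) (hd : 2 ≤ d)
    (hc : IsCosmological L) (A : ℝ) {B : ℝ} (hB : 0 < B) :
    reduced L (A, B) = reduced L (0, B) + A * (reduced L (1, B) - reduced L (0, B)) := by
  have hp : ∀ x : ℝ, HasDerivAt (fun x : ℝ => (x, B)) ((1 : ℝ), (0 : ℝ)) x := fun x =>
    (hasDerivAt_id' x).prodMk (hasDerivAt_const x B)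
  have h1 : ∀ x : ℝ, HasDerivAt (fun x => reducedA L (x, B)) 0 x := by
    intro x
    have := (hL.contDiff_reducedA.differentiable (by simp) (x, B)).hasFDerivAt.comp_hasDerivAt x
      (hp x)
    rwa [hL.second_deriv_eq_zero hd hc x hB] at this
  have h2 : ∀ x, reducedA L (x, B) = reducedA L (0, B) := fun x =>
    is_const_of_deriv_eq_zero (fun x => (h1 x).differentiableAt) (fun x => (h1 x).deriv) x 0
  have h3 : ∀ x : ℝ, HasDerivAt (fun x => reduced L (x, B) - x * reducedA L (0, B)) 0 x := by
    intro x
    have h4 : HasDerivAt (fun x => reduced L (x, B)) (reducedA L (x, B)) x := by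
      have h := (hL.contDiff_reduced.differentiable (by simp) (x, B)).hasFDerivAt.comp_hasDerivAt x
        (hp x)
      exact h
    refine (h4.fun_sub ((hasDerivAt_id' x).mul_const _)).congr_deriv ?_
    rw [h2 x]
    ring
  have h5 : ∀ x, reduced L (x, B) - x * reducedA L (0, B) =
      reduced L (0, B) - 0 * reducedA L (0, B) := fun x =>
    is_const_of_deriv_eq_zero (fun x => (h3 x).differentiableAt) (fun x => (h3 x).deriv) x 0
  -- The value at 1 identifies the constant slope with a difference of values of the reduced
  -- Lagrangian.
  linear_combination h5 A - A * h5 1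

end Exponential

section Cosmo

/-! ### The representatives are curvature invariants -/

theorem ricciScalar_mem (D : ℕ) : ricciScalar D ∈ curvatureInvariants D 1 := trace_ricci_mem D

/-- Expressing the trace through powers of the full Ricci tensor reduces membership in the
invariants to cycle contractions. -/
theorem trace_tracelessRicci_sq {D : ℕ} (hD : D ≠ 0) (G : Matrix (Fin D) (Fin D) ℝ)
    (R : Tensor4 D) : (tracelessRicci G R ^ 2).trace =
      ((ricci G R * G) ^ 2).trace - 1 / D * ricciScalar D G R ^ 2 := by
  have hD' : (D : ℝ) ≠ 0 := by exact_mod_cast hD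
  have h : tracelessRicci G R ^ 2 = (ricci G R * G) ^ 2
      - (2 * (ricciScalar D G R / D)) • (ricci G R * G)
      + ((ricciScalar D G R / D) ^ 2) • (1 : Matrix (Fin D) (Fin D) ℝ) := by
    rw [tracelessRicci]
    generalize ricci G R * G = M
    simp only [sq, sub_mul, mul_sub, Matrix.smul_mul, Matrix.mul_smul, Matrix.one_mul,
      Matrix.mul_one]
    module
  have h1 : (ricci G R * G).trace = ricciScalar D G R := rfl
  rw [h, Matrix.trace_add, Matrix.trace_sub, Matrix.trace_smul, Matrix.trace_smul,
    Matrix.trace_one, h1, Fintype.card_fin, smul_eq_mul, smul_eq_mul]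
  field_simp
  ring

theorem trace_tracelessRicci_cube {D : ℕ} (hD : D ≠ 0) (G : Matrix (Fin D) (Fin D) ℝ)
    (R : Tensor4 D) : (tracelessRicci G R ^ 3).trace =
      ((ricci G R * G) ^ 3).trace - 3 / D * (ricciScalar D G R * ((ricci G R * G) ^ 2).trace)
        + 2 / D ^ 2 * ricciScalar D G R ^ 3 := by
  have hD' : (D : ℝ) ≠ 0 := by exact_mod_cast hD
  have h : tracelessRicci G R ^ 3 = (ricci G R * G) ^ 3
      - (3 * (ricciScalar D G R / D)) • (ricci G R * G) ^ 2
      + (3 * (ricciScalar D G R / D) ^ 2) • (ricci G R * G)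
      - ((ricciScalar D G R / D) ^ 3) • (1 : Matrix (Fin D) (Fin D) ℝ) := by
    rw [tracelessRicci]
    generalize ricci G R * G = M
    simp only [pow_succ, pow_zero, one_mul, sub_mul, mul_sub, Matrix.smul_mul, Matrix.mul_smul,
      Matrix.mul_one]
    module
  have h1 : (ricci G R * G).trace = ricciScalar D G R := rfl
  rw [h, Matrix.trace_sub, Matrix.trace_add, Matrix.trace_sub, Matrix.trace_smul,
    Matrix.trace_smul, Matrix.trace_smul, Matrix.trace_one, h1, Fintype.card_fin, smul_eq_mul,
    smul_eq_mul, smul_eq_mul]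
  field_simp
  ring

theorem K2_mem {D : ℕ} (hD : D ≠ 0) : K2 D ∈ curvatureInvariants D 2 := by
  have h : K2 D = (1 / ((D : ℝ) * ((D : ℝ) - 1))) •
      ((fun G R => ((ricci G R * G) ^ 2).trace : Lagrangian D)
        - (1 / D : ℝ) • ricciScalar D ^ 2) := by
    funext G R
    simp only [K2, trace_tracelessRicci_sq hD]
    rfl
  rw [h]
  exact Submodule.smul_mem _ _ (Submodule.sub_mem _ (trace_ricci_sq_mem D)
    (Submodule.smul_mem _ _ (pow_mem_curvatureInvariants (ricciScalar_mem D) 2)))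

theorem K3_mem {D : ℕ} (hD : D ≠ 0) : K3 D ∈ curvatureInvariants D 3 := by
  have h : K3 D = (-(1 / ((D : ℝ) * ((D : ℝ) - 1) * ((D : ℝ) - 2)))) •
      ((fun G R => ((ricci G R * G) ^ 3).trace : Lagrangian D)
        - (3 / D : ℝ) • (ricciScalar D * (fun G R => ((ricci G R * G) ^ 2).trace : Lagrangian D))
        + (2 / D ^ 2 : ℝ) • ricciScalar D ^ 3) := by
    funext G R
    simp only [K3, trace_tracelessRicci_cube hD]
    rfl
  have h1 : ricciScalar D * (fun G R => ((ricci G R * G) ^ 2).trace : Lagrangian D) ∈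
      curvatureInvariants D (1 + 2) :=
    mul_mem_curvatureInvariants (ricciScalar_mem D) (trace_ricci_sq_mem D)
  have h2 : ricciScalar D ^ 3 ∈ curvatureInvariants D (3 * 1) :=
    pow_mem_curvatureInvariants (ricciScalar_mem D) 3
  norm_num at h1 h2
  rw [h]
  exact Submodule.smul_mem _ _ (Submodule.add_mem _ (Submodule.sub_mem _ (trace_ricci_cube_mem D)
    (Submodule.smul_mem _ _ h1)) (Submodule.smul_mem _ _ h2))

theorem cosmo_mem {D : ℕ} (hD : D ≠ 0) (n : ℕ) : cosmo D n ∈ curvatureInvariants D n := by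
  have h : cosmo D n = ricciScalar D ^ n
      - ∑ p ∈ Icc 1 (n / 2), ((2 * (p : ℝ) - 1) * (n.choose (2 * p) : ℝ)
        * ((D : ℝ) * ((D : ℝ) - 1) / ((D : ℝ) - 2)) ^ (2 * p)) •
          (ricciScalar D ^ (n - 2 * p) * ((4 : ℝ) • K2 D) ^ p)
      - ∑ p ∈ Icc 1 ((n - 1) / 2), (16 * (p : ℝ) * (n.choose (2 * p + 1) : ℝ)
        * ((D : ℝ) * ((D : ℝ) - 1) / ((D : ℝ) - 2)) ^ (2 * p + 1)) •
          (ricciScalar D ^ (n - 2 * p - 1) * ((4 : ℝ) • K2 D) ^ (p - 1) * K3 D) := by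
    funext G R
    simp only [cosmo, Pi.sub_apply, Finset.sum_apply, Pi.smul_apply, Pi.mul_apply, Pi.pow_apply,
      smul_eq_mul, mul_assoc]
  have hK2 : (4 : ℝ) • K2 D ∈ curvatureInvariants D 2 := Submodule.smul_mem _ _ (K2_mem hD)
  rw [h]
  refine Submodule.sub_mem _ (Submodule.sub_mem _ ?_ (Submodule.sum_mem _ fun p hp => ?_))
    (Submodule.sum_mem _ fun p hp => ?_)
  · simpa using pow_mem_curvatureInvariants (ricciScalar_mem D) n
  · refine Submodule.smul_mem _ _ ?_
    have := mul_mem_curvatureInvariants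
      (pow_mem_curvatureInvariants (ricciScalar_mem D) (n - 2 * p))
      (pow_mem_curvatureInvariants hK2 p)
    rw [Finset.mem_Icc] at hp
    rwa [show (n - 2 * p) * 1 + p * 2 = n by omega] at this
  · refine Submodule.smul_mem _ _ ?_
    have := mul_mem_curvatureInvariants (mul_mem_curvatureInvariants
      (pow_mem_curvatureInvariants (ricciScalar_mem D) (n - 2 * p - 1))
      (pow_mem_curvatureInvariants hK2 (p - 1))) (K3_mem hD)
    rw [Finset.mem_Icc] at hp
    rwa [show (n - 2 * p - 1) * 1 + (p - 1) * 2 + 3 = n by omega] at this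

/-! ### The representatives on FLRW configurations -/

variable {d : ℕ}

theorem ricci_frame (A B : ℝ) :
    ricci (minkowski d) (isoRiemann (timeProj d) (spaceProj d) A B) * minkowski d =
      Matrix.diagonal (Fin.cons (d * A) fun _ => A + (d - 1) * B) := by
  ext a b
  rw [minkowski, Matrix.mul_diagonal]
  simp only [ricci, Matrix.of_apply, Fin.sum_univ_succ, Matrix.diagonal_apply]
  refine Fin.cases ?_ (fun i => ?_) a <;> refine Fin.cases ?_ (fun j => ?_) b
  · simp [isoRiemann, kn, timeProj, spaceProj, Fin.succ_ne_zero, (Fin.succ_ne_zero _).symm,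
      Matrix.diagonal_apply]
  · simp [isoRiemann, kn, timeProj, spaceProj, Fin.succ_ne_zero, (Fin.succ_ne_zero _).symm,
      Matrix.diagonal_apply]
  · simp [isoRiemann, kn, timeProj, spaceProj, Fin.succ_ne_zero, (Fin.succ_ne_zero _).symm,
      Matrix.diagonal_apply]
  · by_cases hij : i = j
    · subst hij
      simp [isoRiemann, kn, timeProj, spaceProj, Fin.succ_ne_zero, (Fin.succ_ne_zero _).symm,
        Matrix.diagonal_apply, mul_sub, Finset.sum_sub_distrib]
      ring
    · have hji : j ≠ i := fun h => hij h.symm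
      simp [isoRiemann, kn, timeProj, spaceProj, Fin.succ_ne_zero, (Fin.succ_ne_zero _).symm,
        Matrix.diagonal_apply, hij]
      exact fun h => absurd h hji

theorem ricciScalar_frame (A B : ℝ) :
    ricciScalar (d + 1) (minkowski d) (isoRiemann (timeProj d) (spaceProj d) A B) =
      2 * d * A + d * (d - 1) * B := by
  rw [ricciScalar, ricci_frame, Matrix.trace_diagonal, Fin.sum_univ_succ]
  simp
  ring

/-- With q = (d - 1) (A - B) / (d + 1) the eigenvalues are d q once and -q with multiplicity d. The
normalizations of `K2` and `K3` are such that they become q² and -q³. -/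
theorem tracelessRicci_frame (A B : ℝ) :
    tracelessRicci (minkowski d) (isoRiemann (timeProj d) (spaceProj d) A B) =
      Matrix.diagonal (Fin.cons (d * ((d - 1) * (A - B) / (d + 1)))
        fun _ => -((d - 1) * (A - B) / (d + 1))) := by
  have hD : (d : ℝ) + 1 ≠ 0 := by positivity
  rw [tracelessRicci, ricci_frame, ricciScalar_frame, ← Matrix.diagonal_one, ← Matrix.diagonal_smul,
    Matrix.diagonal_sub]
  congr 1
  funext a
  refine Fin.cases ?_ (fun i => ?_) a
  · simp
    field_simp
    ring
  · simp
    field_simp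
    ring

theorem K2_frame (hd : 2 ≤ d) (A B : ℝ) :
    K2 (d + 1) (minkowski d) (isoRiemann (timeProj d) (spaceProj d) A B) =
      ((d - 1) * (A - B) / (d + 1)) ^ 2 := by
  have hD : (d : ℝ) + 1 ≠ 0 := by positivity
  have hd0 : (d : ℝ) ≠ 0 := by positivity
  rw [K2, tracelessRicci_frame, Matrix.diagonal_pow, Matrix.trace_diagonal, Fin.sum_univ_succ]
  simp
  generalize ((d : ℝ) - 1) * (A - B) / (d + 1) = q
  field_simp

theorem K3_frame (hd : 2 ≤ d) (A B : ℝ) :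
    K3 (d + 1) (minkowski d) (isoRiemann (timeProj d) (spaceProj d) A B) =
      -((d - 1) * (A - B) / (d + 1)) ^ 3 := by
  have hD : (d : ℝ) + 1 ≠ 0 := by positivity
  have hd0 : (d : ℝ) ≠ 0 := by positivity
  have hd1 : (d : ℝ) - 1 ≠ 0 := by
    have : (2 : ℝ) ≤ d := by exact_mod_cast hd
    intro h
    linarith
  have hd2 : (d : ℝ) + 1 - 2 ≠ 0 := by
    intro h
    apply hd1
    linarith
  rw [K3, tracelessRicci_frame, Matrix.diagonal_pow, Matrix.trace_diagonal, Fin.sum_univ_succ]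
  simp
  generalize ((d : ℝ) - 1) * (A - B) / (d + 1) = q
  field_simp
  ring

theorem sum_range_even_odd (f : ℕ → ℝ) (n : ℕ) :
    ∑ j ∈ range (n + 1), f j =
      ∑ p ∈ range (n / 2 + 1), f (2 * p) + ∑ p ∈ range ((n + 1) / 2), f (2 * p + 1) := by
  induction n with
  | zero => simp
  | succ n ih =>
    rw [Finset.sum_range_succ, ih]
    rcases Nat.even_or_odd' n with ⟨m, rfl | rfl⟩
    · rw [show (2 * m + 1) / 2 = m by omega, show 2 * m / 2 = m by omega,
        show (2 * m + 1 + 1) / 2 = m + 1 by omega, Finset.sum_range_succ (fun p => f (2 * p + 1))]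
      ring
    · rw [show (2 * m + 1) / 2 = m by omega, show (2 * m + 1 + 1) / 2 = m + 1 by omega,
        show (2 * m + 1 + 1 + 1) / 2 = m + 1 by omega,
        Finset.sum_range_succ (fun p => f (2 * p)) (m + 1)]
      rw [show 2 * m + 1 + 1 = 2 * (m + 1) by ring]
      ring

theorem sum_Icc_one (f : ℕ → ℝ) (n : ℕ) : ∑ p ∈ Icc 1 n, f p = ∑ p ∈ range n, f (p + 1) := by
  induction n with
  | zero => simp
  | succ n ih => rw [Finset.sum_Icc_succ_top (by omega), ih, Finset.sum_range_succ]

/-- This is 1 - y ∂/∂y applied to the binomial theorem. -/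
theorem sum_one_sub_mul_choose (x y : ℝ) (m : ℕ) :
    ∑ j ∈ range (m + 2), (1 - (j : ℝ)) * ((m + 1).choose j : ℝ) * x ^ (m + 1 - j) * y ^ j =
      (x + y) ^ m * (x + y - (m + 1) * y) := by
  have h1 : ∑ j ∈ range (m + 2), ((m + 1).choose j : ℝ) * x ^ (m + 1 - j) * y ^ j =
      (x + y) ^ (m + 1) := by
    rw [add_comm x y, add_pow]
    exact Finset.sum_congr rfl fun j _ => by ring
  have h2 : ∑ j ∈ range (m + 2), (j : ℝ) * ((m + 1).choose j : ℝ) * x ^ (m + 1 - j) * y ^ j =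
      (m + 1) * y * (x + y) ^ m := by
    rw [Finset.sum_range_succ', add_comm x y, add_pow, Finset.mul_sum]
    simp only [Nat.cast_zero, zero_mul, add_zero]
    refine Finset.sum_congr rfl fun j _ => ?_
    have := Nat.add_one_mul_choose_eq m j
    have h3 : ((m : ℝ) + 1) * (m.choose j : ℝ) = ((m + 1).choose (j + 1) : ℝ) * (j + 1) := by
      exact_mod_cast this
    rw [Nat.add_sub_add_right]
    push_cast
    linear_combination (-(x ^ (m - j) * y ^ (j + 1))) * h3
  have h3 : ∀ j : ℕ, (1 - (j : ℝ)) * ((m + 1).choose j : ℝ) * x ^ (m + 1 - j) * y ^ j =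
      ((m + 1).choose j : ℝ) * x ^ (m + 1 - j) * y ^ j
        - (j : ℝ) * ((m + 1).choose j : ℝ) * x ^ (m + 1 - j) * y ^ j := fun j => by ring
  simp only [h3, Finset.sum_sub_distrib, h1, h2]
  ring

/-- Take y = -w in `sum_one_sub_mul_choose` and split by parity. The index 0 gives the leading
power, the index 1 has coefficient zero, and the two sums starting at p = 1 collect the rest. -/
theorem cosmo_sum (x w : ℝ) (m : ℕ) :
    x ^ (m + 1) - ∑ p ∈ Icc 1 ((m + 1) / 2), (2 * (p : ℝ) - 1) * ((m + 1).choose (2 * p) : ℝ)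
        * x ^ (m + 1 - 2 * p) * w ^ (2 * p)
      + ∑ p ∈ Icc 1 (m / 2), 2 * (p : ℝ) * ((m + 1).choose (2 * p + 1) : ℝ)
        * x ^ (m + 1 - 2 * p - 1) * w ^ (2 * p + 1) =
      (x - w) ^ m * (x - w + (m + 1) * w) := by
  have h := sum_one_sub_mul_choose x (-w) m
  rw [sum_range_even_odd _ (m + 1), show (m + 1 + 1) / 2 = m / 2 + 1 by omega,
    Finset.sum_range_succ', Finset.sum_range_succ' (n := m / 2)] at h
  rw [sum_Icc_one, sum_Icc_one]
  have e1 : ∑ p ∈ range ((m + 1) / 2), (2 * ((p + 1 : ℕ) : ℝ) - 1) *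
      ((m + 1).choose (2 * (p + 1)) : ℝ) * x ^ (m + 1 - 2 * (p + 1)) * w ^ (2 * (p + 1)) =
      -∑ p ∈ range ((m + 1) / 2), (1 - ((2 * (p + 1) : ℕ) : ℝ)) *
      ((m + 1).choose (2 * (p + 1)) : ℝ) * x ^ (m + 1 - 2 * (p + 1)) * (-w) ^ (2 * (p + 1)) := by
    rw [← Finset.sum_neg_distrib]
    refine Finset.sum_congr rfl fun p _ => ?_
    rw [Even.neg_pow ⟨p + 1, by ring⟩]
    push_cast
    ring
  have e2 : ∑ p ∈ range (m / 2), 2 * ((p + 1 : ℕ) : ℝ) *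
      ((m + 1).choose (2 * (p + 1) + 1) : ℝ) * x ^ (m + 1 - 2 * (p + 1) - 1)
        * w ^ (2 * (p + 1) + 1) =
      ∑ p ∈ range (m / 2), (1 - ((2 * (p + 1) + 1 : ℕ) : ℝ)) *
      ((m + 1).choose (2 * (p + 1) + 1) : ℝ) * x ^ (m + 1 - (2 * (p + 1) + 1))
        * (-w) ^ (2 * (p + 1) + 1) := by
    refine Finset.sum_congr rfl fun p _ => ?_
    rw [Odd.neg_pow ⟨p + 1, rfl⟩, Nat.sub_sub]
    push_cast
    ring
  rw [e1, e2]
  simp only [mul_zero, Nat.cast_zero, Nat.choose_zero_right, Nat.cast_one, pow_zero, Nat.sub_zero,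
    zero_add, sub_self, zero_mul, add_zero, sub_zero, one_mul, mul_one] at h
  linear_combination h

/-- The factor D (D - 1) / (D - 2) turns 2 q into w = 2 d (A - B), the multiple for which R - w = d
(d + 1) B is free of A. In the closed form of `cosmo_sum` only the last factor then contains A. -/
theorem reduced_cosmo_succ (hd : 2 ≤ d) (m : ℕ) (A B : ℝ) :
    reduced (cosmo (d + 1) (m + 1)) (A, B) =
      ((d : ℝ) * (d + 1)) ^ m * d * (d + 1 - 2 * (m + 1)) * B ^ (m + 1)
        + A * (((d : ℝ) * (d + 1)) ^ m * d * (2 * (m + 1)) * B ^ m) := by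
  have hD : (d : ℝ) + 1 ≠ 0 := by positivity
  have hd1 : (d : ℝ) - 1 ≠ 0 := by
    have : (2 : ℝ) ≤ d := by exact_mod_cast hd
    intro h
    linarith
  simp only [reduced, cosmo, K2_frame hd, K3_frame hd, ricciScalar_frame]
  have hc : (((d + 1 : ℕ) : ℝ) * (((d + 1 : ℕ) : ℝ) - 1) / (((d + 1 : ℕ) : ℝ) - 2)) *
      (2 * ((d - 1) * (A - B) / (d + 1))) = 2 * d * (A - B) := by
    have hd2 : (d : ℝ) + 1 - 2 ≠ 0 := by
      intro h
      apply hd1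
      linarith
    push_cast
    field_simp
    ring
  generalize ((d + 1 : ℕ) : ℝ) * (((d + 1 : ℕ) : ℝ) - 1) / (((d + 1 : ℕ) : ℝ) - 2) = c at hc ⊢
  generalize ((d : ℝ) - 1) * (A - B) / (d + 1) = q at hc ⊢
  have h := cosmo_sum (2 * d * A + d * (d - 1) * B) (2 * d * (A - B)) m
  rw [show 2 * d * A + d * (d - 1) * B - 2 * d * (A - B) = d * (d + 1) * B by ring, ← hc] at h
  have e1 : ∀ (p n : ℕ) (x : ℝ), (2 * (p : ℝ) - 1) * (n.choose (2 * p) : ℝ) * c ^ (2 * p) * x *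
      (4 * q ^ 2) ^ p = (2 * (p : ℝ) - 1) * (n.choose (2 * p) : ℝ) * x * (c * (2 * q)) ^ (2 * p) := by
    intro p n x
    rw [show (4 : ℝ) * q ^ 2 = (2 * q) ^ 2 by ring, ← pow_mul, mul_pow c]
    ring
  -- The coefficient 16 comes from 16 q³ (2q)^(2p-2) = 2 (2q)^(2p+1); the sign of `K3` makes the odd
  -- terms enter with a plus.
  have e2 : ∀ p ∈ Icc 1 (m / 2), ∀ (n : ℕ) (x : ℝ), 16 * (p : ℝ) * (n.choose (2 * p + 1) : ℝ) *
      c ^ (2 * p + 1) * x * (4 * q ^ 2) ^ (p - 1) * -q ^ 3 =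
      -(2 * (p : ℝ) * (n.choose (2 * p + 1) : ℝ) * x * (c * (2 * q)) ^ (2 * p + 1)) := by
    intro p hp n x
    rw [Finset.mem_Icc] at hp
    obtain ⟨r, rfl⟩ : ∃ r, p = r + 1 := ⟨p - 1, by omega⟩
    rw [Nat.add_sub_cancel, show (4 : ℝ) * q ^ 2 = (2 * q) ^ 2 by ring, ← pow_mul, mul_pow c]
    ring
  simp only [e1]
  rw [Nat.add_sub_cancel, Finset.sum_congr rfl fun p hp => e2 p hp _ _, Finset.sum_neg_distrib,
    sub_neg_eq_add, h, hc, mul_pow ((d : ℝ) * (d + 1)) B m]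
  ring

theorem reduced_cosmo_zero (A B : ℝ) : reduced (cosmo (d + 1) 0) (A, B) = 1 := by
  simp [reduced, cosmo]

end Cosmo

/-! ### Homogeneity and the classification at each order. -/

section Classification

open Polynomial

variable {d n : ℕ} {L : Lagrangian (d + 1)}

theorem reduced_mul (h : L ∈ curvatureInvariants (d + 1) n) (c A B : ℝ) :
    reduced L (c * A, c * B) = c ^ n * reduced L (A, B) := by
  rw [reduced, reduced, ← homogeneous_of_mem h]
  congr 1
  simp only [isoRiemann, smul_sub, smul_smul]

theorem reduced_sum {ι : Type*} (s : Finset ι) (L : ι → Lagrangian (d + 1)) (x : ℝ × ℝ) :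
    reduced (∑ i ∈ s, L i) x = ∑ i ∈ s, reduced (L i) x := by
  simp only [reduced, Finset.sum_apply]

theorem reduced_smul (c : ℝ) (L : Lagrangian (d + 1)) (x : ℝ × ℝ) :
    reduced (c • L) x = c * reduced L x := rfl

/-- Linearity in the time-space curvature at unit spatial curvature. -/
def IsAffine (L : Lagrangian (d + 1)) : Prop :=
  ∀ A, reduced L (A, 1) = reduced L (0, 1) + A * (reduced L (1, 1) - reduced L (0, 1))

theorem IsAffine.smul (h : IsAffine L) (c : ℝ) : IsAffine (c • L) := fun A => by
  rw [reduced_smul, reduced_smul, reduced_smul, h A]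
  ring

/-- Scaling moves any B ≠ 0 to B = 1, and continuity covers B = 0. At order zero the reduced
Lagrangian is constant, so the slope is zero and the truncated exponent n - 1 is harmless. -/
theorem IsAffine.reduced_eq (hL : L ∈ curvatureInvariants (d + 1) n) (h : IsAffine L) (A B : ℝ) :
    reduced L (A, B) = (monomial n (reduced L (0, 1))).eval B
      + A * (monomial (n - 1) (reduced L (1, 1) - reduced L (0, 1))).eval B := by
  simp only [eval_monomial]
  cases n with
  | zero =>
    have hc : ∀ A B, reduced L (A, B) = reduced L (0, 0) := fun A B => by
      simpa using (reduced_mul hL 0 A B).symm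
    rw [hc A, hc 0 1, hc 1 1]
    simp
  | succ n =>
    have hB : ∀ B : ℝ, B ≠ 0 → reduced L (A, B) = reduced L (0, 1) * B ^ (n + 1)
        + A * ((reduced L (1, 1) - reduced L (0, 1)) * B ^ n) := by
      intro B hB
      have h1 := reduced_mul hL B (A / B) 1
      rw [mul_div_cancel₀ _ hB, mul_one, h (A / B)] at h1
      rw [h1]
      field_simp
      ring
    have hcont : Continuous fun B : ℝ => reduced L (A, B) :=
      (isInvariant_of_mem hL).contDiff_reduced.continuous.comp (by fun_prop)
    have := Continuous.ext_on (dense_compl_singleton (0 : ℝ)) hcont (by fun_prop) hB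
    exact congrFun this B

theorem isAffine_of_isCosmological (hd : 2 ≤ d) (hL : L ∈ curvatureInvariants (d + 1) n)
    (hc : IsCosmological L) : IsAffine L := fun A =>
  (isInvariant_of_mem hL).reduced_affine hd hc A one_pos

theorem isInvariant_sum {L : ℕ → Lagrangian (d + 1)} (hL : IsExpansion L) (s : Finset ℕ) :
    IsInvariant (∑ n ∈ s, L n) := IsInvariant.sum fun n _ => isInvariant_of_mem (hL n)

/-- At (x A, x) the n-th order scales as xⁿ, so the deviation of the sum from affinity is a
polynomial in x. It vanishes for all x > 0, hence so do its coefficients, which are the deviations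
of the single orders. -/
theorem isAffine_of_sum_isCosmological (hd : 2 ≤ d) {L : ℕ → Lagrangian (d + 1)}
    (hL : IsExpansion L) {N : ℕ} (hc : IsCosmological (∑ n ∈ range (N + 1), L n)) (hn : n ≤ N) :
    IsAffine (L n) := by
  intro A
  set f : ℕ → ℝ := fun n => reduced (L n) (A, 1)
    - (reduced (L n) (0, 1) + A * (reduced (L n) (1, 1) - reduced (L n) (0, 1))) with hf
  have hroot : ∀ x : ℝ, 0 < x → (∑ n ∈ range (N + 1), monomial n (f n)).eval x = 0 := by
    intro x hx
    have h := (isInvariant_sum hL (range (N + 1))).reduced_affine hd hc (x * A) hx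
    have h1 := (isInvariant_sum hL (range (N + 1))).reduced_affine hd hc x hx
    have e : ∀ n A, reduced (L n) (x * A, x) = x ^ n * reduced (L n) (A, 1) := fun n A => by
      simpa using reduced_mul (hL n) x A 1
    have e0 : ∀ n, reduced (L n) (0, x) = x ^ n * reduced (L n) (0, 1) := fun n => by
      simpa using reduced_mul (hL n) x 0 1
    have e1 : ∀ n, reduced (L n) (x, x) = x ^ n * reduced (L n) (1, 1) := fun n => by
      simpa using reduced_mul (hL n) x 1 1
    -- Affinity at first argument x is used to rewrite the slope, so that only quantities with a
    -- definite scaling weight remain.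
    have h2 : reduced (∑ n ∈ range (N + 1), L n) (x * A, x) -
        (reduced (∑ n ∈ range (N + 1), L n) (0, x) + A *
          (reduced (∑ n ∈ range (N + 1), L n) (x, x)
            - reduced (∑ n ∈ range (N + 1), L n) (0, x))) = 0 := by
      linear_combination h - A * h1
    simp only [reduced_sum, e, e0, e1] at h2
    rw [eval_finsetSum, ← h2, ← Finset.sum_sub_distrib, Finset.mul_sum, ← Finset.sum_add_distrib,
      ← Finset.sum_sub_distrib]
    refine Finset.sum_congr rfl fun n _ => ?_
    rw [eval_monomial, hf]
    ring
  have hzero : ∑ n ∈ range (N + 1), monomial n (f n) = 0 :=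
    eq_zero_of_infinite_isRoot _ ((Set.Ioi_infinite (0 : ℝ)).mono fun x hx => hroot x hx)
  have hcoeff := congrArg (fun p => p.coeff n) hzero
  simp only [finsetSum_coeff, coeff_monomial, coeff_zero] at hcoeff
  rw [Finset.sum_ite_eq' (range (N + 1)) n f, if_pos (Finset.mem_range.mpr (by omega))] at hcoeff
  exact sub_eq_zero.mp hcoeff

/-! ### The second-order equations -/

theorem friedmannEq_monomial (n : ℕ) (c : ℝ) :
    (friedmannEq (monomial n c) : FLRWEvent d → _) = c • friedmannEq (monomial n 1) := by
  funext p
  ext i j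
  refine Fin.cases ?_ (fun i => ?_) i <;> refine Fin.cases ?_ (fun j => ?_) j <;>
    simp [friedmannEq, derivative_monomial, eval_monomial] <;> ring

/-- On the flat slicing with a = exp t and F = 1 one has B = 1, and the time-time component is 1/2.
-/
theorem friedmannEq_monomial_one_ne_zero (n : ℕ) :
    (friedmannEq (monomial n 1) : FLRWEvent d → _) ≠ 0 := by
  intro h
  have h1 := congrFun (congrFun (congrFun h (expEvent d 1 0 0)) 0) 0
  simp [friedmannEq, expEvent, curvB_expScale, eval_monomial] at h1

theorem friedmannEq_monomial_eq_zero_iff {c : ℝ} :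
    (friedmannEq (monomial n c) : FLRWEvent d → _) = 0 ↔ c = 0 := by
  rw [friedmannEq_monomial, smul_eq_zero, or_iff_left (friedmannEq_monomial_one_ne_zero n)]

theorem secondOrder_friedmannEq (h : ℝ[X]) : SecondOrder (friedmannEq h : FLRWEvent d → _) := by
  intro p q hk hy ha hF
  have hB : curvB p.k p.a p.F (p.y 0) = curvB q.k q.a q.F (q.y 0) := by
    simp only [curvB, ← hk, ← hy, ha.1, ha.2.1, hF.1]
  have hA : curvA p.a p.F (p.y 0) = curvA q.a q.F (q.y 0) := by
    have h2 := ha.2.2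
    simp only [iteratedDeriv_succ, iteratedDeriv_zero] at h2
    simp only [curvA, ← hy, ha.1, ha.2.1, hF.1, hF.2.1, h2]
  simp only [friedmannEq, hA, hB]
  rw [← hk, ← hy, ha.1, hF.1]

theorem flrwEq_of_isAffine (hd : 2 ≤ d) (hL : L ∈ curvatureInvariants (d + 1) n)
    (h : IsAffine L) : flrwEq L = friedmannEq (monomial n (reduced L (0, 1))) :=
  (isInvariant_of_mem hL).flrwEq_of_affine hd (h.reduced_eq hL)

theorem flrwEq_sum_of_isAffine (hd : 2 ≤ d) {L : ℕ → Lagrangian (d + 1)} (hL : IsExpansion L)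
    {s : Finset ℕ} (h : ∀ n ∈ s, IsAffine (L n)) :
    flrwEq (∑ n ∈ s, L n) = friedmannEq (∑ n ∈ s, monomial n (reduced (L n) (0, 1))) := by
  refine (isInvariant_sum hL s).flrwEq_of_affine hd
    (g := ∑ n ∈ s, monomial (n - 1) (reduced (L n) (1, 1) - reduced (L n) (0, 1)))
    fun A B => ?_
  rw [reduced_sum, eval_finsetSum, eval_finsetSum, Finset.mul_sum, ← Finset.sum_add_distrib]
  exact Finset.sum_congr rfl fun n hn => (h n hn).reduced_eq (hL n) A B

theorem isCosmological_of_isAffine (hd : 2 ≤ d) (hL : L ∈ curvatureInvariants (d + 1) n)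
    (h : IsAffine L) : IsCosmological L := by
  rw [IsCosmological, flrwEq_of_isAffine hd hL h]
  exact secondOrder_friedmannEq _

theorem isTrivial_iff_of_isAffine (hd : 2 ≤ d) (hL : L ∈ curvatureInvariants (d + 1) n)
    (h : IsAffine L) : IsTrivial L ↔ reduced L (0, 1) = 0 := by
  rw [IsTrivial, flrwEq_of_isAffine hd hL h, friedmannEq_monomial_eq_zero_iff]

/-- In the critical dimension a second-order invariant has no field equations. -/
theorem IsAffine.reduced_eq_zero (hd : 2 ≤ d) (hL : L ∈ curvatureInvariants (d + 1) n)
    (h : IsAffine L) (hn : d + 1 = 2 * n) : reduced L (0, 1) = 0 := by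
  -- At B = 1, for h = α Bⁿ and g = β Bⁿ⁻¹, the constraint is (d - 1) β = 2 (n α + (n - 1) β). When
  -- d + 1 = 2n the β terms cancel and leave n α = 0.
  have hc := (isInvariant_of_mem hL).affine_constraint hd (h.reduced_eq hL) 1
  obtain ⟨m, rfl⟩ : ∃ m, n = m + 1 := ⟨n - 1, by omega⟩
  simp only [derivative_monomial, eval_monomial, one_pow, mul_one, Nat.add_sub_cancel, one_mul] at hc
  have hdr : (d : ℝ) + 1 = 2 * (m + 1) := by exact_mod_cast hn
  have h2 : ((m : ℝ) + 1) * reduced L (0, 1) = 0 := by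
    push_cast at hc
    linear_combination (-1 / 2) * hc + (1 / 2) * (reduced L (1, 1) - reduced L (0, 1)) * hdr
  exact (mul_eq_zero.mp h2).resolve_left (by positivity)

/-! ### The representatives -/

theorem isAffine_cosmo (hd : 2 ≤ d) (n : ℕ) : IsAffine (cosmo (d + 1) n) := by
  intro A
  cases n with
  | zero => simp [reduced_cosmo_zero]
  | succ m =>
    simp only [reduced_cosmo_succ hd]
    ring

theorem reduced_cosmo_eq_zero_iff (hd : 2 ≤ d) (n : ℕ) :
    reduced (cosmo (d + 1) n) (0, 1) = 0 ↔ d + 1 = 2 * n := by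
  cases n with
  | zero => simp [reduced_cosmo_zero]
  | succ m =>
    have hd0 : (d : ℝ) ≠ 0 := by positivity
    have hD : (d : ℝ) + 1 ≠ 0 := by positivity
    rw [reduced_cosmo_succ hd, ← Nat.cast_inj (R := ℝ)]
    simp [hd0, hD, sub_eq_zero]

/-- The coupling of `C^{(n)}` in the expansion `cosmoExpansion`. -/
def cosmoCoupling (lam ell : ℝ) (mu : ℕ → ℝ) : ℕ → ℝ
  | 0 => -2 * lam
  | p + 1 => mu (p + 1) * ell ^ (2 * p)

theorem cosmoExpansion_eq (D : ℕ) (lam ell : ℝ) (mu : ℕ → ℝ) (n : ℕ) :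
    cosmoExpansion D lam ell mu n = cosmoCoupling lam ell mu n • cosmo D n := by
  cases n with
  | zero =>
    funext G R
    simp [cosmoExpansion, cosmoCoupling, cosmo]
  | succ p => rfl

theorem exists_cosmoCoupling {ell : ℝ} (hl : 0 < ell) (c : ℕ → ℝ) :
    ∃ (lam : ℝ) (mu : ℕ → ℝ), cosmoCoupling lam ell mu = c := by
  -- The value of `mu` at 0 is never used, so the truncated subtraction in its exponent does not
  -- matter.
  refine ⟨-c 0 / 2, fun n => c n / ell ^ (2 * (n - 1)), ?_⟩
  funext n
  cases n with
  | zero =>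
    rw [cosmoCoupling]
    ring
  | succ p =>
    rw [cosmoCoupling, Nat.add_sub_cancel]
    field_simp

theorem isExpansion_cosmoExpansion (d : ℕ) (lam ell : ℝ) (mu : ℕ → ℝ) :
    IsExpansion (cosmoExpansion (d + 1) lam ell mu) := fun n => by
  rw [cosmoExpansion_eq]
  exact Submodule.smul_mem _ _ (cosmo_mem d.succ_ne_zero n)

theorem isAffine_cosmoExpansion (hd : 2 ≤ d) (lam ell : ℝ) (mu : ℕ → ℝ) (n : ℕ) :
    IsAffine (cosmoExpansion (d + 1) lam ell mu n) := by
  rw [cosmoExpansion_eq]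
  exact (isAffine_cosmo hd n).smul _

/-- Couplings that reproduce the field equations of a second-order expansion. -/
theorem exists_couplings (hd : 2 ≤ d) {ell : ℝ} (hl : 0 < ell) {L : ℕ → Lagrangian (d + 1)}
    (hL : IsExpansion L) : ∃ (lam : ℝ) (mu : ℕ → ℝ), ∀ n, IsAffine (L n) →
      reduced (cosmoExpansion (d + 1) lam ell mu n) (0, 1) = reduced (L n) (0, 1) := by
  obtain ⟨lam, mu, h⟩ := exists_cosmoCoupling hl fun n =>
    reduced (L n) (0, 1) / reduced (cosmo (d + 1) n) (0, 1)
  refine ⟨lam, mu, fun n hn => ?_⟩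
  rw [cosmoExpansion_eq, h, reduced_smul]
  -- In the critical dimension the chosen coupling is a division by zero; its value is irrelevant
  -- because both reduced constants vanish.
  by_cases h0 : reduced (cosmo (d + 1) n) (0, 1) = 0
  · rw [h0, mul_zero, hn.reduced_eq_zero hd (hL n) ((reduced_cosmo_eq_zero_iff hd n).mp h0)]
  · exact div_mul_cancel₀ _ h0

/-- A repeated vector is linearly dependent, also when it is zero. This suffices for the expansions,
where couplings are chosen to give identical equations. -/
theorem equivEq_refl {V : Type*} [AddCommGroup V] [Module ℝ V] (E : FLRWEvent d → V) :
    EquivEq E E := by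
  refine ⟨Iff.rfl, fun h => ?_⟩
  have := h.injective (a₁ := 0) (a₂ := 1) rfl
  exact absurd this (by decide)

theorem equivalent_cosmo (hd : 2 ≤ d) (hL : L ∈ curvatureInvariants (d + 1) n)
    (hc : IsCosmological L) (ht : ¬ IsTrivial L) : Equivalent L (cosmo (d + 1) n) := by
  have h := isAffine_of_isCosmological hd hL hc
  have h1 : reduced L (0, 1) ≠ 0 := fun h0 => ht ((isTrivial_iff_of_isAffine hd hL h).mpr h0)
  have h2 : reduced (cosmo (d + 1) n) (0, 1) ≠ 0 := fun h0 =>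
    h1 (h.reduced_eq_zero hd hL ((reduced_cosmo_eq_zero_iff hd n).mp h0))
  rw [Equivalent, flrwEq_of_isAffine hd hL h,
    flrwEq_of_isAffine hd (cosmo_mem d.succ_ne_zero n) (isAffine_cosmo hd n), EquivEq,
    friedmannEq_monomial_eq_zero_iff, friedmannEq_monomial_eq_zero_iff]
  refine ⟨iff_of_false h1 h2, fun hli => h2 ?_⟩
  -- Both equations are multiples of the same monomial equation; cross-multiplying their constants
  -- gives a relation whose first coefficient is non-zero.
  refine (LinearIndependent.pair_iff.mp hli _ (-reduced L (0, 1)) ?_).1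
  rw [friedmannEq_monomial, friedmannEq_monomial n (reduced (cosmo (d + 1) n) (0, 1)), smul_smul,
    smul_smul, ← add_smul]
  rw [show reduced (cosmo (d + 1) n) (0, 1) * reduced L (0, 1)
    + -reduced L (0, 1) * reduced (cosmo (d + 1) n) (0, 1) = 0 by ring, zero_smul]

theorem SecondOrder.order {L : ℕ → Lagrangian (d + 1)} (h : SecondOrder (flrwEqSeries L)) (n : ℕ) :
    IsCosmological (L n) := fun p q hk hy ha hF => congrFun (h p q hk hy ha hF) n

end Classification

end CosmoGravity

/-! ### The classification theorem. -/

theorem theorem1 (d : ℕ) (hd : 2 ≤ d) :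
    -- each curvature order, in spacetime dimension `D = d + 1 ≥ 3`
    (∀ n : ℕ,
      cosmo (d + 1) n ∈ curvatureInvariants (d + 1) n ∧
      IsCosmological (cosmo (d + 1) n) ∧
      (IsTrivial (cosmo (d + 1) n) ↔ d + 1 = 2 * n) ∧
      (∀ L ∈ curvatureInvariants (d + 1) n, IsCosmological L → ¬ IsTrivial L →
        Equivalent L (cosmo (d + 1) n))) ∧
    -- theories truncated at a finite curvature order
    (∀ ell : ℝ, 0 < ell → ∀ N : ℕ,
      (∀ (lam : ℝ) (mu : ℕ → ℝ),
        IsCosmological (∑ n ∈ Finset.range (N + 1), cosmoExpansion (d + 1) lam ell mu n)) ∧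
      (∀ L : ℕ → Lagrangian (d + 1), IsExpansion L →
        IsCosmological (∑ n ∈ Finset.range (N + 1), L n) →
        ∃ (lam : ℝ) (mu : ℕ → ℝ), Equivalent (∑ n ∈ Finset.range (N + 1), L n)
          (∑ n ∈ Finset.range (N + 1), cosmoExpansion (d + 1) lam ell mu n))) ∧
    -- infinite expansions in the curvature
    (∀ ell : ℝ, 0 < ell →
      (∀ (lam : ℝ) (mu : ℕ → ℝ),
        IsExpansion (cosmoExpansion (d + 1) lam ell mu) ∧
        SecondOrder (flrwEqSeries (cosmoExpansion (d + 1) lam ell mu))) ∧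
      (∀ L : ℕ → Lagrangian (d + 1), IsExpansion L → SecondOrder (flrwEqSeries L) →
        ∃ (lam : ℝ) (mu : ℕ → ℝ),
          EquivEq (flrwEqSeries L) (flrwEqSeries (cosmoExpansion (d + 1) lam ell mu)))) := by
  refine ⟨fun n => ?_, fun ell hl N => ⟨fun lam mu => ?_, fun L hL hc => ?_⟩,
    fun ell hl => ⟨fun lam mu => ⟨isExpansion_cosmoExpansion d lam ell mu, ?_⟩, fun L hL hc => ?_⟩⟩
  · have hm := cosmo_mem d.succ_ne_zero n
    have ha := isAffine_cosmo hd n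
    exact ⟨hm, isCosmological_of_isAffine hd hm ha,
      (isTrivial_iff_of_isAffine hd hm ha).trans (reduced_cosmo_eq_zero_iff hd n),
      fun L hL hc ht => equivalent_cosmo hd hL hc ht⟩
  · rw [IsCosmological, flrwEq_sum_of_isAffine hd (isExpansion_cosmoExpansion d lam ell mu)
      fun n _ => isAffine_cosmoExpansion hd lam ell mu n]
    exact secondOrder_friedmannEq _
  · obtain ⟨lam, mu, h⟩ := exists_couplings hd hl hL
    -- Only the total is assumed to be of second order; the different scaling weights exclude
    -- cancellations between orders.
    have ha : ∀ n ∈ Finset.range (N + 1), IsAffine (L n) := fun n hn =>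
      isAffine_of_sum_isCosmological hd hL hc (Finset.mem_range_succ_iff.mp hn)
    refine ⟨lam, mu, ?_⟩
    rw [Equivalent, flrwEq_sum_of_isAffine hd hL ha,
      flrwEq_sum_of_isAffine hd (isExpansion_cosmoExpansion d lam ell mu)
        fun n _ => isAffine_cosmoExpansion hd lam ell mu n,
      Finset.sum_congr rfl fun n hn => by rw [← h n (ha n hn)]]
    exact equivEq_refl _
  · intro p q hk hy ha hF
    funext n
    exact isCosmological_of_isAffine hd (isExpansion_cosmoExpansion d lam ell mu n)
      (isAffine_cosmoExpansion hd lam ell mu n) p q hk hy ha hF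
  · obtain ⟨lam, mu, h⟩ := exists_couplings hd hl hL
    have ha : ∀ n, IsAffine (L n) := fun n => isAffine_of_isCosmological hd (hL n) (hc.order n)
    refine ⟨lam, mu, ?_⟩
    have hE : flrwEqSeries (cosmoExpansion (d + 1) lam ell mu) = flrwEqSeries L := by
      funext p n
      rw [flrwEqSeries, flrwEqSeries, flrwEq_of_isAffine hd (hL n) (ha n),
        flrwEq_of_isAffine hd (isExpansion_cosmoExpansion d lam ell mu n)
          (isAffine_cosmoExpansion hd lam ell mu n), h n (ha n)]
    rw [hE]
    exact equivEq_refl _
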